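/- Let $m\ge 2$ and let $x:\Sigma^m\to\mathbb{R}^{m+1}$ be a translator for the mean curvature flow, that is, a smooth isometric immersion of a complete Riemannian manifold $\Sigma$ of dimension $m$ (without boundary, second countable) such that $\mathbf{H}=\bar E_{m+1}^{\perp}$. Here $\mathbf{H}$ is the mean curvature vector (the trace of the second fundamental form, not divided by $m$), $\bar E_{m+1}$ is the last vector of the standard basis of $\mathbb{R}^{m+1}$, and $(\cdot)^\perp$ is the orthogonal projection onto the normal space of $\Sigma$. Let $f=-x_{m+1}$, let $H^2=|\mathbf{H}|^2$, and let $d\mathrm{vol}_\Sigma$ be the Riemannian volume measure of $\Sigma$. Then: (a) for every $\varphi\in C_c^\infty(\Sigma)$ the following integrals are finite and $$\frac14\int_\Sigma \varphi^2e^{-f}\,d\mathrm{vol}_\Sigma\;\le\;\frac14\int_\Sigma(1+H^2)\varphi^2e^{-f}\,d\mathrm{vol}_\Sigma\;\le\;\int_\Sigma|\nabla\varphi|^2e^{-f}\,d\mathrm{vol}_\Sigma;$$ (b) every end $E$ of $\Sigma$ has infinite $f$-volume, that is, $\int_E e^{-f}\,d\mathrm{vol}_\Sigma=+\infty$ whenever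 $E$ is a connected component of $\Sigma\setminus K$ that is not relatively compact in $\Sigma$, for some compact set $K\subset\Sigma$. -/

import Mathlib

open MeasureTheory Set Bundle
open scoped Manifold ContDiff

attribute [local instance 2000] chartedSpaceSelf

noncomputable section

namespace Hypersurface

/-- Euclidean space `ℝⁿ`. -/
abbrev Euc (n : ℕ) : Type := EuclideanSpace ℝ (Fin n)

section Riemannian

variable {m : ℕ} {M : Type*} [TopologicalSpace M] [ChartedSpace (Euc m) M]

instance finiteDimensional_tangentSpace (p : M) :
    FiniteDimensional ℝ (TangentSpace (𝓡 m) p) :=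
  inferInstanceAs (FiniteDimensional ℝ (Euc m))

variable [RiemannianBundle (fun p : M => TangentSpace (𝓡 m) p)]

instance completeSpace_tangentSpace (p : M) : CompleteSpace (TangentSpace (𝓡 m) p) :=
  FiniteDimensional.complete ℝ _

/-- The Riemannian gradient `∇φ(p)`: the tangent vector that represents the differential of `φ`
at `p` through the Riemannian metric. -/
def riemGradient (φ : M → ℝ) (p : M) : TangentSpace (𝓡 m) p :=
  (InnerProductSpace.toDual ℝ (TangentSpace (𝓡 m) p)).symm
    (mfderiv (𝓡 m) 𝓘(ℝ, ℝ) φ p : TangentSpace (𝓡 m) p →L[ℝ] ℝ)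

/-- The coordinate vector field `∂ᵢ` of the chart around `p`, at the point with coordinates `y`. -/
def coordVector (p : M) (y : Euc m) (i : Fin m) :
    TangentSpace (𝓡 m) ((extChartAt (𝓡 m) p).symm y) :=
  mfderiv 𝓘(ℝ, Euc m) (𝓡 m) (extChartAt (𝓡 m) p).symm y (EuclideanSpace.single i (1 : ℝ) : Euc m)

/-- The matrix `gᵢⱼ = ⟨∂ᵢ, ∂ⱼ⟩` of the metric in the chart around `p`, at the point with
coordinates `y`. -/
def gramMatrix (p : M) (y : Euc m) : Matrix (Fin m) (Fin m) ℝ :=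
  Matrix.of fun i j => inner ℝ (coordVector p y i) (coordVector p y j)

variable [MeasurableSpace M]

/-- The volume `√(det gᵢⱼ) dy¹ ⋯ dyᵐ` of the domain of the chart around `p`, as a measure on `M`
that vanishes outside this domain. -/
def chartVolume (p : M) : Measure M :=
  ((volume.restrict (extChartAt (𝓡 m) p).target).withDensity
    fun y => ENNReal.ofReal √(gramMatrix p y).det).map (extChartAt (𝓡 m) p).symm

variable (m M) in
/-- The Riemannian volume measure. The measures `chartVolume p` agree on the overlaps of the
charts, so that their supremum is the measure that restricts to `chartVolume p` on the domain of
the chart around each `p`. -/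
def riemannianVolume : Measure M := ⨆ p : M, chartVolume (m := m) p

variable (m) in
/-- The weighted volume `vol_f(A) = ∫_A e^{-f} dvol`. -/
def weightedVolume (f : M → ℝ) (A : Set M) : ENNReal :=
  ∫⁻ p in A, ENNReal.ofReal (Real.exp (-f p)) ∂riemannianVolume m M

end Riemannian

/-- An end of `M` with respect to some compact set `K`: a connected component of `M \ K` that is
not relatively compact. -/
def IsEnd {M : Type*} [TopologicalSpace M] (E : Set M) : Prop :=
  ∃ K : Set M, IsCompact K ∧ (∃ p ∈ Kᶜ, E = connectedComponentIn Kᶜ p) ∧ ¬ IsCompact (closure E)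

section Immersion

variable {m : ℕ} {M : Type*} [TopologicalSpace M] [ChartedSpace (Euc m) M]

/-- The differential `dx_p : T_p M → ℝᵐ⁺¹`. -/
def differentialAt (x : M → Euc (m + 1)) (p : M) : TangentSpace (𝓡 m) p →L[ℝ] Euc (m + 1) :=
  mfderiv (𝓡 m) 𝓘(ℝ, Euc (m + 1)) x p

/-- The orthogonal projection of vectors of `ℝᵐ⁺¹` onto the normal space `(dx_p(T_p M))^⊥`. -/
def normalProj (x : M → Euc (m + 1)) (p : M) : Euc (m + 1) →L[ℝ] Euc (m + 1) :=
  (differentialAt x p).rangeᗮ.starProjection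

/-- The vector-valued second fundamental form `II_p(u, v)`: the normal part of the second
derivative of `x` along `u` and `v`. It is computed in the chart around `p`, through which
`TangentSpace (𝓡 m) p` is identified with `ℝᵐ`. -/
def secondFundamentalForm (x : M → Euc (m + 1)) (p : M) (u v : TangentSpace (𝓡 m) p) :
    Euc (m + 1) :=
  normalProj x p
    (fderiv ℝ (fderiv ℝ (x ∘ (extChartAt (𝓡 m) p).symm)) (extChartAt (𝓡 m) p p)
      (u : Euc m) (v : Euc m))

variable [RiemannianBundle (fun p : M => TangentSpace (𝓡 m) p)]

/-- The mean curvature vector `𝐇(p)`: the trace `∑ᵢ II_p(eᵢ, eᵢ)` over an orthonormal basis of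
`T_p M` (not divided by `m`). -/
def meanCurvatureVector (x : M → Euc (m + 1)) (p : M) : Euc (m + 1) :=
  ∑ i, secondFundamentalForm x p (stdOrthonormalBasis ℝ (TangentSpace (𝓡 m) p) i)
    (stdOrthonormalBasis ℝ (TangentSpace (𝓡 m) p) i)

/-- A smooth isometric immersion `x : M → ℝᵐ⁺¹`. -/
structure IsIsometricImmersion (x : M → Euc (m + 1)) : Prop where
  contMDiff : ContMDiff (𝓡 m) 𝓘(ℝ, Euc (m + 1)) ∞ x
  inner_differentialAt : ∀ (p : M) (u v : TangentSpace (𝓡 m) p),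
    inner ℝ (differentialAt x p u) (differentialAt x p v) = inner ℝ u v

/-- A translator: an isometrically immersed hypersurface with `𝐇 = E_{m+1}^⊥`. -/
structure IsTranslator (x : M → Euc (m + 1)) : Prop extends IsIsometricImmersion x where
  meanCurvatureVector_eq : ∀ p : M,
    meanCurvatureVector x p = normalProj x p (EuclideanSpace.single (Fin.last m) (1 : ℝ))

end Immersion

end Hypersurface

end
open Hypersurface

noncomputable section

set_option linter.unusedSectionVars false

/-! Write `h = x_{m+1}`, `μ = e^h dvol` and `Δ_f` for the Laplacian weighted by `μ`. The first
variation formula is the weak form of `Δxₖ = Hₖ`. On a translator `Hₖ = δₖ - ⟨∇h, ∇xₖ⟩`, with `δₖ =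
1` for the last coordinate and `0` otherwise, and the weight absorbs the gradient term: `Δ_f h = 1`,
and `Δ_f xₖ = 0` for all other coordinates (`IsTranslator.integral_inner_coordGradient`). Both
claims follow from this.

(a) Integrate `0 ≤ |∇φ + (φ/2)∇h|²` against `μ`. The cross term gives `-½∫φ² dμ`, and `|∇h|² = 1 -
H²` (`IsTranslator.weighted_poincare`).

(b) Suppose that an end `E` has finite `μ`-volume. The barrier `w = x₁² + ⋯ + x_m² - h` satisfies
`Δ_f w ≥ 2m - 3 ≥ 1`, and `|∇w|` grows at most linearly with the distance. Cutoffs of slope `1/R`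
therefore cost only a constant times the volume of the tail of `E`, which tends to `0`, and an
integral maximum principle bounds `w` on `E` by its values on the frontier
(`IsTranslator.barrier_le`). So `h` is bounded below on `E`. A monotonicity formula for `∫ (r - ρ)₊²
dμ`, with `ρ` the intrinsic distance, then bounds below the `μ`-volume of the unit balls in `E` away
from the frontier (`IsTranslator.densityConst_mul_exp_le`). By Hopf–Rinow `E` is unbounded, so such
balls occur arbitrarily far out, although the volume of the tails tends to `0`
(`IsTranslator.weightedMeasure_eq_top`). For `m = 1` the lower end of a vertical line has finite
volume.

Since `ρ` is only Lipschitz, the integral formulas are proved for functions that are Lipschitz in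
charts, with Rademacher's theorem in place of differentiability. -/

namespace Hypersurface

/-! ### Determinants and inverses of smooth families of matrices. -/

section Determinant

variable {E : Type*} [NormedAddCommGroup E] [NormedSpace ℝ E] {n : Type*} [Fintype n] [DecidableEq n]

/-- Jacobi's formula for the derivative of the determinant. -/
theorem hasFDerivAt_det {A : E → Matrix n n ℝ} {A' : n → n → E →L[ℝ] ℝ} {y : E}
    (h : ∀ i j, HasFDerivAt (fun z => A z i j) (A' i j) y) :
    HasFDerivAt (fun z => (A z).det) (∑ i, ∑ j, (A y).adjugate i j • A' j i) y := by
  have h1 : HasFDerivAt (fun z => ∑ σ : Equiv.Perm n, (Equiv.Perm.sign σ : ℝ) *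
      ∏ i, A z (σ i) i) (∑ σ : Equiv.Perm n, (Equiv.Perm.sign σ : ℝ) •
      ∑ i, (∏ j ∈ Finset.univ.erase i, A y (σ j) j) • A' (σ i) i) y :=
    HasFDerivAt.fun_sum fun σ _ =>
      (HasFDerivAt.finsetProd fun i _ => h (σ i) i).const_mul _
  have h2 : (fun z => (A z).det) = fun z => ∑ σ : Equiv.Perm n, (Equiv.Perm.sign σ : ℝ) *
      ∏ i, A z (σ i) i := by
    funext z; rw [Matrix.det_apply']
  rw [h2]
  convert h1 using 1
  ext v
  simp only [FunLike.coe_sum, Finset.sum_apply, FunLike.coe_smul, Pi.smul_apply, smul_eq_mul]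
  -- Cramer's rule: a row of the adjugate paired with a vector is the determinant with one column
  -- replaced. The Leibniz expansions of both sides then agree term by term.
  have h3 : ∀ i, ∑ j, (A y).adjugate i j * A' j i v =
      ((A y).updateCol i fun k => A' k i v).det := by
    intro i
    rw [← Matrix.cramer_apply, Matrix.cramer_eq_adjugate_mulVec]
    rfl
  simp_rw [h3, Matrix.det_apply', Finset.mul_sum]
  rw [Finset.sum_comm]
  refine Finset.sum_congr rfl fun σ _ => Finset.sum_congr rfl fun i _ => ?_
  rw [← Finset.mul_prod_erase _ _ (Finset.mem_univ i)]
  have h4 : ∏ j ∈ Finset.univ.erase i, ((A y).updateCol i fun k => A' k i v) (σ j) j =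
      ∏ j ∈ Finset.univ.erase i, A y (σ j) j :=
    Finset.prod_congr rfl fun j hj => by
      rw [Matrix.updateCol_apply, if_neg (Finset.ne_of_mem_erase hj)]
  rw [h4, Matrix.updateCol_self]
  ring

theorem contDiffAt_det {A : E → Matrix n n ℝ} {y : E} {k : WithTop ℕ∞}
    (h : ∀ i j, ContDiffAt ℝ k (fun z => A z i j) y) : ContDiffAt ℝ k (fun z => (A z).det) y := by
  have h2 : (fun z => (A z).det) = fun z => ∑ σ : Equiv.Perm n, (Equiv.Perm.sign σ : ℝ) *
      ∏ i, A z (σ i) i := by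
    funext z; rw [Matrix.det_apply']
  rw [h2]
  exact ContDiffAt.sum fun σ _ => contDiffAt_const.mul (contDiffAt_prod fun i _ => h (σ i) i)

/-- By Cramer's rule every entry of the inverse is a quotient of two determinants. -/
theorem contDiffAt_inv_apply {A : E → Matrix n n ℝ} {y : E} {k : WithTop ℕ∞}
    (h : ∀ i j, ContDiffAt ℝ k (fun z => A z i j) y) (h0 : (A y).det ≠ 0) (i j : n) :
    ContDiffAt ℝ k (fun z => (A z)⁻¹ i j) y := by
  have h2 : (fun z => (A z)⁻¹ i j) =
      fun z => (A z).det⁻¹ * ((A z).updateRow j (Pi.single i 1)).det := by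
    funext z
    rw [Matrix.inv_def, Matrix.smul_apply, Matrix.adjugate_apply, Ring.inverse_eq_inv', smul_eq_mul]
  rw [h2]
  refine ((contDiffAt_det h).inv h0).mul (contDiffAt_det fun a b => ?_)
  by_cases hab : a = j
  · subst hab
    simpa using contDiffAt_const
  · simpa [Matrix.updateRow_apply, hab] using h a b

end Determinant

/-! ### The Laplacian of the position vector of a parametrized submanifold. -/

section Parametrized

variable {m : ℕ} {F : Type*} [NormedAddCommGroup F] [InnerProductSpace ℝ F]

/-- The partial derivative `∂ᵢX`. -/
def partialDeriv {F : Type*} [NormedAddCommGroup F] [NormedSpace ℝ F]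
    (X : Euc m → F) (i : Fin m) (y : Euc m) : F :=
  fderiv ℝ X y (EuclideanSpace.single i 1)

/-- The Gram matrix of the partial derivatives of a parametrized submanifold. -/
def paramGram (X : Euc m → F) (y : Euc m) : Matrix (Fin m) (Fin m) ℝ :=
  Matrix.of fun i j => inner ℝ (partialDeriv X i y) (partialDeriv X j y)

variable {X : Euc m → F} {y : Euc m}

theorem paramGram_apply (i j : Fin m) :
    paramGram X y i j = inner ℝ (partialDeriv X i y) (partialDeriv X j y) := rfl

theorem paramGram_symm (i j : Fin m) : paramGram X y i j = paramGram X y j i :=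
  real_inner_comm _ _

theorem inv_paramGram_symm (i j : Fin m) : (paramGram X y)⁻¹ i j = (paramGram X y)⁻¹ j i := by
  have h : (paramGram X y).transpose = paramGram X y := by
    ext i j; exact paramGram_symm j i
  calc (paramGram X y)⁻¹ i j = ((paramGram X y).transpose)⁻¹ i j := by rw [h]
    _ = _ := by rw [← Matrix.transpose_nonsing_inv]; rfl

theorem contDiffAt_partialDeriv {F : Type*} [NormedAddCommGroup F] [NormedSpace ℝ F]
    {X : Euc m → F} {k : WithTop ℕ∞} (hX : ContDiffAt ℝ ∞ X y) (i : Fin m)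
    (hk : k + 1 ≤ ∞) : ContDiffAt ℝ k (partialDeriv X i) y :=
  (hX.fderiv_right hk).clm_apply contDiffAt_const

theorem contDiffAt_paramGram (hX : ContDiffAt ℝ ∞ X y) (i j : Fin m) :
    ContDiffAt ℝ ∞ (fun z => paramGram X z i j) y :=
  (contDiffAt_partialDeriv hX i le_rfl).inner ℝ (contDiffAt_partialDeriv hX j le_rfl)

/-- The coefficients `√(det g) gⁱʲ` of the Laplacian in divergence form. -/
def divCoeff (X : Euc m → F) (i j : Fin m) (y : Euc m) : ℝ :=
  √(paramGram X y).det * (paramGram X y)⁻¹ i j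

theorem contDiffAt_divCoeff (hX : ContDiffAt ℝ ∞ X y) (h0 : 0 < (paramGram X y).det)
    (i j : Fin m) : ContDiffAt ℝ ∞ (divCoeff X i j) y :=
  ((contDiffAt_det fun i j => contDiffAt_paramGram hX i j).sqrt h0.ne').mul
    (contDiffAt_inv_apply (fun i j => contDiffAt_paramGram hX i j) h0.ne' i j)

theorem partialDeriv_comm (hX : ContDiffAt ℝ ∞ X y) (i j : Fin m) :
    partialDeriv (partialDeriv X i) j y = partialDeriv (partialDeriv X j) i y := by
  have hd : DifferentiableAt ℝ (fderiv ℝ X) y :=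
    (hX.fderiv_right (m := ∞) le_rfl).differentiableAt (by simp)
  have h : ∀ i j : Fin m, partialDeriv (partialDeriv X i) j y =
      fderiv ℝ (fderiv ℝ X) y (EuclideanSpace.single j 1) (EuclideanSpace.single i 1) := by
    intro i j
    change fderiv ℝ (fun z => fderiv ℝ X z (EuclideanSpace.single i 1)) y _ = _
    rw [fderiv_clm_apply hd (differentiableAt_const _)]
    simp
  rw [h, h]
  exact (hX.isSymmSndFDerivAt (by
    simpa using WithTop.coe_le_coe.2 (le_top : (2 : ℕ∞) ≤ ⊤))).eq _ _

theorem partialDeriv_partialDeriv (hX : ContDiffAt ℝ ∞ X y) (i j : Fin m) :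
    partialDeriv (partialDeriv X j) i y =
      fderiv ℝ (fderiv ℝ X) y (EuclideanSpace.single i 1) (EuclideanSpace.single j 1) := by
  have hd : DifferentiableAt ℝ (fderiv ℝ X) y :=
    (hX.fderiv_right (m := ∞) le_rfl).differentiableAt (by simp)
  change fderiv ℝ (fun z => fderiv ℝ X z (EuclideanSpace.single j 1)) y _ = _
  rw [fderiv_clm_apply hd (differentiableAt_const _)]
  simp

theorem divCoeff_symm (i j : Fin m) : divCoeff X i j y = divCoeff X j i y := by
  rw [divCoeff, divCoeff, inv_paramGram_symm]

/-- This is `g⁻¹ g = 1`. It yields `⟨Vᵢ, ∂ₖX⟩ = √g δᵢₖ` for `Vᵢ = ∑ⱼ √g gⁱʲ ∂ⱼX`, from which the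
divergence formula is derived. -/
theorem sum_divCoeff_mul_paramGram (h0 : (paramGram X y).det ≠ 0) (i k : Fin m) :
    ∑ j, divCoeff X i j y * paramGram X y j k =
      √(paramGram X y).det * (1 : Matrix (Fin m) (Fin m) ℝ) i k := by
  rw [← Matrix.nonsing_inv_mul _ (isUnit_iff_ne_zero.2 h0), Matrix.mul_apply, Finset.mul_sum]
  exact Finset.sum_congr rfl fun j _ => by rw [divCoeff, mul_assoc]

/-- Jacobi's formula gives `∂ₖ√g = ½ √g gⁱʲ ∂ₖgᵢⱼ`. The two halves of `∂ₖ⟨∂ᵢX, ∂ⱼX⟩` contribute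
equally by symmetry, which cancels the `½`. -/
theorem partialDeriv_sqrt_det (hX : ContDiffAt ℝ ∞ X y) (h0 : 0 < (paramGram X y).det)
    (k : Fin m) :
    partialDeriv (fun z => √(paramGram X z).det) k y =
      ∑ i, ∑ j, divCoeff X i j y * inner ℝ (partialDeriv X j y)
        (partialDeriv (partialDeriv X k) i y) := by
  have hdX : ∀ i, DifferentiableAt ℝ (partialDeriv X i) y := fun i =>
    (contDiffAt_partialDeriv (k := ∞) hX i le_rfl).differentiableAt (by simp)
  have hG : ∀ i j, HasFDerivAt (fun z => paramGram X z i j) (fderiv ℝ (fun z => paramGram X z i j) y) y :=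
    fun i j => ((contDiffAt_paramGram hX i j).differentiableAt (by simp)).hasFDerivAt
  have hGd : ∀ i j, fderiv ℝ (fun z => paramGram X z i j) y (EuclideanSpace.single k 1) =
      inner ℝ (partialDeriv X i y) (partialDeriv (partialDeriv X j) k y) +
      inner ℝ (partialDeriv (partialDeriv X i) k y) (partialDeriv X j y) := by
    intro i j
    have := fderiv_inner_apply ℝ (hdX i) (hdX j) (EuclideanSpace.single k (1 : ℝ))
    exact this
  have h1 := (hasFDerivAt_det hG).sqrt h0.ne'
  rw [partialDeriv, h1.fderiv]
  simp only [FunLike.coe_sum, Finset.sum_apply, FunLike.coe_smul, Pi.smul_apply, smul_eq_mul, hGd]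
  have hs : √(paramGram X y).det ≠ 0 := (Real.sqrt_pos.2 h0).ne'
  have hadj : ∀ i j, (paramGram X y).adjugate i j = √(paramGram X y).det * divCoeff X i j y := by
    intro i j
    rw [divCoeff, ← mul_assoc, Real.mul_self_sqrt h0.le, Matrix.inv_def, Matrix.smul_apply,
      Ring.inverse_eq_inv', smul_eq_mul, mul_inv_cancel_left₀ h0.ne']
  have h2 : ∀ i j, (paramGram X y).adjugate i j *
      (inner ℝ (partialDeriv X j y) (partialDeriv (partialDeriv X i) k y) +
      inner ℝ (partialDeriv (partialDeriv X j) k y) (partialDeriv X i y)) =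
      √(paramGram X y).det * (divCoeff X i j y * inner ℝ (partialDeriv X j y)
        (partialDeriv (partialDeriv X k) i y)) +
      √(paramGram X y).det * (divCoeff X j i y * inner ℝ (partialDeriv X i y)
        (partialDeriv (partialDeriv X k) j y)) := by
    intro i j
    rw [hadj, partialDeriv_comm hX k i, partialDeriv_comm hX k j, divCoeff_symm j i,
      real_inner_comm (partialDeriv X i y)]
    ring
  simp_rw [h2, Finset.sum_add_distrib]
  rw [Finset.sum_comm (f := fun i j => √(paramGram X y).det * (divCoeff X j i y * inner ℝ
    (partialDeriv X i y) (partialDeriv (partialDeriv X k) j y)))]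
  simp_rw [← Finset.mul_sum]
  field_simp
  ring

/-- The vector-valued divergence formula: `∑ᵢⱼ ∂ᵢ(√g gⁱʲ ∂ⱼX)` is `√g` times the trace of the normal
part of the second derivative of `X`. -/
theorem sum_partialDeriv_divCoeff (hX : ContDiffAt ℝ ∞ X y) (h0 : 0 < (paramGram X y).det) :
    ∑ i, partialDeriv (fun z => ∑ j, divCoeff X i j z • partialDeriv X j z) i y =
      ∑ i, ∑ j, divCoeff X i j y •
        ((fderiv ℝ X y).rangeᗮ.starProjection (partialDeriv (partialDeriv X j) i y)) := by
  have hdX : ∀ i, DifferentiableAt ℝ (partialDeriv X i) y := fun i =>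
    (contDiffAt_partialDeriv (k := ∞) hX i le_rfl).differentiableAt (by simp)
  have hda : ∀ i j, DifferentiableAt ℝ (divCoeff X i j) y := fun i j =>
    (contDiffAt_divCoeff hX h0 i j).differentiableAt (by simp)
  set V : Fin m → Euc m → F := fun i z => ∑ j, divCoeff X i j z • partialDeriv X j z with hV
  have hdV : ∀ i, DifferentiableAt ℝ (V i) y := fun i =>
    DifferentiableAt.fun_sum fun j _ => (hda i j).smul (hdX j)
  set N := (fderiv ℝ X y).rangeᗮ with hN
  have hVi : ∀ i, partialDeriv (V i) i y = ∑ j, (divCoeff X i j y • partialDeriv (partialDeriv X j) i y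
      + partialDeriv (divCoeff X i j) i y • partialDeriv X j y) := by
    intro i
    rw [partialDeriv, hV]
    simp only
    rw [fderiv_fun_sum (A := fun j z => divCoeff X i j z • partialDeriv X j z)
      fun j _ => (hda i j).smul (hdX j)]
    simp only [FunLike.coe_sum, Finset.sum_apply]
    refine Finset.sum_congr rfl fun j _ => ?_
    rw [fderiv_fun_smul (hda i j) (hdX j)]
    rfl
  have hVX : ∀ i k, ∀ᶠ z in nhds y, inner ℝ (V i z) (partialDeriv X k z) =
      √(paramGram X z).det * (1 : Matrix (Fin m) (Fin m) ℝ) i k := by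
    intro i k
    have hc : ContinuousAt (fun z => (paramGram X z).det) y :=
      (contDiffAt_det fun i j => contDiffAt_paramGram hX i j).continuousAt
    filter_upwards [hc.eventually_ne h0.ne'] with z hz
    rw [← sum_divCoeff_mul_paramGram hz, sum_inner]
    exact Finset.sum_congr rfl fun j _ => by rw [real_inner_smul_left]; rfl
  have hsd : DifferentiableAt ℝ (fun z => √(paramGram X z).det) y :=
    ((contDiffAt_det fun i j => contDiffAt_paramGram hX i j).sqrt h0.ne').differentiableAt (by simp)
  -- The divergence is normal: differentiating `⟨Vᵢ, ∂ₖX⟩ = √g δᵢₖ` along `∂ᵢ` and summing over `i`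
  -- leaves `∂ₖ√g - ∑ᵢ ⟨Vᵢ, ∂ᵢ∂ₖX⟩`, which vanishes by `partialDeriv_sqrt_det`.
  have horth : ∀ k, inner ℝ (∑ i, partialDeriv (V i) i y) (partialDeriv X k y) = 0 := by
    intro k
    have h1 : ∀ i, inner ℝ (partialDeriv (V i) i y) (partialDeriv X k y) =
        partialDeriv (fun z => √(paramGram X z).det) i y * (1 : Matrix (Fin m) (Fin m) ℝ) i k
        - inner ℝ (V i y) (partialDeriv (partialDeriv X k) i y) := by
      intro i
      have h2 := fderiv_inner_apply ℝ (hdV i) (hdX k) (EuclideanSpace.single i (1 : ℝ))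
      rw [Filter.EventuallyEq.fderiv_eq (hVX i k), fderiv_mul_const hsd] at h2
      simp only [partialDeriv] at h2 ⊢
      rw [eq_sub_iff_add_eq, add_comm, ← h2, mul_comm]
      rfl
    rw [sum_inner]
    simp_rw [h1, Finset.sum_sub_distrib]
    have h3 : ∑ i, partialDeriv (fun z => √(paramGram X z).det) i y *
        (1 : Matrix (Fin m) (Fin m) ℝ) i k = partialDeriv (fun z => √(paramGram X z).det) k y := by
      simp [Matrix.one_apply]
    rw [h3, partialDeriv_sqrt_det hX h0, sub_eq_zero]
    refine Finset.sum_congr rfl fun i _ => ?_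
    rw [sum_inner]
    exact Finset.sum_congr rfl fun j _ => by rw [real_inner_smul_left]
  have hmem : ∑ i, partialDeriv (V i) i y ∈ N := by
    rw [hN, Submodule.mem_orthogonal']
    rintro _ ⟨v, rfl⟩
    have hv : v = ∑ k, v k • EuclideanSpace.single k (1 : ℝ) := by
      ext j; simp [Finset.sum_apply, Pi.single_apply]
    rw [hv]
    simp only [ContinuousLinearMap.coe_coe, map_sum, map_smul, inner_sum, real_inner_smul_right]
    exact Finset.sum_eq_zero fun k _ => by
      have := horth k
      rw [partialDeriv] at this
      rw [this, mul_zero]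
  -- A normal vector equals its normal projection, and the projection kills the tangential terms
  -- that carry the derivatives of the coefficients.
  rw [← Submodule.starProjection_eq_self_iff.2 hmem]
  simp_rw [hVi, map_sum, map_add, map_smul]
  refine Finset.sum_congr rfl fun i _ => Finset.sum_congr rfl fun j _ => ?_
  have hz : N.starProjection (partialDeriv X j y) = 0 := by
    rw [Submodule.starProjection_apply_eq_zero_iff]
    exact Submodule.le_orthogonal_orthogonal _ ⟨_, rfl⟩
  rw [hz, smul_zero, add_zero]

end Parametrized

/-! ### Expansions and traces in a basis that need not be orthonormal. -/

section LinearAlgebra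

variable {ι T F : Type*} [Fintype ι] [DecidableEq ι] [NormedAddCommGroup T] [InnerProductSpace ℝ T]
  [NormedAddCommGroup F] [InnerProductSpace ℝ F]

/-- Both sides are linear in `a`, and on a basis vector the identity is `g⁻¹ g = 1`. -/
theorem sum_inv_gram_smul (b : Module.Basis ι ℝ T) (a : T) :
    ∑ i, ∑ j, ((Matrix.gram ℝ b)⁻¹ i j * inner ℝ (b i) a) • b j = a := by
  have hdet : IsUnit (Matrix.gram ℝ b).det :=
    isUnit_iff_ne_zero.2 (Matrix.det_gram_ne_zero_iff_linearIndependent.2 b.linearIndependent)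
  have hsymm : ∀ i j, (Matrix.gram ℝ b)⁻¹ i j = (Matrix.gram ℝ b)⁻¹ j i := by
    intro i j
    have h : (Matrix.gram ℝ b).transpose = Matrix.gram ℝ b := by
      ext i j; exact real_inner_comm _ _
    calc (Matrix.gram ℝ b)⁻¹ i j = ((Matrix.gram ℝ b).transpose)⁻¹ i j := by rw [h]
      _ = _ := by rw [← Matrix.transpose_nonsing_inv]; rfl
  let P : T →ₗ[ℝ] T :=
    ∑ i, ∑ j, (Matrix.gram ℝ b)⁻¹ i j • ((innerₗ T (b i)).smulRight (b j))
  have hP : P = LinearMap.id := by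
    refine b.ext fun k => ?_
    simp only [P, LinearMap.sum_apply, LinearMap.smul_apply, LinearMap.smulRight_apply,
      innerₗ_apply_apply, LinearMap.id_apply, smul_smul]
    rw [Finset.sum_comm]
    simp_rw [← Finset.sum_smul]
    have h1 : ∀ j, ∑ i, (Matrix.gram ℝ b)⁻¹ i j * inner ℝ (b i) (b k) =
        (1 : Matrix ι ι ℝ) j k := by
      intro j
      rw [← Matrix.nonsing_inv_mul _ hdet, Matrix.mul_apply]
      exact Finset.sum_congr rfl fun i _ => by rw [hsymm]; rfl
    simp [h1, Matrix.one_apply]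
  have := LinearMap.congr_fun hP a
  simpa [P, smul_smul] using this

/-- The trace of a bilinear map over an orthonormal basis, computed in an arbitrary basis. -/
theorem sum_orthonormalBasis_eq {κ : Type*} [Fintype κ] (b : Module.Basis ι ℝ T)
    (o : OrthonormalBasis κ ℝ T) (B : T →ₗ[ℝ] T →ₗ[ℝ] F) :
    ∑ a, B (o a) (o a) = ∑ i, ∑ j, (Matrix.gram ℝ b)⁻¹ i j • B (b i) (b j) := by
  -- Expand one argument in the basis `b` and move the scalar `⟨o a, b i⟩` to the other. Summing
  -- over `a` then reassembles `b i` there.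
  have h1 : ∀ a, B (o a) (o a) =
      ∑ i, ∑ j, (Matrix.gram ℝ b)⁻¹ i j • B (inner ℝ (o a) (b i) • o a) (b j) := by
    intro a
    conv_lhs => rw [← sum_inv_gram_smul b (o a)]
    rw [sum_inv_gram_smul b (o a)]
    conv_lhs => arg 2; rw [← sum_inv_gram_smul b (o a)]
    simp only [map_sum, map_smul, LinearMap.smul_apply, smul_smul, real_inner_comm]
  simp_rw [h1]
  rw [Finset.sum_comm]
  refine Finset.sum_congr rfl fun i _ => ?_
  rw [Finset.sum_comm]
  refine Finset.sum_congr rfl fun j _ => ?_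
  rw [← Finset.smul_sum, ← LinearMap.sum_apply, ← map_sum, o.sum_repr' (b i)]

theorem inner_eq_sum_inv_gram (b : Module.Basis ι ℝ T) (a c : T) :
    inner ℝ a c = ∑ i, ∑ j, (Matrix.gram ℝ b)⁻¹ i j * inner ℝ a (b i) * inner ℝ c (b j) := by
  conv_lhs => rw [← sum_inv_gram_smul b a]
  simp only [sum_inner, real_inner_smul_left]
  refine Finset.sum_congr rfl fun i _ => Finset.sum_congr rfl fun j _ => ?_
  rw [real_inner_comm a, real_inner_comm c]

end LinearAlgebra

/-! ### Differentials and coordinate vector fields in charts. -/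

section Charts

variable {m : ℕ} {M : Type*} [TopologicalSpace M] [ChartedSpace (Euc m) M] [IsManifold (𝓡 m) ∞ M]
  {F : Type*} [NormedAddCommGroup F] [NormedSpace ℝ F]

theorem contMDiffAt_symm {p : M} {y : Euc m} (hy : y ∈ (extChartAt (𝓡 m) p).target) :
    ContMDiffAt 𝓘(ℝ, Euc m) (𝓡 m) ∞ (extChartAt (𝓡 m) p).symm y :=
  (contMDiffOn_extChartAt_symm p).contMDiffAt ((isOpen_extChartAt_target p).mem_nhds hy)

theorem mdifferentiableAt_symm {p : M} {y : Euc m} (hy : y ∈ (extChartAt (𝓡 m) p).target) :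
    MDifferentiableAt 𝓘(ℝ, Euc m) (𝓡 m) (extChartAt (𝓡 m) p).symm y :=
  (contMDiffAt_symm hy).mdifferentiableAt (by simp)

theorem contDiffAt_comp_symm {u : M → F} (hu : ContMDiff (𝓡 m) 𝓘(ℝ, F) ∞ u) {p : M} {y : Euc m}
    (hy : y ∈ (extChartAt (𝓡 m) p).target) :
    ContDiffAt ℝ ∞ (u ∘ (extChartAt (𝓡 m) p).symm) y :=
  contMDiffAt_iff_contDiffAt.1 (hu.contMDiffAt.comp y (contMDiffAt_symm hy))

theorem fderiv_comp_symm {u : M → F} {p : M} {y : Euc m}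
    (hy : y ∈ (extChartAt (𝓡 m) p).target)
    (hu : MDifferentiableAt (𝓡 m) 𝓘(ℝ, F) u ((extChartAt (𝓡 m) p).symm y)) (v : Euc m) :
    fderiv ℝ (u ∘ (extChartAt (𝓡 m) p).symm) y v =
      mfderiv (𝓡 m) 𝓘(ℝ, F) u ((extChartAt (𝓡 m) p).symm y)
        (mfderiv 𝓘(ℝ, Euc m) (𝓡 m) (extChartAt (𝓡 m) p).symm y v) := by
  rw [← mfderiv_eq_fderiv, mfderiv_comp y hu (mdifferentiableAt_symm hy)]
  rfl

/-- Near the point `u` is its coordinate expression composed with the chart. This carries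
Rademacher's theorem from coordinates to the manifold. -/
theorem mdifferentiableAt_of_comp_symm {u : M → F} {p : M} {y : Euc m}
    (hy : y ∈ (extChartAt (𝓡 m) p).target)
    (hu : DifferentiableAt ℝ (u ∘ (extChartAt (𝓡 m) p).symm) y) :
    MDifferentiableAt (𝓡 m) 𝓘(ℝ, F) u ((extChartAt (𝓡 m) p).symm y) := by
  have hq : (extChartAt (𝓡 m) p).symm y ∈ (extChartAt (𝓡 m) p).source :=
    (extChartAt (𝓡 m) p).map_target hy
  have h1 : MDifferentiableAt (𝓡 m) 𝓘(ℝ, Euc m) (extChartAt (𝓡 m) p)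
      ((extChartAt (𝓡 m) p).symm y) :=
    mdifferentiableAt_extChartAt (by simpa using hq)
  have h2 : MDifferentiableAt 𝓘(ℝ, Euc m) 𝓘(ℝ, F) (u ∘ (extChartAt (𝓡 m) p).symm)
      (extChartAt (𝓡 m) p ((extChartAt (𝓡 m) p).symm y)) := by
    rw [(extChartAt (𝓡 m) p).right_inv hy]
    exact hu.mdifferentiableAt
  refine (h2.comp _ h1).congr_of_eventuallyEq ?_
  filter_upwards [(isOpen_extChartAt_source p).mem_nhds hq] with z hz
  exact congrArg u ((extChartAt (𝓡 m) p).left_inv hz).symm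

theorem isInvertible_mfderiv_symm {p : M} {y : Euc m} (hy : y ∈ (extChartAt (𝓡 m) p).target) :
    (mfderiv 𝓘(ℝ, Euc m) (𝓡 m) (extChartAt (𝓡 m) p).symm y).IsInvertible := by
  have : IsManifold (𝓡 m) 1 M := IsManifold.of_le (n := ∞) (by simp)
  have h := isInvertible_mfderivWithin_extChartAt_symm (I := 𝓡 m) hy
  rwa [ModelWithCorners.range_eq_univ, mfderivWithin_univ] at h

/-- The coordinate vector fields as a basis of the tangent space. -/
def coordBasis {p : M} {y : Euc m} (hy : y ∈ (extChartAt (𝓡 m) p).target) :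
    Module.Basis (Fin m) ℝ (TangentSpace (𝓡 m) ((extChartAt (𝓡 m) p).symm y)) :=
  (EuclideanSpace.basisFun (Fin m) ℝ).toBasis.map
    (isInvertible_mfderiv_symm hy).choose.toLinearEquiv

theorem coordBasis_apply {p : M} {y : Euc m} (hy : y ∈ (extChartAt (𝓡 m) p).target) (i : Fin m) :
    coordBasis hy i = coordVector p y i := by
  have h := (isInvertible_mfderiv_symm hy).choose_spec
  refine Eq.trans ?_ (congrArg (fun L => L (EuclideanSpace.single i (1 : ℝ))) h)
  refine (Module.Basis.map_apply _ _ i).trans ?_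
  rw [OrthonormalBasis.coe_toBasis, EuclideanSpace.basisFun_apply]
  rfl

theorem partialDeriv_comp_symm {u : M → F} {p : M} {y : Euc m}
    (hy : y ∈ (extChartAt (𝓡 m) p).target)
    (hu : MDifferentiableAt (𝓡 m) 𝓘(ℝ, F) u ((extChartAt (𝓡 m) p).symm y)) (i : Fin m) :
    partialDeriv (u ∘ (extChartAt (𝓡 m) p).symm) i y =
      mfderiv (𝓡 m) 𝓘(ℝ, F) u ((extChartAt (𝓡 m) p).symm y) (coordVector p y i) :=
  fderiv_comp_symm hy hu _

/-! ### The metric, the coordinate functions and the mean curvature in charts. -/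

section Metric

variable [RiemannianBundle (fun p : M => TangentSpace (𝓡 m) p)]

theorem inner_riemGradient (u : M → ℝ) (q : M) (v : TangentSpace (𝓡 m) q) :
    inner ℝ (riemGradient (m := m) u q) v = mfderiv (𝓡 m) 𝓘(ℝ, ℝ) u q v :=
  InnerProductSpace.toDual_symm_apply

theorem inner_riemGradient_eq {u v : M → ℝ} {p : M} {y : Euc m}
    (hy : y ∈ (extChartAt (𝓡 m) p).target)
    (hu : MDifferentiableAt (𝓡 m) 𝓘(ℝ, ℝ) u ((extChartAt (𝓡 m) p).symm y))
    (hv : MDifferentiableAt (𝓡 m) 𝓘(ℝ, ℝ) v ((extChartAt (𝓡 m) p).symm y)) :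
    inner ℝ (riemGradient (m := m) u ((extChartAt (𝓡 m) p).symm y))
      (riemGradient (m := m) v ((extChartAt (𝓡 m) p).symm y)) =
      ∑ i, ∑ j, (gramMatrix p y)⁻¹ i j * partialDeriv (u ∘ (extChartAt (𝓡 m) p).symm) i y *
        partialDeriv (v ∘ (extChartAt (𝓡 m) p).symm) j y := by
  rw [inner_eq_sum_inv_gram (coordBasis hy)]
  have hG : Matrix.gram ℝ (coordBasis hy) = gramMatrix p y := by
    ext i j
    rw [Matrix.gram_apply, coordBasis_apply, coordBasis_apply]; rfl
  rw [hG]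
  refine Finset.sum_congr rfl fun i _ => Finset.sum_congr rfl fun j _ => ?_
  rw [coordBasis_apply, coordBasis_apply, inner_riemGradient, inner_riemGradient,
    partialDeriv_comp_symm hy hu, partialDeriv_comp_symm hy hv]

theorem det_gramMatrix_pos {p : M} {y : Euc m} (hy : y ∈ (extChartAt (𝓡 m) p).target) :
    0 < (gramMatrix p y).det := by
  have hG : Matrix.gram ℝ (coordBasis hy) = gramMatrix p y := by
    ext i j
    rw [Matrix.gram_apply, coordBasis_apply, coordBasis_apply]; rfl
  rw [← hG]
  exact (Matrix.posDef_gram_of_linearIndependent (coordBasis hy).linearIndependent).det_pos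

variable {x : M → Euc (m + 1)}

theorem IsIsometricImmersion.mdifferentiableAt (hx : IsIsometricImmersion x) (q : M) :
    MDifferentiableAt (𝓡 m) 𝓘(ℝ, Euc (m + 1)) x q :=
  hx.contMDiff.contMDiffAt.mdifferentiableAt (by simp)

/-- The smoothness of the metric in charts is read off from that of `x` through this identity. -/
theorem IsIsometricImmersion.gramMatrix_eq (hx : IsIsometricImmersion x) {p : M} {y : Euc m}
    (hy : y ∈ (extChartAt (𝓡 m) p).target) :
    gramMatrix p y = paramGram (x ∘ (extChartAt (𝓡 m) p).symm) y := by
  ext i j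
  rw [paramGram_apply, partialDeriv_comp_symm hy (hx.mdifferentiableAt _),
    partialDeriv_comp_symm hy (hx.mdifferentiableAt _)]
  exact (hx.inner_differentialAt _ _ _).symm

theorem IsIsometricImmersion.norm_differentialAt (hx : IsIsometricImmersion x) (q : M)
    (v : TangentSpace (𝓡 m) q) : ‖differentialAt x q v‖ = ‖v‖ := by
  rw [norm_eq_sqrt_real_inner, hx.inner_differentialAt, ← norm_eq_sqrt_real_inner]

theorem IsIsometricImmersion.norm_mfderiv_symm (hx : IsIsometricImmersion x) {p : M} {y : Euc m}
    (hy : y ∈ (extChartAt (𝓡 m) p).target) (v : Euc m) :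
    ‖(mfderiv 𝓘(ℝ, Euc m) (𝓡 m) (extChartAt (𝓡 m) p).symm y v :
      TangentSpace (𝓡 m) ((extChartAt (𝓡 m) p).symm y))‖ =
      ‖fderiv ℝ (x ∘ (extChartAt (𝓡 m) p).symm) y v‖ := by
  rw [fderiv_comp_symm hy (hx.mdifferentiableAt _), ← hx.norm_differentialAt]
  rfl

theorem IsIsometricImmersion.range_fderiv_comp_symm (hx : IsIsometricImmersion x) {p : M}
    {y : Euc m} (hy : y ∈ (extChartAt (𝓡 m) p).target) :
    (fderiv ℝ (x ∘ (extChartAt (𝓡 m) p).symm) y).range =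
      (differentialAt x ((extChartAt (𝓡 m) p).symm y)).range := by
  ext w
  constructor
  · rintro ⟨v, rfl⟩
    exact ⟨_, (fderiv_comp_symm hy (hx.mdifferentiableAt _) v).symm⟩
  · rintro ⟨v, rfl⟩
    obtain ⟨e, he⟩ := isInvertible_mfderiv_symm hy
    refine ⟨e.symm v, ?_⟩
    refine (fderiv_comp_symm hy (hx.mdifferentiableAt _) (e.symm v)).trans ?_
    rw [← he]
    exact congrArg (differentialAt x _) (e.apply_symm_apply v)

theorem IsIsometricImmersion.mfderiv_coord (hx : IsIsometricImmersion x) (k : Fin (m + 1)) (q : M)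
    (v : TangentSpace (𝓡 m) q) :
    mfderiv (𝓡 m) 𝓘(ℝ, ℝ) (fun z => x z k) q v = differentialAt x q v k := by
  have h : MDifferentiableAt 𝓘(ℝ, Euc (m + 1)) 𝓘(ℝ, ℝ)
      (EuclideanSpace.proj k : Euc (m + 1) →L[ℝ] ℝ) (x q) :=
    (EuclideanSpace.proj k : Euc (m + 1) →L[ℝ] ℝ).differentiableAt.mdifferentiableAt
  have h1 := mfderiv_comp q h (hx.mdifferentiableAt q)
  rw [mfderiv_eq_fderiv, ContinuousLinearMap.fderiv] at h1
  exact congrArg (fun L => L v) h1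

theorem IsIsometricImmersion.contMDiff_coord (hx : IsIsometricImmersion x) (k : Fin (m + 1)) :
    ContMDiff (𝓡 m) 𝓘(ℝ, ℝ) ∞ (fun z => x z k) :=
  (EuclideanSpace.proj k : Euc (m + 1) →L[ℝ] ℝ).contDiff.contMDiff.comp
    hx.contMDiff

/-- The gradient of the coordinate function `xₖ`. -/
def coordGradient (x : M → Euc (m + 1)) (k : Fin (m + 1)) (q : M) : TangentSpace (𝓡 m) q :=
  riemGradient (m := m) (fun z => x z k) q

theorem IsIsometricImmersion.inner_coordGradient (hx : IsIsometricImmersion x) (k : Fin (m + 1))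
    (q : M) (v : TangentSpace (𝓡 m) q) :
    inner ℝ (coordGradient x k q) v = differentialAt x q v k := by
  rw [coordGradient, inner_riemGradient, hx.mfderiv_coord]

theorem inner_single_eq (v : Euc (m + 1)) (k : Fin (m + 1)) :
    inner ℝ (EuclideanSpace.single k (1 : ℝ)) v = v k := by
  simp [EuclideanSpace.inner_single_left]

/-- Since `⟨∇xₖ, v⟩ = ⟨eₖ, dx v⟩` for tangent `v`, the vector `dx(∇xₖ)` is the tangential part of
`eₖ`. -/
theorem IsIsometricImmersion.normalProj_single (hx : IsIsometricImmersion x) (k : Fin (m + 1))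
    (q : M) : normalProj x q (EuclideanSpace.single k (1 : ℝ)) =
      EuclideanSpace.single k (1 : ℝ) - differentialAt x q (coordGradient x k q) := by
  rw [normalProj]
  refine (Submodule.eq_starProjection_of_mem_orthogonal
    (K := (differentialAt x q).rangeᗮ) ?_ ?_)
  · rw [Submodule.mem_orthogonal']
    rintro _ ⟨v, rfl⟩
    rw [inner_sub_left, inner_single_eq]
    erw [hx.inner_differentialAt, hx.inner_coordGradient]
    exact sub_self _
  · exact Submodule.le_orthogonal_orthogonal _ (by rw [sub_sub_cancel]; exact ⟨_, rfl⟩)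

theorem IsIsometricImmersion.normalProj_single_apply (hx : IsIsometricImmersion x)
    (k l : Fin (m + 1)) (q : M) : normalProj x q (EuclideanSpace.single k (1 : ℝ)) l =
      (if l = k then 1 else 0) - inner ℝ (coordGradient x k q) (coordGradient x l q) := by
  rw [hx.normalProj_single, PiLp.sub_apply, real_inner_comm, hx.inner_coordGradient]
  simp

theorem IsIsometricImmersion.norm_sq_normalProj_single (hx : IsIsometricImmersion x)
    (k : Fin (m + 1)) (q : M) : ‖normalProj x q (EuclideanSpace.single k (1 : ℝ))‖ ^ 2 =
      1 - ‖coordGradient x k q‖ ^ 2 := by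
  rw [hx.normalProj_single, norm_sub_sq_real, inner_single_eq, hx.norm_differentialAt,
    ← hx.inner_coordGradient, real_inner_self_eq_norm_sq]
  simp
  ring

theorem finrank_tangentSpace (q : M) : Module.finrank ℝ (TangentSpace (𝓡 m) q) = m :=
  finrank_euclideanSpace_fin

/-- The sum is the squared Hilbert–Schmidt norm of `dx`. Computed over an orthonormal basis of the
tangent space instead, it is a sum of `m` ones. -/
theorem IsIsometricImmersion.sum_norm_sq_coordGradient (hx : IsIsometricImmersion x) (q : M) :
    ∑ k, ‖coordGradient x k q‖ ^ 2 = m := by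
  let o := stdOrthonormalBasis ℝ (TangentSpace (𝓡 m) q)
  have h1 : ∀ k, ‖coordGradient x k q‖ ^ 2 = ∑ a, (differentialAt x q (o a) k) ^ 2 := by
    intro k
    rw [← o.sum_sq_norm_inner_right]
    refine Finset.sum_congr rfl fun a _ => ?_
    rw [real_inner_comm, hx.inner_coordGradient, Real.norm_eq_abs, sq_abs]
  simp_rw [h1]
  rw [Finset.sum_comm]
  have h2 : ∀ a, ∑ k, (differentialAt x q (o a) k) ^ 2 = 1 := by
    intro a
    rw [← EuclideanSpace.real_norm_sq_eq, hx.norm_differentialAt, o.norm_eq_one, one_pow]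
  simp [h2, finrank_tangentSpace]

/-- The vector on the left is the tangential part of the ambient vector `c`, so the claim is that a
projection does not increase norms. -/
theorem IsIsometricImmersion.norm_sum_smul_coordGradient_le (hx : IsIsometricImmersion x) (q : M)
    (c : Euc (m + 1)) : ‖∑ k, c k • coordGradient x k q‖ ≤ ‖c‖ := by
  set v := ∑ k, c k • coordGradient x k q with hv
  have h : ‖v‖ * ‖v‖ ≤ ‖c‖ * ‖v‖ := by
    calc ‖v‖ * ‖v‖ = inner ℝ v v := (real_inner_self_eq_norm_mul_norm v).symm
      _ = inner ℝ (differentialAt x q v) c := by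
        conv_lhs => arg 2; rw [hv]
        rw [sum_inner, PiLp.inner_apply]
        refine Finset.sum_congr rfl fun k _ => ?_
        rw [real_inner_smul_left, hx.inner_coordGradient]
        simp
      _ ≤ ‖differentialAt x q v‖ * ‖c‖ := real_inner_le_norm _ _
      _ = ‖c‖ * ‖v‖ := by rw [hx.norm_differentialAt, mul_comm]
  rcases (norm_nonneg v).eq_or_lt with h0 | h0
  · rw [← h0]; exact norm_nonneg _
  · exact le_of_mul_le_mul_right h h0

/-- `secondFundamentalForm` is defined through the chart around the point itself. In another chart
the second derivative changes by `DX'(D²Φ)`, with `Φ` the transition map; this is tangential and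
disappears under the normal projection. -/
theorem IsIsometricImmersion.secondFundamentalForm_mfderiv_symm (hx : IsIsometricImmersion x)
    {p : M} {y : Euc m} (hy : y ∈ (extChartAt (𝓡 m) p).target) (u v : Euc m) :
    secondFundamentalForm x ((extChartAt (𝓡 m) p).symm y)
      (mfderiv 𝓘(ℝ, Euc m) (𝓡 m) (extChartAt (𝓡 m) p).symm y u)
      (mfderiv 𝓘(ℝ, Euc m) (𝓡 m) (extChartAt (𝓡 m) p).symm y v) =
    normalProj x ((extChartAt (𝓡 m) p).symm y)
      (fderiv ℝ (fderiv ℝ (x ∘ (extChartAt (𝓡 m) p).symm)) y u v) := by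
  set q := (extChartAt (𝓡 m) p).symm y with hq
  set Φ : Euc m → Euc m := extChartAt (𝓡 m) q ∘ (extChartAt (𝓡 m) p).symm with hΦ
  set X := x ∘ (extChartAt (𝓡 m) p).symm with hX
  set X' := x ∘ (extChartAt (𝓡 m) q).symm with hX'
  have hy' : Φ y ∈ (extChartAt (𝓡 m) q).target := mem_extChartAt_target q
  have hcont : ContinuousAt (extChartAt (𝓡 m) p).symm y := continuousAt_extChartAt_symm'' hy
  have hsrc : ∀ᶠ z in nhds y, (extChartAt (𝓡 m) p).symm z ∈ (extChartAt (𝓡 m) q).source :=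
    hcont.preimage_mem_nhds (extChartAt_source_mem_nhds q)
  have htgt : ∀ᶠ z in nhds y, z ∈ (extChartAt (𝓡 m) p).target :=
    (isOpen_extChartAt_target p).mem_nhds hy
  have hΦd : ∀ z, z ∈ (extChartAt (𝓡 m) p).target →
      (extChartAt (𝓡 m) p).symm z ∈ (extChartAt (𝓡 m) q).source → ContDiffAt ℝ ∞ Φ z := by
    intro z hz hz'
    refine contMDiffAt_iff_contDiffAt.1 (ContMDiffAt.comp z ?_ (contMDiffAt_symm hz))
    exact contMDiffAt_extChartAt' (by simpa using hz')
  have hXX : X =ᶠ[nhds y] X' ∘ Φ := by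
    filter_upwards [hsrc] with z hz
    simp only [hX, hX', hΦ, Function.comp_apply, (extChartAt (𝓡 m) q).left_inv hz]
  have hX'd : ContDiffAt ℝ ∞ X' (Φ y) := contDiffAt_comp_symm hx.contMDiff hy'
  have hfd : fderiv ℝ X =ᶠ[nhds y] fun z => (fderiv ℝ X' (Φ z)).comp (fderiv ℝ Φ z) := by
    filter_upwards [hXX.eventuallyEq_nhds, hsrc, htgt] with z h1 h2 h3
    rw [h1.fderiv_eq]
    refine fderiv_comp z ?_ ((hΦd z h3 h2).differentiableAt (by simp))
    exact (contDiffAt_comp_symm hx.contMDiff ((extChartAt (𝓡 m) q).map_source h2)).differentiableAt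
      (by simp)
  have hΦy := hΦd y hy hsrc.self_of_nhds
  have hA : DifferentiableAt ℝ (fderiv ℝ X') (Φ y) :=
    (hX'd.fderiv_right (m := ∞) le_rfl).differentiableAt (by simp)
  have hB : DifferentiableAt ℝ (fderiv ℝ Φ) y :=
    (hΦy.fderiv_right (m := ∞) le_rfl).differentiableAt (by simp)
  have hΦ1 : DifferentiableAt ℝ Φ y := hΦy.differentiableAt (by simp)
  have hAc : DifferentiableAt ℝ (fun z => fderiv ℝ X' (Φ z)) y := hA.comp y hΦ1
  -- The tangent space at `q` is identified with `ℝᵐ` by the chart around `q`, so the differential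
  -- of the other chart's inverse is the derivative of the transition map.
  have hmf : ∀ w : Euc m, (mfderiv 𝓘(ℝ, Euc m) (𝓡 m) (extChartAt (𝓡 m) p).symm y w : Euc m) =
      fderiv ℝ Φ y w := by
    intro w
    have h := (mdifferentiableAt_symm hy).mfderiv
    rw [ModelWithCorners.range_eq_univ, fderivWithin_univ] at h
    exact congrArg (fun L => L w) h
  have h2 : fderiv ℝ (fderiv ℝ X) y u v =
      fderiv ℝ (fderiv ℝ X') (Φ y) (fderiv ℝ Φ y u) (fderiv ℝ Φ y v) +
        fderiv ℝ X' (Φ y) (fderiv ℝ (fderiv ℝ Φ) y u v) := by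
    rw [hfd.fderiv_eq, fderiv_clm_comp hAc hB]
    have h3 : fderiv ℝ (fun z => fderiv ℝ X' (Φ z)) y =
        (fderiv ℝ (fderiv ℝ X') (Φ y)).comp (fderiv ℝ Φ y) := fderiv_comp y hA hΦ1
    rw [h3]
    exact add_comm _ _
  rw [h2, map_add]
  have h4 : normalProj x q (fderiv ℝ X' (Φ y) (fderiv ℝ (fderiv ℝ Φ) y u v)) = 0 := by
    have h5 := hx.range_fderiv_comp_symm hy'
    have h6 : (extChartAt (𝓡 m) q).symm (Φ y) = q := extChartAt_to_inv q
    rw [normalProj, Submodule.starProjection_apply_eq_zero_iff]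
    apply Submodule.le_orthogonal_orthogonal
    rw [h6] at h5
    rw [← h5]
    exact ⟨_, rfl⟩
  rw [h4, add_zero, secondFundamentalForm, hmf, hmf]
  rfl

/-- The mean curvature vector in an arbitrary chart. -/
theorem IsIsometricImmersion.meanCurvatureVector_symm (hx : IsIsometricImmersion x)
    {p : M} {y : Euc m} (hy : y ∈ (extChartAt (𝓡 m) p).target) :
    meanCurvatureVector x ((extChartAt (𝓡 m) p).symm y) =
      ∑ i, ∑ j, (gramMatrix p y)⁻¹ i j • normalProj x ((extChartAt (𝓡 m) p).symm y)
        (partialDeriv (partialDeriv (x ∘ (extChartAt (𝓡 m) p).symm) j) i y) := by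
  set q := (extChartAt (𝓡 m) p).symm y with hq
  let D : Euc m →L[ℝ] Euc m →L[ℝ] Euc (m + 1) :=
    fderiv ℝ (fderiv ℝ (x ∘ (extChartAt (𝓡 m) q).symm)) (extChartAt (𝓡 m) q q)
  let B : TangentSpace (𝓡 m) q →ₗ[ℝ] TangentSpace (𝓡 m) q →ₗ[ℝ] Euc (m + 1) :=
    LinearMap.mk₂ ℝ (fun u v => secondFundamentalForm x q u v)
      (fun u u' v => (congrArg (normalProj x q) (D.map_add₂ u u' v)).trans (map_add _ _ _))
      (fun c u v => (congrArg (normalProj x q) (D.map_smul₂ c u v)).trans (map_smul _ _ _))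
      (fun u v v' => (congrArg (normalProj x q) ((D u).map_add v v')).trans (map_add _ _ _))
      (fun c u v => (congrArg (normalProj x q) ((D u).map_smul c v)).trans (map_smul _ _ _))
  have hG : Matrix.gram ℝ (coordBasis hy) = gramMatrix p y := by
    ext i j
    rw [Matrix.gram_apply, coordBasis_apply, coordBasis_apply]; rfl
  have h := sum_orthonormalBasis_eq (coordBasis hy) (stdOrthonormalBasis ℝ (TangentSpace (𝓡 m) q)) B
  rw [hG] at h
  refine Eq.trans h (Finset.sum_congr rfl fun i _ => Finset.sum_congr rfl fun j _ => ?_)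
  rw [coordBasis_apply, coordBasis_apply,
    partialDeriv_partialDeriv (contDiffAt_comp_symm hx.contMDiff hy),
    ← hx.secondFundamentalForm_mfderiv_symm hy]
  rfl

end Metric

end Charts

/-! ### The Riemannian volume measure and integration in charts. -/

section Volume

variable {m : ℕ} {M : Type*} [TopologicalSpace M] [MeasurableSpace M] [BorelSpace M]
  [ChartedSpace (Euc m) M] [IsManifold (𝓡 m) ∞ M]
  [RiemannianBundle (fun p : M => TangentSpace (𝓡 m) p)] {x : M → Euc (m + 1)}

theorem measurableSet_source (p : M) : MeasurableSet (extChartAt (𝓡 m) p).source :=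
  (isOpen_extChartAt_source p).measurableSet

theorem measurableSet_target (p : M) : MeasurableSet (extChartAt (𝓡 m) p).target :=
  (isOpen_extChartAt_target p).measurableSet

theorem measurableEmbedding_symm (p : M) :
    MeasurableEmbedding fun y : (extChartAt (𝓡 m) p).target => (extChartAt (𝓡 m) p).symm y := by
  refine Topology.IsOpenEmbedding.measurableEmbedding
    (.of_continuous_injective_isOpenMap ?_ ?_ ?_)
  · exact continuousOn_iff_continuous_domRestrict.1 (continuousOn_extChartAt_symm p)
  · exact fun a b h => Subtype.ext ((extChartAt (𝓡 m) p).symm.injOn a.2 b.2 h)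
  · intro U hU
    have h1 : (fun y : (extChartAt (𝓡 m) p).target => (extChartAt (𝓡 m) p).symm y) '' U =
        (extChartAt (𝓡 m) p).source ∩ extChartAt (𝓡 m) p ⁻¹' (Subtype.val '' U) := by
      ext z
      constructor
      · rintro ⟨y, hy, rfl⟩
        exact ⟨(extChartAt (𝓡 m) p).map_target y.2, y, hy, ((extChartAt (𝓡 m) p).right_inv y.2).symm⟩
      · rintro ⟨hz, y, hy, hyz⟩
        exact ⟨y, hy, by simp only [hyz]; exact (extChartAt (𝓡 m) p).left_inv hz⟩
    rw [h1]
    exact (continuousOn_extChartAt p).isOpen_inter_preimage (isOpen_extChartAt_source p)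
      ((isOpen_extChartAt_target p).isOpenMap_subtype_val _ hU)

theorem measurableSet_target_inter_symm {p : M} {A : Set M} (hA : MeasurableSet A) :
    MeasurableSet ((extChartAt (𝓡 m) p).target ∩ (extChartAt (𝓡 m) p).symm ⁻¹' A) := by
  have h := (measurableEmbedding_symm (m := m) p).measurable hA
  have h1 := (MeasurableEmbedding.subtype_coe (measurableSet_target (m := m) p)).measurableSet_image' h
  convert h1 using 1
  ext y
  simp [and_comm]

/-- Only almost everywhere, for the restricted measure: nothing is known of the chart inverse off
the target. -/
theorem aemeasurable_symm (p : M) : AEMeasurable (extChartAt (𝓡 m) p).symm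
    ((volume : Measure (Euc m)).restrict (extChartAt (𝓡 m) p).target) := by
  rw [← map_comap_subtype_coe (measurableSet_target p)]
  exact ((MeasurableEmbedding.subtype_coe (measurableSet_target p)).aemeasurable_map_iff).2
    (measurableEmbedding_symm p).measurable.aemeasurable

/-- The volume density `√(det g)` of a chart. -/
def volumeDensity (p : M) (y : Euc m) : ℝ := √(gramMatrix p y).det

theorem volumeDensity_pos {p : M} {y : Euc m} (hy : y ∈ (extChartAt (𝓡 m) p).target) :
    0 < volumeDensity p y := Real.sqrt_pos.2 (det_gramMatrix_pos hy)

theorem IsIsometricImmersion.volumeDensity_eq (hx : IsIsometricImmersion x) {p : M} {y : Euc m}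
    (hy : y ∈ (extChartAt (𝓡 m) p).target) :
    volumeDensity p y = √(paramGram (x ∘ (extChartAt (𝓡 m) p).symm) y).det := by
  rw [volumeDensity, hx.gramMatrix_eq hy]

theorem IsIsometricImmersion.det_paramGram_pos (hx : IsIsometricImmersion x) {p : M} {y : Euc m}
    (hy : y ∈ (extChartAt (𝓡 m) p).target) :
    0 < (paramGram (x ∘ (extChartAt (𝓡 m) p).symm) y).det := by
  rw [← hx.gramMatrix_eq hy]; exact det_gramMatrix_pos hy

theorem IsIsometricImmersion.contDiffAt_volumeDensity (hx : IsIsometricImmersion x) {p : M}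
    {y : Euc m} (hy : y ∈ (extChartAt (𝓡 m) p).target) : ContDiffAt ℝ ∞ (volumeDensity p) y := by
  have h : ContDiffAt ℝ ∞ (fun z => √(paramGram (x ∘ (extChartAt (𝓡 m) p).symm) z).det) y :=
    (contDiffAt_det fun i j => contDiffAt_paramGram
      (contDiffAt_comp_symm hx.contMDiff hy) i j).sqrt (hx.det_paramGram_pos hy).ne'
  refine h.congr_of_eventuallyEq ?_
  filter_upwards [(isOpen_extChartAt_target p).mem_nhds hy] with z hz
  exact hx.volumeDensity_eq hz

theorem IsIsometricImmersion.continuousOn_volumeDensity (hx : IsIsometricImmersion x) (p : M) :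
    ContinuousOn (volumeDensity (m := m) p) (extChartAt (𝓡 m) p).target :=
  fun _ hy => (hx.contDiffAt_volumeDensity hy).continuousAt.continuousWithinAt

theorem IsIsometricImmersion.aemeasurable_volumeDensity (hx : IsIsometricImmersion x) (p : M) :
    AEMeasurable (volumeDensity (m := m) p) (volume.restrict (extChartAt (𝓡 m) p).target) :=
  (hx.continuousOn_volumeDensity p).aemeasurable (measurableSet_target p)

theorem aemeasurable_symm_withDensity (p : M) (d : Euc m → ENNReal) :
    AEMeasurable (extChartAt (𝓡 m) p).symm
      (((volume : Measure (Euc m)).restrict (extChartAt (𝓡 m) p).target).withDensity d) :=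
  (aemeasurable_symm p).mono_ac (withDensity_absolutelyContinuous _ _)

theorem chartVolume_apply (p : M) {A : Set M} (hA : MeasurableSet A) :
    chartVolume (m := m) p A =
      ∫⁻ y in (extChartAt (𝓡 m) p).target ∩ (extChartAt (𝓡 m) p).symm ⁻¹' A,
        ENNReal.ofReal (volumeDensity p y) := by
  have h2 := measurableSet_target_inter_symm (m := m) (p := p) hA
  rw [chartVolume, Measure.map_apply_of_aemeasurable (aemeasurable_symm_withDensity p _) hA]
  have h1 : ∀ μ : Measure (Euc m), (μ.restrict (extChartAt (𝓡 m) p).target).withDensity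
      (fun y => ENNReal.ofReal √(gramMatrix p y).det) ((extChartAt (𝓡 m) p).symm ⁻¹' A) =
      (μ.restrict (extChartAt (𝓡 m) p).target).withDensity
      (fun y => ENNReal.ofReal √(gramMatrix p y).det)
        ((extChartAt (𝓡 m) p).target ∩ (extChartAt (𝓡 m) p).symm ⁻¹' A) := by
    intro μ
    refine measure_congr ?_
    have h3 : ∀ᵐ y ∂(μ.restrict (extChartAt (𝓡 m) p).target).withDensity
        (fun y => ENNReal.ofReal √(gramMatrix p y).det), y ∈ (extChartAt (𝓡 m) p).target :=
      (withDensity_absolutelyContinuous _ _).ae_le (ae_restrict_mem (measurableSet_target p))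
    filter_upwards [h3] with y hy
    exact propext ⟨fun h => ⟨hy, h⟩, fun h => h.2⟩
  rw [h1, withDensity_apply _ h2, Measure.restrict_restrict h2, inter_assoc,
    inter_comm (_ ⁻¹' A), ← inter_assoc, inter_self]
  rfl

theorem chartVolume_inter_source (p : M) {A : Set M} (hA : MeasurableSet A) :
    chartVolume (m := m) p (A ∩ (extChartAt (𝓡 m) p).source) = chartVolume (m := m) p A := by
  rw [chartVolume_apply p hA, chartVolume_apply p (hA.inter (measurableSet_source p))]
  congr 2
  ext y
  constructor
  · exact fun h => ⟨h.1, h.2.1⟩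
  · exact fun h => ⟨h.1, h.2, (extChartAt (𝓡 m) p).map_target h.1⟩

/-- By the chain rule the Gram matrix of `X ∘ Φ` is `Pᵀ G P`, with `P` the Jacobian matrix of `Φ`.
-/
theorem det_paramGram_comp {F : Type*} [NormedAddCommGroup F] [InnerProductSpace ℝ F]
    {X : Euc m → F} {Φ : Euc m → Euc m} {y : Euc m} (hX : DifferentiableAt ℝ X (Φ y))
    (hΦ : DifferentiableAt ℝ Φ y) :
    (paramGram (X ∘ Φ) y).det = (fderiv ℝ Φ y).det ^ 2 * (paramGram X (Φ y)).det := by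
  let b := (EuclideanSpace.basisFun (Fin m) ℝ).toBasis
  let P : Matrix (Fin m) (Fin m) ℝ := LinearMap.toMatrix b b (fderiv ℝ Φ y : Euc m →ₗ[ℝ] Euc m)
  have hP : ∀ k i, P k i = fderiv ℝ Φ y (EuclideanSpace.single i 1) k := by
    intro k i
    simp [P, b, LinearMap.toMatrix_apply]
  have hd : ∀ i, partialDeriv (X ∘ Φ) i y = ∑ k, P k i • partialDeriv X k (Φ y) := by
    intro i
    rw [partialDeriv, fderiv_comp y hX hΦ]
    have hv : fderiv ℝ Φ y (EuclideanSpace.single i 1) =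
        ∑ k, P k i • EuclideanSpace.single k (1 : ℝ) := by
      ext j; simp [hP, Finset.sum_apply, Pi.single_apply]
    rw [ContinuousLinearMap.comp_apply, hv, map_sum]
    exact Finset.sum_congr rfl fun k _ => map_smul _ _ _
  have hG : paramGram (X ∘ Φ) y = P.transpose * paramGram X (Φ y) * P := by
    ext i j
    rw [paramGram_apply, hd, hd, sum_inner, Matrix.mul_apply]
    simp_rw [inner_sum, real_inner_smul_left, real_inner_smul_right, Matrix.mul_apply,
      Finset.sum_mul, Matrix.transpose_apply]
    rw [Finset.sum_comm]
    refine Finset.sum_congr rfl fun k _ => Finset.sum_congr rfl fun l _ => ?_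
    rw [paramGram_apply]
    ring
  have hdet : P.det = (fderiv ℝ Φ y).det := LinearMap.det_toMatrix b _
  rw [hG, Matrix.det_mul, Matrix.det_mul, Matrix.det_transpose, hdet]
  ring

/-- Change of variables along the transition map: its Jacobian is the factor by which `√(det g)`
changes. -/
theorem IsIsometricImmersion.chartVolume_eq_of_subset (hx : IsIsometricImmersion x) {p q : M}
    {A : Set M} (hA : MeasurableSet A) (hp : A ⊆ (extChartAt (𝓡 m) p).source)
    (hq : A ⊆ (extChartAt (𝓡 m) q).source) :
    chartVolume (m := m) p A = chartVolume (m := m) q A := by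
  set S := (extChartAt (𝓡 m) p).target ∩ (extChartAt (𝓡 m) p).symm ⁻¹' A with hS
  set Φ : Euc m → Euc m := extChartAt (𝓡 m) q ∘ (extChartAt (𝓡 m) p).symm with hΦ
  have hSm : MeasurableSet S := measurableSet_target_inter_symm hA
  have hΦd : ∀ y ∈ S, DifferentiableAt ℝ Φ y := by
    intro y hy
    have h : ContDiffAt ℝ ∞ Φ y :=
      contMDiffAt_iff_contDiffAt.1 (ContMDiffAt.comp y
        (contMDiffAt_extChartAt' (by simpa using hq hy.2)) (contMDiffAt_symm hy.1))
    exact h.differentiableAt (by simp)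
  have hinv : ∀ y ∈ S, (extChartAt (𝓡 m) q).symm (Φ y) = (extChartAt (𝓡 m) p).symm y :=
    fun y hy => (extChartAt (𝓡 m) q).left_inv (hq hy.2)
  have hinj : InjOn Φ S := by
    intro y hy z hz h
    refine (extChartAt (𝓡 m) p).symm.injOn hy.1 hz.1 ?_
    rw [← hinv y hy, ← hinv z hz, h]
  have himg : Φ '' S = (extChartAt (𝓡 m) q).target ∩ (extChartAt (𝓡 m) q).symm ⁻¹' A := by
    ext z
    constructor
    · rintro ⟨y, hy, rfl⟩
      refine ⟨(extChartAt (𝓡 m) q).map_source (hq hy.2), ?_⟩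
      rw [mem_preimage, hinv y hy]
      exact hy.2
    · rintro ⟨hz, hzA⟩
      have hl := (extChartAt (𝓡 m) p).left_inv (hp hzA)
      refine ⟨extChartAt (𝓡 m) p ((extChartAt (𝓡 m) q).symm z),
        ⟨(extChartAt (𝓡 m) p).map_source (hp hzA), ?_⟩, ?_⟩
      · rw [mem_preimage, hl]; exact hzA
      · rw [hΦ, Function.comp_apply, hl]
        exact (extChartAt (𝓡 m) q).right_inv hz
  rw [chartVolume_apply p hA, chartVolume_apply q hA, ← himg,
    lintegral_image_eq_lintegral_abs_det_fderiv_mul volume hSm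
      (fun y hy => (hΦd y hy).hasFDerivAt.hasFDerivWithinAt) hinj]
  refine setLIntegral_congr_fun hSm fun y hy => ?_
  have hyq : Φ y ∈ (extChartAt (𝓡 m) q).target := (himg ▸ mem_image_of_mem Φ hy).1
  have hXX : x ∘ (extChartAt (𝓡 m) p).symm =ᶠ[nhds y] (x ∘ (extChartAt (𝓡 m) q).symm) ∘ Φ := by
    have hsrc : ∀ᶠ z in nhds y, (extChartAt (𝓡 m) p).symm z ∈ (extChartAt (𝓡 m) q).source :=
      (continuousAt_extChartAt_symm'' hy.1).preimage_mem_nhds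
        ((isOpen_extChartAt_source q).mem_nhds (hq hy.2))
    filter_upwards [hsrc] with z hz
    simp only [hΦ, Function.comp_apply, (extChartAt (𝓡 m) q).left_inv hz]
  have hG : paramGram (x ∘ (extChartAt (𝓡 m) p).symm) y =
      paramGram ((x ∘ (extChartAt (𝓡 m) q).symm) ∘ Φ) y := by
    ext i j
    simp only [paramGram_apply, partialDeriv, hXX.fderiv_eq]
  rw [← ENNReal.ofReal_mul (abs_nonneg _), hx.volumeDensity_eq hy.1, hx.volumeDensity_eq hyq, hG,
    det_paramGram_comp ((contDiffAt_comp_symm hx.contMDiff hyq).differentiableAt (by simp))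
      (hΦd y hy), Real.sqrt_mul (sq_nonneg _), Real.sqrt_sq_eq_abs]

variable [SecondCountableTopology M]

theorem exists_seq_iUnion_source [Nonempty M] :
    ∃ c : ℕ → M, ⋃ n, (extChartAt (𝓡 m) (c n)).source = univ := by
  obtain ⟨s, hs, hcov⟩ := TopologicalSpace.countable_cover_nhds
    (fun p : M => extChartAt_source_mem_nhds (I := 𝓡 m) p)
  have hne : s.Nonempty := by
    by_contra h
    rw [not_nonempty_iff_eq_empty] at h
    simp [h] at hcov
    exact absurd hcov.symm univ_nonempty.ne_empty
  obtain ⟨c, rfl⟩ := hs.exists_eq_range hne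
  exact ⟨c, by simpa using hcov⟩

/-- Cut `M` into countably many disjoint pieces `D n`, each inside one chart domain, and let `μ` be
the sum of the chart volumes of the pieces. Every chart volume is at most `μ` because chart volumes
agree on overlaps, and `μ` is at most the supremum because on each piece it is one of the measures
in the supremum. -/
theorem IsIsometricImmersion.riemannianVolume_apply (hx : IsIsometricImmersion x) {p : M}
    {A : Set M} (hA : MeasurableSet A) (hp : A ⊆ (extChartAt (𝓡 m) p).source) :
    riemannianVolume m M A = chartVolume (m := m) p A := by
  have : Nonempty M := ⟨p⟩
  obtain ⟨c, hc⟩ := exists_seq_iUnion_source (m := m) (M := M)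
  set D : ℕ → Set M := disjointed fun n => (extChartAt (𝓡 m) (c n)).source with hD
  have hDm : ∀ n, MeasurableSet (D n) := MeasurableSet.disjointed fun n => measurableSet_source _
  have hDs : ∀ n, D n ⊆ (extChartAt (𝓡 m) (c n)).source := fun n => disjointed_subset _ n
  have hDu : ⋃ n, D n = univ := iUnion_disjointed.trans hc
  have hDd : Pairwise (Function.onFun Disjoint D) := disjoint_disjointed _
  have hsum : ∀ (ν : Measure M) {B : Set M}, MeasurableSet B → ν B = ∑' n, ν (B ∩ D n) := by
    intro ν B hB
    rw [← measure_iUnion (fun i j hij => (hDd hij).mono inter_subset_right inter_subset_right)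
      fun n => hB.inter (hDm n), ← inter_iUnion, hDu, inter_univ]
  set μ : Measure M := Measure.sum fun n => (chartVolume (m := m) (c n)).restrict (D n) with hμ
  have hμA : ∀ {B : Set M}, MeasurableSet B → μ B = ∑' n, chartVolume (m := m) (c n) (B ∩ D n) := by
    intro B hB
    rw [hμ, Measure.sum_apply _ hB]
    exact tsum_congr fun n => Measure.restrict_apply hB
  have heq : riemannianVolume m M = μ := by
    refine le_antisymm (iSup_le fun q => Measure.le_iff.2 fun B hB => ?_)
      (Measure.le_iff.2 fun B hB => ?_)
    · rw [hsum _ hB, hμA hB]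
      refine ENNReal.tsum_le_tsum fun n => ?_
      rw [← chartVolume_inter_source q (hB.inter (hDm n)),
        hx.chartVolume_eq_of_subset (q := c n) ((hB.inter (hDm n)).inter (measurableSet_source q))
          inter_subset_right ((inter_subset_left.trans inter_subset_right).trans (hDs n))]
      exact measure_mono inter_subset_left
    · rw [hsum (riemannianVolume m M) hB, hμA hB]
      exact ENNReal.tsum_le_tsum fun n => (le_iSup (chartVolume (m := m)) (c n)) _
  rw [heq, hμA hA, hsum (chartVolume p) hA]
  exact tsum_congr fun n => hx.chartVolume_eq_of_subset (hA.inter (hDm n))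
    (inter_subset_right.trans (hDs n)) (inter_subset_left.trans hp)

theorem IsIsometricImmersion.restrict_riemannianVolume (hx : IsIsometricImmersion x) (p : M) :
    (riemannianVolume m M).restrict (extChartAt (𝓡 m) p).source = chartVolume (m := m) p := by
  ext A hA
  rw [Measure.restrict_apply hA, hx.riemannianVolume_apply (hA.inter (measurableSet_source p))
    inter_subset_right, chartVolume_inter_source p hA]

/-- The measure `√(det g) dy` on the target of a chart. -/
def densityMeasure (p : M) : Measure (Euc m) :=
  (volume.restrict (extChartAt (𝓡 m) p).target).withDensity
    fun y => ENNReal.ofReal (volumeDensity p y)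

theorem map_comap_densityMeasure (p : M) : ((densityMeasure (m := m) p).comap
    (Subtype.val : (extChartAt (𝓡 m) p).target → Euc m)).map Subtype.val = densityMeasure p := by
  rw [map_comap_subtype_coe (measurableSet_target p), densityMeasure,
    restrict_withDensity (measurableSet_target p), Measure.restrict_restrict
    (measurableSet_target p), inter_self]

/-- On the target as a subtype the chart inverse is a measurable embedding, so integrals can be
pulled back without any measurability of the integrand. -/
theorem chartVolume_eq_map (p : M) : chartVolume (m := m) p =
    ((densityMeasure (m := m) p).comap Subtype.val).map
      fun y : (extChartAt (𝓡 m) p).target => (extChartAt (𝓡 m) p).symm y := by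
  have h1 := map_comap_densityMeasure (m := m) p
  have h2 := AEMeasurable.map_map_of_aemeasurable (μ := (densityMeasure (m := m) p).comap
      (Subtype.val : (extChartAt (𝓡 m) p).target → Euc m)) (f := Subtype.val)
      (g := (extChartAt (𝓡 m) p).symm) (by rw [h1]; exact aemeasurable_symm_withDensity p _)
      measurable_subtype_coe.aemeasurable
  rw [h1] at h2
  exact h2

theorem integral_chartVolume {p : M} (F : M → ℝ) :
    ∫ q, F q ∂chartVolume (m := m) p = ∫ y, F ((extChartAt (𝓡 m) p).symm y) ∂densityMeasure p := by
  have h1 := map_comap_densityMeasure (m := m) p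
  rw [chartVolume_eq_map, (measurableEmbedding_symm p).integral_map]
  conv_rhs => rw [← h1]
  rw [(MeasurableEmbedding.subtype_coe (measurableSet_target p)).integral_map]

theorem integrable_chartVolume {p : M} {F : M → ℝ} :
    Integrable F (chartVolume (m := m) p) ↔
      Integrable (F ∘ (extChartAt (𝓡 m) p).symm) (densityMeasure p) := by
  have h1 := map_comap_densityMeasure (m := m) p
  rw [chartVolume_eq_map, (measurableEmbedding_symm p).integrable_map_iff]
  conv_rhs => rw [← h1]
  rw [(MeasurableEmbedding.subtype_coe (measurableSet_target p)).integrable_map_iff]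
  rfl

theorem ae_chartVolume {p : M} {P : M → Prop}
    (h : ∀ᵐ y ∂(volume : Measure (Euc m)), y ∈ (extChartAt (𝓡 m) p).target →
      P ((extChartAt (𝓡 m) p).symm y)) : ∀ᵐ q ∂chartVolume (m := m) p, P q := by
  rw [chartVolume_eq_map, (measurableEmbedding_symm p).ae_map_iff]
  have h1 := map_comap_densityMeasure (m := m) p
  have h2 : ∀ᵐ y ∂densityMeasure p, P ((extChartAt (𝓡 m) p).symm y) :=
    (withDensity_absolutelyContinuous _ _).ae_le ((ae_restrict_iff' (measurableSet_target p)).2 h)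
  rw [← h1, (MeasurableEmbedding.subtype_coe (measurableSet_target p)).ae_map_iff] at h2
  exact h2

theorem IsIsometricImmersion.ae_riemannianVolume (hx : IsIsometricImmersion x) {P : M → Prop}
    (h : ∀ p, ∀ᵐ y ∂(volume : Measure (Euc m)), y ∈ (extChartAt (𝓡 m) p).target →
      P ((extChartAt (𝓡 m) p).symm y)) : ∀ᵐ q ∂riemannianVolume m M, P q := by
  rcases isEmpty_or_nonempty M with hM | hM
  · exact Filter.Eventually.of_forall fun q => (hM.false q).elim
  obtain ⟨c, hc⟩ := exists_seq_iUnion_source (m := m) (M := M)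
  rw [← Measure.restrict_univ (μ := riemannianVolume m M), ← hc, ae_restrict_iUnion_iff]
  intro n
  rw [hx.restrict_riemannianVolume]
  exact ae_chartVolume (h (c n))

theorem integral_densityMeasure (hx : IsIsometricImmersion x) (p : M) (g : Euc m → ℝ) :
    ∫ y, g y ∂densityMeasure p =
      ∫ y in (extChartAt (𝓡 m) p).target, volumeDensity p y * g y := by
  rw [densityMeasure, integral_withDensity_eq_integral_toReal_smul₀
    (hx.aemeasurable_volumeDensity p).ennreal_ofReal (Filter.Eventually.of_forall fun _ => by simp)]
  refine integral_congr_ae (Filter.Eventually.of_forall fun y => ?_)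
  simp [ENNReal.toReal_ofReal (Real.sqrt_nonneg _), volumeDensity]

theorem integrable_densityMeasure (hx : IsIsometricImmersion x) (p : M) {g : Euc m → ℝ} :
    Integrable g (densityMeasure p) ↔
      IntegrableOn (fun y => volumeDensity p y * g y) (extChartAt (𝓡 m) p).target := by
  rw [densityMeasure, integrable_withDensity_iff_integrable_smul₀'
    (hx.aemeasurable_volumeDensity p).ennreal_ofReal (Filter.Eventually.of_forall fun _ => by simp)]
  refine integrable_congr (Filter.Eventually.of_forall fun y => ?_)
  simp [ENNReal.toReal_ofReal (Real.sqrt_nonneg _), volumeDensity]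

/-- Integration in a chart. -/
theorem IsIsometricImmersion.setIntegral_source (hx : IsIsometricImmersion x) (p : M) (F : M → ℝ) :
    ∫ q in (extChartAt (𝓡 m) p).source, F q ∂riemannianVolume m M =
      ∫ y in (extChartAt (𝓡 m) p).target,
        volumeDensity p y * F ((extChartAt (𝓡 m) p).symm y) := by
  rw [hx.restrict_riemannianVolume, integral_chartVolume, integral_densityMeasure hx]

theorem IsIsometricImmersion.integrableOn_source (hx : IsIsometricImmersion x) (p : M)
    {F : M → ℝ} :
    IntegrableOn F (extChartAt (𝓡 m) p).source (riemannianVolume m M) ↔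
      IntegrableOn (fun y => volumeDensity p y * F ((extChartAt (𝓡 m) p).symm y))
        (extChartAt (𝓡 m) p).target := by
  rw [IntegrableOn, hx.restrict_riemannianVolume, integrable_chartVolume,
    integrable_densityMeasure hx]
  rfl

theorem IsIsometricImmersion.isLocallyFiniteMeasure (hx : IsIsometricImmersion x) :
    IsLocallyFiniteMeasure (riemannianVolume m M) := by
  refine ⟨fun p => ?_⟩
  obtain ⟨r, hr, hball⟩ := Metric.nhds_basis_closedBall.mem_iff.1
    (extChartAt_target_mem_nhds (I := 𝓡 m) p)
  set B := Metric.closedBall (extChartAt (𝓡 m) p p) r with hB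
  have hBc : IsCompact B := isCompact_closedBall _ _
  have hnhds : (extChartAt (𝓡 m) p).source ∩ extChartAt (𝓡 m) p ⁻¹' Metric.ball (extChartAt (𝓡 m) p p) r
      ∈ nhds p := Filter.inter_mem (extChartAt_source_mem_nhds p)
    ((continuousAt_extChartAt p).preimage_mem_nhds (Metric.ball_mem_nhds _ hr))
  have hopen : IsOpen ((extChartAt (𝓡 m) p).source ∩
      extChartAt (𝓡 m) p ⁻¹' Metric.ball (extChartAt (𝓡 m) p p) r) :=
    (continuousOn_extChartAt p).isOpen_inter_preimage (isOpen_extChartAt_source p) Metric.isOpen_ball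
  refine ⟨_, hnhds, ?_⟩
  rw [hx.riemannianVolume_apply hopen.measurableSet inter_subset_left,
    chartVolume_apply p hopen.measurableSet]
  obtain ⟨C, hC⟩ := hBc.bddAbove_image ((hx.continuousOn_volumeDensity p).mono hball)
  calc _ ≤ ∫⁻ y in B, ENNReal.ofReal (volumeDensity p y) := by
        refine lintegral_mono_set ?_
        rintro y ⟨hy, -, hy'⟩
        rw [mem_preimage, (extChartAt (𝓡 m) p).right_inv hy] at hy'
        exact Metric.ball_subset_closedBall hy'
    _ ≤ ∫⁻ y in B, ENNReal.ofReal C :=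
        setLIntegral_mono' hBc.measurableSet fun y hy =>
          ENNReal.ofReal_le_ofReal (hC (mem_image_of_mem _ hy))
    _ < ⊤ := by
        rw [setLIntegral_const]
        exact ENNReal.mul_lt_top ENNReal.ofReal_lt_top hBc.measure_lt_top

end Volume

/-! ### Compactly supported Lipschitz functions and the divergence theorem in `ℝᵐ`. -/

section LipschitzEuclidean

variable {E : Type*} [NormedAddCommGroup E] [NormedSpace ℝ E]

/-- A Lebesgue number argument: finitely many local constants serve the pairs at distance less than
`δ` that meet `K`; farther pairs are served by the bound on `|f|`, with constant `2|B|/δ`. -/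
theorem exists_lipschitzWith_of_eq_zero_off_compact {f : E → ℝ} {U K : Set E} (hU : IsOpen U)
    (hK : IsCompact K) (hKU : K ⊆ U) (hf : LocallyLipschitzOn U f) (h0 : ∀ y ∉ K, f y = 0) :
    ∃ C, LipschitzWith C f := by
  have hloc : ∀ y, ∃ C : NNReal, ∃ t ∈ nhds y, LipschitzOnWith C f t := by
    intro y
    by_cases hy : y ∈ U
    · obtain ⟨C, t, ht, hC⟩ := hf hy
      rw [hU.nhdsWithin_eq hy] at ht
      exact ⟨C, t, ht, hC⟩
    · refine ⟨0, Kᶜ, hK.isClosed.isOpen_compl.mem_nhds fun h => hy (hKU h), ?_⟩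
      intro a ha b hb
      simp [h0 a ha, h0 b hb]
  have hcont : Continuous f := by
    have : LocallyLipschitz f := hloc
    exact this.continuous
  obtain ⟨B, hB⟩ := hK.exists_bound_of_continuousOn hcont.continuousOn
  choose C t ht hC using hloc
  have hε : ∀ y, ∃ ε > 0, Metric.ball y ε ⊆ t y := fun y => Metric.mem_nhds_iff.1 (ht y)
  choose ε hε0 hεt using hε
  obtain ⟨s, -, hs⟩ := hK.elim_nhds_subcover (fun y => Metric.ball y (ε y / 2))
    fun y _ => Metric.ball_mem_nhds y (half_pos (hε0 y))
  have hδ : ∃ δ > 0, ∀ y ∈ s, δ ≤ ε y / 2 := by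
    clear hs
    classical
    induction s using Finset.induction_on with
    | empty => exact ⟨1, one_pos, by simp⟩
    | insert a s _ ih =>
      obtain ⟨δ, hδ, h⟩ := ih
      refine ⟨min δ (ε a / 2), lt_min hδ (half_pos (hε0 a)), fun y hy => ?_⟩
      rcases Finset.mem_insert.1 hy with rfl | hy
      · exact min_le_right _ _
      · exact (min_le_left _ _).trans (h y hy)
  obtain ⟨δ, hδ0, hδ⟩ := hδ
  set L : NNReal := s.sup C + Real.toNNReal (2 * |B| / δ) with hL
  have hL1 : ∀ y ∈ s, (C y : ℝ) ≤ L := by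
    intro y hy
    have : C y ≤ L := (Finset.le_sup (f := C) hy).trans le_self_add
    exact_mod_cast this
  have hL2 : 2 * |B| / δ ≤ L := by
    rw [hL, NNReal.coe_add, Real.coe_toNNReal _ (by positivity)]
    exact le_add_of_nonneg_left (by positivity)
  have key : ∀ a ∈ K, ∀ b, dist (f a) (f b) ≤ L * dist a b := by
    intro a ha b
    obtain ⟨y, hy, hay⟩ := mem_iUnion₂.1 (hs ha)
    by_cases hab : dist a b < δ
    · have h1 : a ∈ t y := hεt y (Metric.ball_subset_ball (by linarith [hε0 y]) hay)
      have h2 : b ∈ t y := by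
        refine hεt y ?_
        rw [Metric.mem_ball] at hay ⊢
        linarith [dist_triangle_left b y a, hδ y hy]
      exact ((hC y).dist_le_mul a h1 b h2).trans
        (mul_le_mul_of_nonneg_right (hL1 y hy) dist_nonneg)
    · push Not at hab
      have hb : ∀ z, |f z| ≤ |B| := by
        intro z
        by_cases hz : z ∈ K
        · exact (hB z hz).trans (le_abs_self B)
        · rw [h0 z hz, abs_zero]; exact abs_nonneg B
      calc dist (f a) (f b) ≤ |f a| + |f b| := by rw [Real.dist_eq]; exact abs_sub _ _
        _ ≤ 2 * |B| / δ * δ := by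
          rw [div_mul_cancel₀ _ hδ0.ne']; linarith [hb a, hb b]
        _ ≤ L * dist a b := mul_le_mul hL2 hab hδ0.le L.2
  refine ⟨L, LipschitzWith.of_dist_le_mul fun a b => ?_⟩
  by_cases ha : a ∈ K
  · exact key a ha b
  · by_cases hb : b ∈ K
    · rw [dist_comm, dist_comm a]; exact key b hb a
    · rw [h0 a ha, h0 b hb, dist_self]; positivity

/-- Rademacher's theorem near each point; a set that is locally null is null. -/
theorem ae_differentiableAt_of_locallyLipschitzOn [FiniteDimensional ℝ E] [MeasurableSpace E]
    [BorelSpace E] (μ : Measure E) [μ.IsAddHaarMeasure] {f : E → ℝ} {U : Set E} (hU : IsOpen U)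
    (hf : LocallyLipschitzOn U f) : ∀ᵐ y ∂μ, y ∈ U → DifferentiableAt ℝ f y := by
  rw [ae_iff]
  refine measure_null_of_locally_null _ fun y hy => ?_
  simp only [mem_ofPred_eq, Classical.not_imp] at hy
  obtain ⟨C, t, ht, hC⟩ := hf hy.1
  rw [hU.nhdsWithin_eq hy.1] at ht
  obtain ⟨V, hVt, hV, hyV⟩ := mem_nhds_iff.1 ht
  refine ⟨{a | ¬ (a ∈ U → DifferentiableAt ℝ f a)} ∩ V,
    inter_mem_nhdsWithin _ (hV.mem_nhds hyV), ?_⟩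
  have h := (hC.mono hVt).ae_differentiableWithinAt (μ := μ) hV.measurableSet
  rw [ae_restrict_iff' hV.measurableSet, ae_iff] at h
  refine measure_mono_null ?_ h
  rintro z ⟨hz, hzV⟩ h1
  exact hz fun _ => (h1 hzV).differentiableAt (hV.mem_nhds hzV)

/-- The divergence theorem for the product of a compactly supported Lipschitz function and a
smooth vector field. -/
theorem integral_divergence_eq_zero {m : ℕ} {f : Euc m → ℝ} {U K : Set (Euc m)} (hU : IsOpen U)
    (hK : IsCompact K) (hKU : K ⊆ U) (hf : LocallyLipschitzOn U f) (h0 : ∀ y ∉ K, f y = 0)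
    {W : Fin m → Euc m → ℝ} (hW : ∀ i, ∀ y ∈ U, ContDiffAt ℝ ∞ (W i) y) :
    Integrable (fun y => ∑ i, (partialDeriv f i y * W i y + f y * partialDeriv (W i) i y)) ∧
      ∫ y, ∑ i, (partialDeriv f i y * W i y + f y * partialDeriv (W i) i y) = 0 := by
  obtain ⟨C, hC⟩ := exists_lipschitzWith_of_eq_zero_off_compact hU hK hKU hf h0
  obtain ⟨L, hL, hKL, hLU⟩ := exists_compact_between hK hU hKU
  -- `W` is smooth only on `U`. Multiplying by a cutoff that is `1` on `K` makes it smooth with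
  -- compact support, without changing it where `f` is nonzero.
  obtain ⟨χ, hχ, -, hχs, hχ1⟩ := exists_contMDiff_support_eq_eq_one_iff 𝓘(ℝ, Euc m) (n := ⊤)
    isOpen_interior hK.isClosed hKL
  have hχd : ContDiff ℝ ∞ χ := contMDiff_iff_contDiff.1 hχ
  have hχt : tsupport χ ⊆ L := by
    rw [tsupport, hχs]
    exact closure_minimal interior_subset hL.isClosed
  set V : Fin m → Euc m → ℝ := fun i y => χ y * W i y with hV
  have hVt : ∀ i, ∀ y ∉ L, V i =ᶠ[nhds y] 0 := by
    intro i y hy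
    filter_upwards [hL.isClosed.isOpen_compl.mem_nhds hy] with z hz
    simp [hV, image_eq_zero_of_notMem_tsupport fun h => hz (hχt h)]
  have hVd : ∀ i, ContDiff ℝ ∞ (V i) := by
    intro i
    rw [contDiff_iff_contDiffAt]
    intro y
    by_cases hy : y ∈ L
    · exact hχd.contDiffAt.mul (hW i y (hLU hy))
    · exact (contDiffAt_const (c := (0 : ℝ))).congr_of_eventuallyEq (hVt i y hy)
  have hVc : ∀ i, HasCompactSupport (V i) := fun i =>
    HasCompactSupport.intro hL fun y hy => (hVt i y hy).self_of_nhds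
  -- At a frontier point of `K` the cutoff need not be `1` nearby, but `{f ≠ 0}` is open and
  -- contained in `K`.
  have hsupp : ∀ y, f y ≠ 0 → ∀ᶠ z in nhds y, χ z = 1 := by
    intro y hy
    filter_upwards [(isOpen_ne_fun hC.continuous continuous_const).mem_nhds hy] with z hz
    exact (hχ1 z).1 (by by_contra h; exact hz (h0 z h))
  have hsupp0 : ∀ y ∉ K, f =ᶠ[nhds y] 0 := fun y hy => by
    filter_upwards [hK.isClosed.isOpen_compl.mem_nhds hy] with z hz using h0 z hz
  have hibp : ∀ i, Integrable (fun y => partialDeriv f i y * W i y + f y * partialDeriv (W i) i y) ∧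
      ∫ y, (partialDeriv f i y * W i y + f y * partialDeriv (W i) i y) = 0 := by
    intro i
    obtain ⟨D, hD⟩ := ContDiff.lipschitzWith_of_hasCompactSupport (hVc i) (hVd i) (by simp)
    have h1 := hC.integral_lineDeriv_mul_eq (μ := (volume : Measure (Euc m))) hD (hVc i)
      (EuclideanSpace.single i 1)
    have h2 : (fun y => partialDeriv f i y * W i y) =ᵐ[volume]
        fun y => lineDeriv ℝ f y (EuclideanSpace.single i 1) * V i y := by
      filter_upwards [hC.ae_differentiableAt (μ := volume)] with y hy
      rw [hy.lineDeriv_eq_fderiv, hV]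
      by_cases hyK : y ∈ K
      · simp [(hχ1 y).1 hyK, partialDeriv]
      · rw [partialDeriv, (hsupp0 y hyK).fderiv_eq]
        simp
    have h3 : (fun y => f y * partialDeriv (W i) i y) =
        fun y => -(lineDeriv ℝ (V i) y (-EuclideanSpace.single i 1) * f y) := by
      funext y
      rw [((hVd i).differentiable (by simp) y).lineDeriv_eq_fderiv]
      by_cases hy : f y = 0
      · simp [hy]
      · have h4 : V i =ᶠ[nhds y] W i := by
          filter_upwards [hsupp y hy] with z hz
          simp [hV, hz]
        rw [h4.fderiv_eq, map_neg, partialDeriv]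
        ring
    have hint1 : Integrable fun y => lineDeriv ℝ f y (EuclideanSpace.single i 1) * V i y := by
      have hVi : Integrable (V i) := (hVd i).continuous.integrable_of_hasCompactSupport (hVc i)
      have hm := (hC.memLp_lineDeriv (μ := (volume : Measure (Euc m)))
        (EuclideanSpace.single i 1))
      exact (memLp_one_iff_integrable.2 hVi).integrable_mul hm |>.congr
        (Filter.Eventually.of_forall fun y => mul_comm _ _)
    have hint2 : Integrable fun y => f y * partialDeriv (W i) i y := by
      rw [h3]
      have hfi : Integrable f := hC.continuous.integrable_of_hasCompactSupport
        (HasCompactSupport.intro hK h0)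
      have hm := (hD.memLp_lineDeriv (μ := (volume : Measure (Euc m)))
        (-EuclideanSpace.single i 1))
      exact (((memLp_one_iff_integrable.2 hfi).integrable_mul hm).congr
        (Filter.Eventually.of_forall fun y => mul_comm _ _)).neg
    have hint1' := hint1.congr h2.symm
    refine ⟨hint1'.add hint2, ?_⟩
    rw [integral_add hint1' hint2, integral_congr_ae h2, h1, h3, integral_neg, add_neg_cancel]
  exact ⟨integrable_finsetSum _ fun i _ => (hibp i).1, by
    rw [integral_finsetSum _ fun i _ => (hibp i).1]
    exact Finset.sum_eq_zero fun i _ => (hibp i).2⟩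

end LipschitzEuclidean

/-! ### Functions that are Lipschitz in charts. -/

section ChartLipschitz

variable {m : ℕ} {M : Type*} [TopologicalSpace M] [ChartedSpace (Euc m) M] [IsManifold (𝓡 m) ∞ M]

variable (m) in
/-- A function that is locally Lipschitz in every chart. -/
def ChartLipschitz (u : M → ℝ) : Prop :=
  ∀ p : M, LocallyLipschitzOn (extChartAt (𝓡 m) p).target (u ∘ (extChartAt (𝓡 m) p).symm)

theorem ChartLipschitz.comp_prodMk {u v : M → ℝ} (hu : ChartLipschitz m u)
    (hv : ChartLipschitz m v) {G : ℝ × ℝ → ℝ} (hG : LocallyLipschitz G) :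
    ChartLipschitz m fun q => G (u q, v q) := by
  intro p
  rw [locallyLipschitzOn_iff_restrict]
  exact hG.comp ((locallyLipschitzOn_iff_restrict.1 (hu p)).prodMk
    (locallyLipschitzOn_iff_restrict.1 (hv p)))

theorem ChartLipschitz.mul {u v : M → ℝ} (hu : ChartLipschitz m u) (hv : ChartLipschitz m v) :
    ChartLipschitz m fun q => u q * v q :=
  hu.comp_prodMk hv (G := fun z => z.1 * z.2)
    (ContDiff.locallyLipschitz (𝕂 := ℝ) (contDiff_fst.mul contDiff_snd))

theorem ChartLipschitz.add {u v : M → ℝ} (hu : ChartLipschitz m u) (hv : ChartLipschitz m v) :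
    ChartLipschitz m fun q => u q + v q :=
  hu.comp_prodMk hv (G := fun z => z.1 + z.2)
    (ContDiff.locallyLipschitz (𝕂 := ℝ) (contDiff_fst.add contDiff_snd))

theorem _root_.ContMDiff.chartLipschitz {u : M → ℝ} (hu : ContMDiff (𝓡 m) 𝓘(ℝ, ℝ) ∞ u) :
    ChartLipschitz m u := by
  intro p y hy
  obtain ⟨C, t, ht, hC⟩ := ((contDiffAt_comp_symm hu hy).of_le (by simp)).exists_lipschitzOnWith
  exact ⟨C, t, nhdsWithin_le_nhds ht, hC⟩

theorem ChartLipschitz.continuous {u : M → ℝ} (hu : ChartLipschitz m u) : Continuous u := by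
  rw [continuous_iff_continuousAt]
  intro q
  have h1 : ContinuousOn (u ∘ (extChartAt (𝓡 m) q).symm) (extChartAt (𝓡 m) q).target :=
    (hu q).continuousOn
  have h2 : ContinuousAt ((u ∘ (extChartAt (𝓡 m) q).symm) ∘ extChartAt (𝓡 m) q) q :=
    (h1.continuousAt (extChartAt_target_mem_nhds q)).comp (continuousAt_extChartAt q)
  refine h2.congr ?_
  filter_upwards [extChartAt_source_mem_nhds (I := 𝓡 m) q] with z hz
  simp only [Function.comp_apply, (extChartAt (𝓡 m) q).left_inv hz]

variable [MeasurableSpace M] [BorelSpace M] [SecondCountableTopology M]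
  [RiemannianBundle (fun p : M => TangentSpace (𝓡 m) p)] {x : M → Euc (m + 1)}

theorem ChartLipschitz.ae_mdifferentiableAt {u : M → ℝ} (hu : ChartLipschitz m u)
    (hx : IsIsometricImmersion x) :
    ∀ᵐ q ∂riemannianVolume m M, MDifferentiableAt (𝓡 m) 𝓘(ℝ, ℝ) u q := by
  refine hx.ae_riemannianVolume fun p => ?_
  filter_upwards [ae_differentiableAt_of_locallyLipschitzOn volume (isOpen_extChartAt_target p)
    (hu p)] with y hy hy'
  exact mdifferentiableAt_of_comp_symm hy' (hy hy')

end ChartLipschitz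

/-! ### Calculus of the Riemannian gradient. -/

section Gradient

variable {m : ℕ} {M : Type*} [TopologicalSpace M] [ChartedSpace (Euc m) M] [IsManifold (𝓡 m) ∞ M]
  [RiemannianBundle (fun p : M => TangentSpace (𝓡 m) p)]

theorem riemGradient_add {u v : M → ℝ} {q : M} (hu : MDifferentiableAt (𝓡 m) 𝓘(ℝ, ℝ) u q)
    (hv : MDifferentiableAt (𝓡 m) 𝓘(ℝ, ℝ) v q) :
    riemGradient (m := m) (fun z => u z + v z) q =
      riemGradient (m := m) u q + riemGradient (m := m) v q := by
  refine ext_inner_right ℝ fun w => ?_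
  rw [inner_add_left, inner_riemGradient, inner_riemGradient, inner_riemGradient]
  exact congrArg (fun L => L w) (hu.hasMFDerivAt.add hv.hasMFDerivAt).mfderiv

theorem riemGradient_mul {u v : M → ℝ} {q : M} (hu : MDifferentiableAt (𝓡 m) 𝓘(ℝ, ℝ) u q)
    (hv : MDifferentiableAt (𝓡 m) 𝓘(ℝ, ℝ) v q) :
    riemGradient (m := m) (fun z => u z * v z) q =
      u q • riemGradient (m := m) v q + v q • riemGradient (m := m) u q := by
  refine ext_inner_right ℝ fun w => ?_
  rw [inner_add_left, real_inner_smul_left, real_inner_smul_left, inner_riemGradient,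
    inner_riemGradient, inner_riemGradient]
  exact congrArg (fun L => L w) (hu.hasMFDerivAt.mul hv.hasMFDerivAt).mfderiv

theorem riemGradient_comp {g : ℝ → ℝ} {u : M → ℝ} {q : M} {g' : ℝ}
    (hg : HasDerivAt g g' (u q)) (hu : MDifferentiableAt (𝓡 m) 𝓘(ℝ, ℝ) u q) :
    riemGradient (m := m) (fun z => g (u z)) q = g' • riemGradient (m := m) u q := by
  refine ext_inner_right ℝ fun w => ?_
  rw [real_inner_smul_left, inner_riemGradient, inner_riemGradient]
  have h := congrArg (fun L => L w) (hg.hasFDerivAt.hasMFDerivAt.comp q hu.hasMFDerivAt).mfderiv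
  refine Eq.trans h ?_
  exact mul_comm _ _

theorem riemGradient_eq_zero {u : M → ℝ} {q : M} (h : u =ᶠ[nhds q] 0) :
    riemGradient (m := m) u q = 0 := by
  refine ext_inner_right ℝ fun w => ?_
  have h0 : mfderiv (𝓡 m) 𝓘(ℝ, ℝ) (0 : M → ℝ) q = 0 := mfderiv_const
  rw [inner_zero_left, inner_riemGradient, h.mfderiv_eq, h0]
  rfl

end Gradient

/-! ### The first variation formula. -/

section FirstVariation

variable {m : ℕ} {M : Type*} [TopologicalSpace M] [ChartedSpace (Euc m) M] [IsManifold (𝓡 m) ∞ M]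
  [MeasurableSpace M] [BorelSpace M] [SecondCountableTopology M]
  [RiemannianBundle (fun p : M => TangentSpace (𝓡 m) p)] {x : M → Euc (m + 1)}

theorem partialDeriv_apply {X : Euc m → Euc (m + 1)} {y : Euc m} (hX : DifferentiableAt ℝ X y)
    (i : Fin m) (k : Fin (m + 1)) :
    partialDeriv (fun z => X z k) i y = partialDeriv X i y k := by
  have h : HasFDerivAt (fun z => X z k)
      ((EuclideanSpace.proj k : Euc (m + 1) →L[ℝ] ℝ).comp (fderiv ℝ X y)) y :=
    (EuclideanSpace.proj k : Euc (m + 1) →L[ℝ] ℝ).hasFDerivAt.comp y hX.hasFDerivAt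
  rw [partialDeriv, h.fderiv]
  rfl

theorem starProjection_congr {F : Type*} [NormedAddCommGroup F] [InnerProductSpace ℝ F]
    {K L : Submodule ℝ F} [K.HasOrthogonalProjection] [L.HasOrthogonalProjection] (h : K = L) :
    K.starProjection = L.starProjection := by
  subst h; rfl

/-- The integrand of the first variation of the volume in the direction `ψ eₖ`. -/
def variationIntegrand (x : M → Euc (m + 1)) (k : Fin (m + 1)) (ψ : M → ℝ) (q : M) : ℝ :=
  inner ℝ (riemGradient (m := m) ψ q) (coordGradient x k q) + ψ q * meanCurvatureVector x q k

/-- In coordinates the first variation integrand is the Euclidean divergence of `ψ W`, where `Wᵢ` is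
the `k`-th component of `∑ⱼ √g gⁱʲ ∂ⱼX`. The divergence of `W` itself is `√g Hₖ` by
`sum_partialDeriv_divCoeff`. -/
theorem IsIsometricImmersion.volumeDensity_mul_variationIntegrand (hx : IsIsometricImmersion x)
    {p : M} {y : Euc m} (hy : y ∈ (extChartAt (𝓡 m) p).target) {ψ : M → ℝ}
    (hψ : DifferentiableAt ℝ (ψ ∘ (extChartAt (𝓡 m) p).symm) y) (k : Fin (m + 1)) :
    volumeDensity p y * variationIntegrand x k ψ ((extChartAt (𝓡 m) p).symm y) =
      ∑ i, (partialDeriv (ψ ∘ (extChartAt (𝓡 m) p).symm) i y *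
        (∑ j, divCoeff (x ∘ (extChartAt (𝓡 m) p).symm) i j y •
          partialDeriv (x ∘ (extChartAt (𝓡 m) p).symm) j y) k +
        ψ ((extChartAt (𝓡 m) p).symm y) * partialDeriv (fun z =>
          (∑ j, divCoeff (x ∘ (extChartAt (𝓡 m) p).symm) i j z •
            partialDeriv (x ∘ (extChartAt (𝓡 m) p).symm) j z) k) i y) := by
  set X := x ∘ (extChartAt (𝓡 m) p).symm with hX
  have hXd : ContDiffAt ℝ ∞ X y := contDiffAt_comp_symm hx.contMDiff hy
  have hG0 := hx.det_paramGram_pos hy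
  have hV : ∀ i, DifferentiableAt ℝ (fun z => ∑ j, divCoeff X i j z • partialDeriv X j z) y :=
    fun i => DifferentiableAt.fun_sum fun j _ =>
      ((contDiffAt_divCoeff hXd hG0 i j).differentiableAt (by simp)).smul
        ((contDiffAt_partialDeriv (k := ∞) hXd j le_rfl).differentiableAt (by simp))
  have hdiv := sum_partialDeriv_divCoeff hXd hG0
  rw [starProjection_congr (congrArg _ (hx.range_fderiv_comp_symm hy))] at hdiv
  have hdivk : ∑ i, partialDeriv (fun z => (∑ j, divCoeff X i j z • partialDeriv X j z) k) i y =
      ∑ i, ∑ j, divCoeff X i j y * normalProj x ((extChartAt (𝓡 m) p).symm y)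
        (partialDeriv (partialDeriv X j) i y) k := by
    have h1 : ∀ i, partialDeriv (fun z => (∑ j, divCoeff X i j z • partialDeriv X j z) k) i y =
        partialDeriv (fun z => ∑ j, divCoeff X i j z • partialDeriv X j z) i y k :=
      fun i => partialDeriv_apply (hV i) i k
    simp_rw [h1]
    have h2 := congrArg (fun v : Euc (m + 1) => v k) hdiv
    simp only [WithLp.ofLp_sum, Finset.sum_apply, PiLp.smul_apply, smul_eq_mul] at h2
    exact h2
  rw [Finset.sum_add_distrib, ← Finset.mul_sum, hdivk, variationIntegrand, coordGradient,
    inner_riemGradient_eq hy (mdifferentiableAt_of_comp_symm hy hψ)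
      ((hx.contMDiff_coord k).contMDiffAt.mdifferentiableAt (by simp)),
    hx.meanCurvatureVector_symm hy, hx.gramMatrix_eq hy, hx.volumeDensity_eq hy, mul_add]
  congr 1
  · rw [Finset.mul_sum]
    refine Finset.sum_congr rfl fun i _ => ?_
    simp only [WithLp.ofLp_sum, Finset.sum_apply, PiLp.smul_apply, smul_eq_mul, Finset.mul_sum]
    refine Finset.sum_congr rfl fun j _ => ?_
    have h3 : partialDeriv ((fun z => x z k) ∘ (extChartAt (𝓡 m) p).symm) j y =
        partialDeriv X j y k := partialDeriv_apply (hXd.differentiableAt (by simp)) j k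
    rw [h3, divCoeff]
    ring
  · simp only [WithLp.ofLp_sum, Finset.sum_apply, PiLp.smul_apply, smul_eq_mul, Finset.mul_sum]
    refine Finset.sum_congr rfl fun i _ => Finset.sum_congr rfl fun j _ => ?_
    rw [divCoeff]
    ring

theorem variationIntegrand_eq_zero {ψ : M → ℝ} {q : M} (hq : q ∉ tsupport ψ) (k : Fin (m + 1)) :
    variationIntegrand x k ψ q = 0 := by
  have h : ψ =ᶠ[nhds q] 0 := by
    filter_upwards [(isClosed_tsupport ψ).isOpen_compl.mem_nhds hq] with z hz
    exact image_eq_zero_of_notMem_tsupport hz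
  rw [variationIntegrand, riemGradient_eq_zero h, h.self_of_nhds]
  simp

theorem IsIsometricImmersion.first_variation_of_tsupport_subset (hx : IsIsometricImmersion x)
    {ψ : M → ℝ} (hψ : ChartLipschitz m ψ) (hc : HasCompactSupport ψ) {p : M}
    (hp : tsupport ψ ⊆ (extChartAt (𝓡 m) p).source) (k : Fin (m + 1)) :
    Integrable (variationIntegrand x k ψ) (riemannianVolume m M) ∧
      ∫ q, variationIntegrand x k ψ q ∂riemannianVolume m M = 0 := by
  set U := (extChartAt (𝓡 m) p).target with hU
  set X := x ∘ (extChartAt (𝓡 m) p).symm with hX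
  have hUo : IsOpen U := isOpen_extChartAt_target p
  set K := extChartAt (𝓡 m) p '' tsupport ψ with hK
  have hKc : IsCompact K := hc.isCompact.image_of_continuousOn ((continuousOn_extChartAt p).mono hp)
  have hKU : K ⊆ U := by
    rintro _ ⟨q, hq, rfl⟩
    exact (extChartAt (𝓡 m) p).map_source (hp hq)
  -- Off the target the chart inverse is arbitrary, hence the indicator. It does no harm, because
  -- the support is compact inside `U`.
  set f : Euc m → ℝ := U.indicator (ψ ∘ (extChartAt (𝓡 m) p).symm) with hf
  have hfU : ∀ y ∈ U, f y = ψ ((extChartAt (𝓡 m) p).symm y) := fun y hy => indicator_of_mem hy _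
  have hf0 : ∀ y ∉ K, f y = 0 := by
    intro y hy
    by_cases hyU : y ∈ U
    · rw [hfU y hyU]
      refine image_eq_zero_of_notMem_tsupport fun h => hy ⟨_, h, (extChartAt (𝓡 m) p).right_inv hyU⟩
    · exact indicator_of_notMem hyU _
  have hfl : LocallyLipschitzOn U f := by
    intro y hy
    obtain ⟨C, t, ht, hC⟩ := hψ p hy
    refine ⟨C, t ∩ U, Filter.inter_mem ht self_mem_nhdsWithin, fun a ha b hb => ?_⟩
    rw [hfU a ha.2, hfU b hb.2]
    exact hC ha.1 hb.1
  set W : Fin m → Euc m → ℝ := fun i z => (∑ j, divCoeff X i j z • partialDeriv X j z) k with hW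
  have hWd : ∀ i, ∀ y ∈ U, ContDiffAt ℝ ∞ (W i) y := by
    intro i y hy
    have hXd : ContDiffAt ℝ ∞ X y := contDiffAt_comp_symm hx.contMDiff hy
    have h1 : ContDiffAt ℝ ∞ (fun z => ∑ j, divCoeff X i j z • partialDeriv X j z) y :=
      ContDiffAt.sum fun j _ => (contDiffAt_divCoeff hXd (hx.det_paramGram_pos hy) i j).smul
        (contDiffAt_partialDeriv hXd j le_rfl)
    exact (EuclideanSpace.proj k : Euc (m + 1) →L[ℝ] ℝ).contDiff.contDiffAt.comp y h1
  obtain ⟨hint, hzero⟩ := integral_divergence_eq_zero hUo hKc hKU hfl hf0 hWd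
  have hae : U.indicator (fun y => volumeDensity p y *
      variationIntegrand x k ψ ((extChartAt (𝓡 m) p).symm y)) =ᵐ[volume]
      fun y => ∑ i, (partialDeriv f i y * W i y + f y * partialDeriv (W i) i y) := by
    filter_upwards [ae_differentiableAt_of_locallyLipschitzOn volume hUo (hψ p)] with y hy
    by_cases hyU : y ∈ U
    · rw [indicator_of_mem hyU, hx.volumeDensity_mul_variationIntegrand hyU (hy hyU)]
      have h1 : f =ᶠ[nhds y] ψ ∘ (extChartAt (𝓡 m) p).symm := by
        filter_upwards [hUo.mem_nhds hyU] with z hz using hfU z hz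
      refine Finset.sum_congr rfl fun i _ => ?_
      rw [hfU y hyU]
      simp only [partialDeriv, h1.fderiv_eq, hW]
      rfl
    · have h1 : f =ᶠ[nhds y] 0 := by
        filter_upwards [hKc.isClosed.isOpen_compl.mem_nhds fun h => hyU (hKU h)] with z hz
          using hf0 z hz
      rw [indicator_of_notMem hyU]
      refine (Finset.sum_eq_zero fun i _ => ?_).symm
      rw [partialDeriv, h1.fderiv_eq, h1.self_of_nhds]
      simp
  have hsub : Function.support (variationIntegrand x k ψ) ⊆ (extChartAt (𝓡 m) p).source := by
    intro q hq
    by_contra h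
    exact hq (variationIntegrand_eq_zero (fun h1 => h (hp h1)) k)
  constructor
  · rw [← integrableOn_iff_integrable_of_support_subset hsub, hx.integrableOn_source,
      ← integrable_indicator_iff hUo.measurableSet]
    exact hint.congr hae.symm
  · rw [← setIntegral_eq_integral_of_forall_compl_eq_zero (s := (extChartAt (𝓡 m) p).source)
      fun q hq => by_contra fun h => hq (hsub h), hx.setIntegral_source,
      ← integral_indicator hUo.measurableSet, integral_congr_ae hae]
    exact hzero

theorem IsIsometricImmersion.variationIntegrand_add (hx : IsIsometricImmersion x) {ψ₁ ψ₂ : M → ℝ}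
    (h₁ : ChartLipschitz m ψ₁) (h₂ : ChartLipschitz m ψ₂) (k : Fin (m + 1)) :
    variationIntegrand x k (fun q => ψ₁ q + ψ₂ q) =ᵐ[riemannianVolume m M]
      fun q => variationIntegrand x k ψ₁ q + variationIntegrand x k ψ₂ q := by
  filter_upwards [h₁.ae_mdifferentiableAt hx, h₂.ae_mdifferentiableAt hx] with q hq₁ hq₂
  simp only [variationIntegrand, riemGradient_add hq₁ hq₂, inner_add_left]
  ring

/-- The first variation formula, for a compactly supported locally Lipschitz function. -/
theorem IsIsometricImmersion.first_variation [T2Space M] (hx : IsIsometricImmersion x)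
    {ψ : M → ℝ} (hψ : ChartLipschitz m ψ) (hc : HasCompactSupport ψ) (k : Fin (m + 1)) :
    Integrable (variationIntegrand x k ψ) (riemannianVolume m M) ∧
      ∫ q, variationIntegrand x k ψ q ∂riemannianVolume m M = 0 := by
  have : LocallyCompactSpace M := Manifold.locallyCompact_of_finiteDimensional (𝓡 m)
  obtain ⟨t, -, ht⟩ := hc.isCompact.elim_nhds_subcover (fun p => (extChartAt (𝓡 m) p).source)
    fun p _ => extChartAt_source_mem_nhds p
  obtain ⟨χ, hχ⟩ := SmoothPartitionOfUnity.exists_isSubordinate (𝓡 m) (isClosed_tsupport ψ)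
    (fun c : t => (extChartAt (𝓡 m) (c : M)).source) (fun c => isOpen_extChartAt_source _)
    (by simpa [iUnion_subtype] using ht)
  have hlip : ∀ c, ChartLipschitz m fun q => χ c q * ψ q := fun c =>
    (χ c).contMDiff.chartLipschitz.mul hψ
  have hloc : ∀ c, Integrable (variationIntegrand x k fun q => χ c q * ψ q) (riemannianVolume m M) ∧
      ∫ q, variationIntegrand x k (fun q => χ c q * ψ q) q ∂riemannianVolume m M = 0 := fun c =>
    hx.first_variation_of_tsupport_subset (p := c) (hlip c) hc.mul_left
      ((tsupport_mul_subset_left).trans (hχ c)) k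
  -- The integrand is additive in `ψ` only where both summands are differentiable, that is, almost
  -- everywhere. The induction therefore carries the Lipschitz property along.
  have hsum : ∀ s : Finset t, ChartLipschitz m (fun q => ∑ c ∈ s, χ c q * ψ q) ∧
      Integrable (variationIntegrand x k fun q => ∑ c ∈ s, χ c q * ψ q) (riemannianVolume m M) ∧
      ∫ q, variationIntegrand x k (fun q => ∑ c ∈ s, χ c q * ψ q) q ∂riemannianVolume m M = 0 := by
    intro s
    classical
    induction s using Finset.induction_on with
    | empty =>
      have h0 : variationIntegrand x k (fun _ : M => (0 : ℝ)) = 0 := by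
        funext q
        exact variationIntegrand_eq_zero (by simp [tsupport, Function.support]) k
      simp only [Finset.sum_empty, h0]
      exact ⟨contMDiff_const.chartLipschitz, integrable_zero _ _ _, by simp⟩
    | insert c s hcs ih =>
      simp only [Finset.sum_insert hcs]
      have hadd := hx.variationIntegrand_add (hlip c) ih.1 k
      refine ⟨(hlip c).add ih.1, ((hloc c).1.add ih.2.1).congr hadd.symm, ?_⟩
      rw [integral_congr_ae hadd, integral_add (hloc c).1 ih.2.1, (hloc c).2, ih.2.2, add_zero]
  have heq : (fun q => ∑ c, χ c q * ψ q) = ψ := by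
    funext q
    rw [← Finset.sum_mul]
    by_cases hq : q ∈ tsupport ψ
    · rw [← finsum_eq_sum_of_fintype, χ.sum_eq_one hq, one_mul]
    · rw [image_eq_zero_of_notMem_tsupport hq, mul_zero]
  have h := (hsum Finset.univ).2
  rwa [heq] at h

end FirstVariation

/-! ### The weighted measure, the weighted Laplacian of the coordinates and the Poincaré inequality.
-/

section Weighted

variable {m : ℕ} {M : Type*} [TopologicalSpace M] [ChartedSpace (Euc m) M] [IsManifold (𝓡 m) ∞ M]
  [MeasurableSpace M] [BorelSpace M] [SecondCountableTopology M]
  [RiemannianBundle (fun p : M => TangentSpace (𝓡 m) p)] {x : M → Euc (m + 1)}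

theorem riemGradient_eq_zero_of_notMem_tsupport {u : M → ℝ} {q : M} (hq : q ∉ tsupport u) :
    riemGradient (m := m) u q = 0 := by
  refine riemGradient_eq_zero ?_
  filter_upwards [(isClosed_tsupport u).isOpen_compl.mem_nhds hq] with z hz
  exact image_eq_zero_of_notMem_tsupport hz

theorem IsIsometricImmersion.continuous_norm_sq_riemGradient (hx : IsIsometricImmersion x)
    {u : M → ℝ} (hu : ContMDiff (𝓡 m) 𝓘(ℝ, ℝ) ∞ u) :
    Continuous fun q => ‖riemGradient (m := m) u q‖ ^ 2 := by
  rw [continuous_iff_continuousAt]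
  intro p
  set X := x ∘ (extChartAt (𝓡 m) p).symm with hX
  set v := u ∘ (extChartAt (𝓡 m) p).symm with hv
  have hyp : extChartAt (𝓡 m) p p ∈ (extChartAt (𝓡 m) p).target := mem_extChartAt_target p
  have h1 : ContinuousAt (fun y => ∑ i, ∑ j, (paramGram X y)⁻¹ i j * partialDeriv v i y *
      partialDeriv v j y) (extChartAt (𝓡 m) p p) := by
    have hXd : ContDiffAt ℝ ∞ X _ := contDiffAt_comp_symm hx.contMDiff hyp
    have hvd : ContDiffAt ℝ ∞ v _ := contDiffAt_comp_symm hu hyp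
    have h2 : ∀ i, ContinuousAt (partialDeriv v i) (extChartAt (𝓡 m) p p) := fun i =>
      (contDiffAt_partialDeriv (k := ∞) hvd i le_rfl).continuousAt
    have h3 : ∀ i j, ContinuousAt (fun y => (paramGram X y)⁻¹ i j) (extChartAt (𝓡 m) p p) :=
      fun i j => (contDiffAt_inv_apply (fun a b => contDiffAt_paramGram hXd a b)
        (hx.det_paramGram_pos hyp).ne' i j).continuousAt
    exact tendsto_finsetSum _ fun i _ => tendsto_finsetSum _ fun j _ =>
      ((h3 i j).mul (h2 i)).mul (h2 j)
  refine (h1.comp (continuousAt_extChartAt p)).congr ?_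
  filter_upwards [extChartAt_source_mem_nhds (I := 𝓡 m) p] with z hz
  have hy := (extChartAt (𝓡 m) p).map_source hz
  have hd := hu.contMDiffAt (x := (extChartAt (𝓡 m) p).symm (extChartAt (𝓡 m) p z))
    |>.mdifferentiableAt (by simp)
  have h4 := inner_riemGradient_eq hy hd hd
  rw [(extChartAt (𝓡 m) p).left_inv hz, real_inner_self_eq_norm_sq, hx.gramMatrix_eq hy] at h4
  exact h4.symm

/-- The weighted volume measure `e^{x_{m+1}} dvol`. -/
def weightedMeasure (x : M → Euc (m + 1)) : Measure M :=
  (riemannianVolume m M).withDensity fun q => ENNReal.ofReal (Real.exp (x q (Fin.last m)))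

theorem IsIsometricImmersion.continuous_coord (hx : IsIsometricImmersion x) (k : Fin (m + 1)) :
    Continuous fun q => x q k := (hx.contMDiff_coord k).continuous

theorem IsIsometricImmersion.measurable_weight (hx : IsIsometricImmersion x) :
    Measurable fun q => ENNReal.ofReal (Real.exp (x q (Fin.last m))) :=
  (Real.continuous_exp.comp (hx.continuous_coord _)).measurable.ennreal_ofReal

theorem IsIsometricImmersion.integral_weightedMeasure (hx : IsIsometricImmersion x) (F : M → ℝ) :
    ∫ q, F q ∂weightedMeasure x =
      ∫ q, F q * Real.exp (x q (Fin.last m)) ∂riemannianVolume m M := by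
  rw [weightedMeasure, integral_withDensity_eq_integral_toReal_smul₀
    hx.measurable_weight.aemeasurable (Filter.Eventually.of_forall fun _ => by simp)]
  refine integral_congr_ae (Filter.Eventually.of_forall fun y => ?_)
  simp [ENNReal.toReal_ofReal (Real.exp_pos _).le, mul_comm]

theorem IsIsometricImmersion.integrable_weightedMeasure (hx : IsIsometricImmersion x)
    {F : M → ℝ} : Integrable F (weightedMeasure x) ↔
      Integrable (fun q => F q * Real.exp (x q (Fin.last m))) (riemannianVolume m M) := by
  rw [weightedMeasure, integrable_withDensity_iff_integrable_smul₀'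
    hx.measurable_weight.aemeasurable (Filter.Eventually.of_forall fun _ => by simp)]
  refine integrable_congr (Filter.Eventually.of_forall fun y => ?_)
  simp [ENNReal.toReal_ofReal (Real.exp_pos _).le, mul_comm]

theorem IsIsometricImmersion.isLocallyFiniteMeasure_weightedMeasure (hx : IsIsometricImmersion x) :
    IsLocallyFiniteMeasure (weightedMeasure x) := by
  have := hx.isLocallyFiniteMeasure
  exact IsLocallyFiniteMeasure.withDensity_ofReal
    (Real.continuous_exp.comp (hx.continuous_coord (Fin.last m)))

theorem weightedVolume_eq {f : M → ℝ} (hf : ∀ p, f p = -x p (Fin.last m)) {A : Set M}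
    (hA : MeasurableSet A) : weightedVolume m f A = weightedMeasure x A := by
  rw [weightedMeasure, withDensity_apply _ hA, weightedVolume]
  simp [hf]

theorem ChartLipschitz.ae_mdifferentiableAt_weighted {u : M → ℝ} (hu : ChartLipschitz m u)
    (hx : IsIsometricImmersion x) :
    ∀ᵐ q ∂weightedMeasure x, MDifferentiableAt (𝓡 m) 𝓘(ℝ, ℝ) u q :=
  (withDensity_absolutelyContinuous _ _).ae_le (hu.ae_mdifferentiableAt hx)

theorem IsTranslator.norm_sq_meanCurvatureVector (hx : IsTranslator x) (q : M) :
    ‖meanCurvatureVector x q‖ ^ 2 = 1 - ‖coordGradient x (Fin.last m) q‖ ^ 2 := by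
  rw [hx.meanCurvatureVector_eq, hx.norm_sq_normalProj_single]

/-- On a translator the coordinates `xₖ`, `k ≤ m`, are harmonic for the weighted volume, and the
weighted Laplacian of `x_{m+1}` is `1`. -/
theorem IsTranslator.integral_inner_coordGradient [T2Space M] (hx : IsTranslator x) {ψ : M → ℝ}
    (hψ : ChartLipschitz m ψ) (hc : HasCompactSupport ψ) (k : Fin (m + 1)) :
    Integrable (fun q => inner ℝ (riemGradient (m := m) ψ q) (coordGradient x k q) +
      ψ q * if k = Fin.last m then 1 else 0) (weightedMeasure x) ∧
    ∫ q, (inner ℝ (riemGradient (m := m) ψ q) (coordGradient x k q) +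
      ψ q * if k = Fin.last m then 1 else 0) ∂weightedMeasure x = 0 := by
  have hx' := hx.toIsIsometricImmersion
  have hexp : ContMDiff (𝓡 m) 𝓘(ℝ, ℝ) ∞ fun q => Real.exp (x q (Fin.last m)) :=
    Real.contDiff_exp.contMDiff.comp (hx'.contMDiff_coord _)
  -- Test with `ψ e^{x_{m+1}}`: differentiating the weight produces `ψ⟨∇x_{m+1}, ∇xₖ⟩`, which
  -- cancels the same term in `Hₖ = δₖ - ⟨∇x_{m+1}, ∇xₖ⟩`.
  have h := hx'.first_variation (hψ.mul hexp.chartLipschitz) hc.mul_right k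
  have hae : variationIntegrand x k (fun q => ψ q * Real.exp (x q (Fin.last m)))
      =ᵐ[riemannianVolume m M] fun q => (inner ℝ (riemGradient (m := m) ψ q) (coordGradient x k q) +
      ψ q * if k = Fin.last m then 1 else 0) * Real.exp (x q (Fin.last m)) := by
    filter_upwards [hψ.ae_mdifferentiableAt hx'] with q hq
    have h1 : riemGradient (m := m) (fun q => Real.exp (x q (Fin.last m))) q =
        Real.exp (x q (Fin.last m)) • coordGradient x (Fin.last m) q :=
      riemGradient_comp (Real.hasDerivAt_exp _)
        ((hx'.contMDiff_coord _).contMDiffAt.mdifferentiableAt (by simp))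
    rw [variationIntegrand, riemGradient_mul hq (hexp.contMDiffAt.mdifferentiableAt (by simp)), h1,
      hx.meanCurvatureVector_eq, hx'.normalProj_single_apply]
    simp only [inner_add_left, real_inner_smul_left]
    ring
  rw [hx'.integrable_weightedMeasure, hx'.integral_weightedMeasure]
  exact ⟨h.1.congr hae, (integral_congr_ae hae).symm.trans h.2⟩

/-- Expand `0 ≤ |∇φ + (φ/2)∇x_{m+1}|²` and use `|∇x_{m+1}|² = 1 - H²`. The cross term is `½⟨∇φ²,
∇x_{m+1}⟩`, with weighted integral `-½∫φ²`. -/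
theorem IsTranslator.weighted_poincare [T2Space M] (hx : IsTranslator x) {φ : M → ℝ}
    (hφ : ContMDiff (𝓡 m) 𝓘(ℝ, ℝ) ∞ φ) (hc : HasCompactSupport φ) :
    Integrable (fun q => φ q ^ 2) (weightedMeasure x) ∧
    Integrable (fun q => (1 + ‖meanCurvatureVector x q‖ ^ 2) * φ q ^ 2) (weightedMeasure x) ∧
    Integrable (fun q => ‖riemGradient (m := m) φ q‖ ^ 2) (weightedMeasure x) ∧
    1 / 4 * ∫ q, φ q ^ 2 ∂weightedMeasure x ≤
      1 / 4 * ∫ q, (1 + ‖meanCurvatureVector x q‖ ^ 2) * φ q ^ 2 ∂weightedMeasure x ∧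
    1 / 4 * ∫ q, (1 + ‖meanCurvatureVector x q‖ ^ 2) * φ q ^ 2 ∂weightedMeasure x ≤
      ∫ q, ‖riemGradient (m := m) φ q‖ ^ 2 ∂weightedMeasure x := by
  have hx' := hx.toIsIsometricImmersion
  have := hx'.isLocallyFiniteMeasure_weightedMeasure
  have hφ2 : ContMDiff (𝓡 m) 𝓘(ℝ, ℝ) ∞ fun q => φ q * φ q := hφ.mul hφ
  have hc2 : HasCompactSupport fun q => φ q * φ q := hc.mul_left
  have hc2' : HasCompactSupport fun q => φ q ^ 2 := by simpa only [sq] using hc2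
  have hH : Continuous fun q => ‖meanCurvatureVector x q‖ ^ 2 := by
    simp_rw [hx.norm_sq_meanCurvatureVector]
    exact continuous_const.sub (hx'.continuous_norm_sq_riemGradient (hx'.contMDiff_coord _))
  have hi1 : Integrable (fun q => φ q ^ 2) (weightedMeasure x) :=
    (hφ.continuous.pow 2).integrable_of_hasCompactSupport hc2'
  have hi2 : Integrable (fun q => (1 + ‖meanCurvatureVector x q‖ ^ 2) * φ q ^ 2)
      (weightedMeasure x) :=
    ((continuous_const.add hH).mul (hφ.continuous.pow 2)).integrable_of_hasCompactSupport
      hc2'.mul_left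
  have hi3 : Integrable (fun q => ‖riemGradient (m := m) φ q‖ ^ 2) (weightedMeasure x) :=
    (hx'.continuous_norm_sq_riemGradient hφ).integrable_of_hasCompactSupport
      (HasCompactSupport.intro hc.isCompact fun q hq => by
        rw [riemGradient_eq_zero_of_notMem_tsupport hq]; simp)
  refine ⟨hi1, hi2, hi3, ?_, ?_⟩
  · refine mul_le_mul_of_nonneg_left (integral_mono hi1 hi2 fun q => ?_) (by norm_num)
    have := mul_nonneg (sq_nonneg ‖meanCurvatureVector x q‖) (sq_nonneg (φ q))
    simp only []
    nlinarith
  · obtain ⟨hG, hG0⟩ := hx.integral_inner_coordGradient hφ2.chartLipschitz hc2 (Fin.last m)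
    -- The bracket multiplied by `1/2` is the integrand for the test function `φ²`; its integral is
    -- zero.
    have hle : ∀ q, 1 / 4 * ((1 + ‖meanCurvatureVector x q‖ ^ 2) * φ q ^ 2) ≤
        ‖riemGradient (m := m) φ q‖ ^ 2 + 1 / 2 *
        (inner ℝ (riemGradient (m := m) (fun q => φ q * φ q) q) (coordGradient x (Fin.last m) q) +
          φ q * φ q * if Fin.last m = Fin.last m then 1 else 0) := by
      intro q
      have hd : MDifferentiableAt (𝓡 m) 𝓘(ℝ, ℝ) φ q := hφ.contMDiffAt.mdifferentiableAt (by simp)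
      rw [riemGradient_mul hd hd, hx.norm_sq_meanCurvatureVector, inner_add_left,
        real_inner_smul_left, if_pos rfl]
      have h := sq_nonneg ‖riemGradient (m := m) φ q +
        (φ q / 2) • coordGradient x (Fin.last m) q‖
      rw [norm_add_sq_real, real_inner_smul_right, norm_smul, mul_pow, Real.norm_eq_abs,
        sq_abs] at h
      nlinarith
    rw [← integral_const_mul]
    refine (integral_mono (hi2.const_mul _) (hi3.add (hG.const_mul _)) hle).trans_eq ?_
    rw [integral_add' hi3 (hG.const_mul _), integral_const_mul, hG0, mul_zero, add_zero]

end Weighted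

/-! ### The Hopf–Rinow theorem. -/

section HopfRinow

variable {M : Type*} [EMetricSpace M]

/-- The Hopf–Rinow theorem for a complete, locally compact length space. -/
theorem isCompact_closedEBall_of_length [CompleteSpace M] [LocallyCompactSpace M]
    (hlen : ∀ (p q : M) (a b : NNReal), 0 < b → edist p q < a + b →
      ∃ z, edist p z ≤ a ∧ edist z q < b) (p : M) (r : NNReal) :
    IsCompact (Metric.closedEBall p (r : ENNReal)) := by
  -- Compactness passes to the limit radius: every point of the ball of radius `r` is within `δ` of
  -- a slightly smaller, compact ball. The `min` with `r` makes the truncated subtraction exact.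
  have hA : ∀ r : NNReal, 0 < r → (∀ s < r, IsCompact (Metric.closedEBall p (s : ENNReal))) →
      IsCompact (Metric.closedEBall p (r : ENNReal)) := by
    intro r hr hs
    refine isCompact_iff_totallyBounded_isComplete.2
      ⟨EMetric.totallyBounded_iff.2 fun ε hε => ?_, Metric.isClosed_closedEBall.isComplete⟩
    obtain ⟨δ, hδ0, hδε⟩ := ENNReal.lt_iff_exists_nnreal_btwn.1 (ENNReal.half_pos hε.ne')
    have hδ : 0 < δ := by exact_mod_cast hδ0
    obtain ⟨t, ht, hcov⟩ := EMetric.totallyBounded_iff.1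
      (isCompact_iff_totallyBounded_isComplete.1 (hs (r - min (δ / 2) r)
        (tsub_lt_self hr (lt_min (half_pos hδ) hr)))).1 (δ : ENNReal) hδ0
    refine ⟨t, ht, fun q hq => ?_⟩
    have h1 : edist p q < ((r - min (δ / 2) r : NNReal) : ENNReal) + δ := by
      rw [edist_comm]
      refine lt_of_le_of_lt (Metric.mem_closedEBall.1 hq) ?_
      have h2 : r < r - min (δ / 2) r + δ := by
        calc r = (r - min (δ / 2) r) + min (δ / 2) r := (tsub_add_cancel_of_le (min_le_right _ _)).symm
          _ < _ := by
            gcongr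
            exact (min_le_left _ _).trans_lt (half_lt_self hδ)
      exact_mod_cast h2
    obtain ⟨z, hz1, hz2⟩ := hlen p q _ δ hδ h1
    have hz : z ∈ Metric.closedEBall p ((r - min (δ / 2) r : NNReal) : ENNReal) := by
      rw [Metric.mem_closedEBall, edist_comm]; exact hz1
    obtain ⟨y, hy, hzy⟩ := mem_iUnion₂.1 (hcov hz)
    refine mem_iUnion₂.2 ⟨y, hy, ?_⟩
    rw [Metric.mem_eball] at hzy ⊢
    calc edist q y ≤ edist q z + edist z y := edist_triangle _ _ _
      _ < δ + δ := by rw [edist_comm q]; exact ENNReal.add_lt_add hz2 hzy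
      _ ≤ ε / 2 + ε / 2 := add_le_add hδε.le hδε.le
      _ = ε := ENNReal.add_halves ε
  -- By local compactness a compact ball has a compact neighbourhood, and the length property puts a
  -- larger ball inside it.
  have hB : ∀ r : NNReal, IsCompact (Metric.closedEBall p (r : ENNReal)) →
      ∃ δ : NNReal, 0 < δ ∧ IsCompact (Metric.closedEBall p ((r + δ : NNReal) : ENNReal)) := by
    intro r hr
    obtain ⟨L, hL, hrL⟩ := exists_compact_superset hr
    obtain ⟨δ, hδ, hδL⟩ := hr.exists_thickening_subset_open isOpen_interior hrL
    lift δ to NNReal using hδ.le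
    have hδ' : 0 < δ := by exact_mod_cast hδ
    refine ⟨δ / 2, half_pos hδ', hL.of_isClosed_subset Metric.isClosed_closedEBall fun q hq => ?_⟩
    refine interior_subset (hδL ((Metric.mem_thickening_iff_exists_edist_lt _ _).2 ?_))
    have h1 : edist p q < (r : ENNReal) + δ := by
      rw [edist_comm]
      refine lt_of_le_of_lt (Metric.mem_closedEBall.1 hq) ?_
      have h2 : r + δ / 2 < r + δ := by gcongr; exact half_lt_self hδ'
      exact_mod_cast h2
    obtain ⟨z, hz1, hz2⟩ := hlen p q r δ hδ' h1
    refine ⟨z, by rw [Metric.mem_closedEBall, edist_comm]; exact hz1, ?_⟩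
    rw [edist_comm, ENNReal.ofReal_coe_nnreal]
    exact hz2
  by_contra hcon
  -- The radii with compact balls form an initial segment. If it were bounded, its supremum would
  -- belong to it by `hA` and could be exceeded by `hB`.
  set S : Set NNReal := {s | IsCompact (Metric.closedEBall p (s : ENNReal))} with hS
  have hdown : ∀ s ∈ S, ∀ t ≤ s, t ∈ S := fun s hs t hts =>
    IsCompact.of_isClosed_subset hs Metric.isClosed_closedEBall
      (Metric.closedEBall_subset_closedEBall (by exact_mod_cast hts))
  have h0 : (0 : NNReal) ∈ S := by
    simp [hS, Metric.closedEBall_zero]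
  have hbdd : BddAbove S := ⟨r, fun s hs => by
    by_contra h
    exact hcon (hdown s hs r (not_le.1 h).le)⟩
  have hR : sSup S ∈ S := by
    rcases (zero_le (a := sSup S)).eq_or_lt with h | h
    · rw [← h]; exact h0
    · refine hA _ h fun s hs => ?_
      obtain ⟨t, ht, hst⟩ := exists_lt_of_lt_csSup ⟨0, h0⟩ hs
      exact hdown t ht s hst.le
  obtain ⟨δ, hδ, hc⟩ := hB _ hR
  exact absurd (le_csSup hbdd hc) (not_le.2 (lt_add_of_pos_right _ hδ))

end HopfRinow

/-! ### The Riemannian distance, Lipschitz functions and their gradients. -/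

section Distance

variable {m : ℕ} {M : Type*} [EMetricSpace M] [ChartedSpace (Euc m) M] [IsManifold (𝓡 m) ∞ M]
  [RiemannianBundle (fun p : M => TangentSpace (𝓡 m) p)] [IsRiemannianManifold (𝓡 m) M]
  {x : M → Euc (m + 1)}

/-- Follow a curve of length less than `a + b` until the distance from `p` equals `a`; the part
already covered has length at least `a`, so the rest is shorter than `b`. -/
theorem exists_edist_le_of_edist_lt (m : ℕ) {M : Type*} [EMetricSpace M] [ChartedSpace (Euc m) M]
    [IsManifold (𝓡 m) ∞ M] [RiemannianBundle (fun p : M => TangentSpace (𝓡 m) p)]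
    [IsRiemannianManifold (𝓡 m) M] (p q : M) (a b : NNReal) (hb : 0 < b)
    (h : edist p q < a + b) : ∃ z, edist p z ≤ a ∧ edist z q < b := by
  rcases le_or_gt (edist p q) a with hpq | hpq
  · exact ⟨q, hpq, by simpa using hb⟩
  rw [IsRiemannianManifold.out (I := 𝓡 m) p q] at h
  obtain ⟨γ, hγ0, hγ1, hγ, hlen⟩ := Manifold.exists_lt_of_riemannianEDist_lt h
  have hcont : ContinuousOn (fun t => edist p (γ t)) (Icc 0 1) :=
    continuous_edist.comp_continuousOn (continuousOn_const.prodMk hγ.continuousOn)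
  obtain ⟨t, ht, hta⟩ := intermediate_value_Icc zero_le_one hcont
    (show (a : ENNReal) ∈ Icc (edist p (γ 0)) (edist p (γ 1)) by
      rw [hγ0, hγ1, edist_self]; exact ⟨zero_le, hpq.le⟩)
  refine ⟨γ t, hta.le, ?_⟩
  have h1 : edist p (γ t) ≤ Manifold.pathELength (𝓡 m) γ 0 t := by
    rw [IsRiemannianManifold.out (I := 𝓡 m) p (γ t)]
    exact Manifold.riemannianEDist_le_pathELength (hγ.mono (Icc_subset_Icc_right ht.2)) hγ0 rfl ht.1
  have h2 : edist (γ t) q ≤ Manifold.pathELength (𝓡 m) γ t 1 := by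
    rw [IsRiemannianManifold.out (I := 𝓡 m) (γ t) q]
    exact Manifold.riemannianEDist_le_pathELength (hγ.mono (Icc_subset_Icc_left ht.1)) rfl hγ1 ht.2
  rw [← Manifold.pathELength_add ht.1 ht.2] at hlen
  by_contra hcon
  push Not at hcon
  have h3 : (a : ENNReal) + b ≤ Manifold.pathELength (𝓡 m) γ 0 t +
      Manifold.pathELength (𝓡 m) γ t 1 :=
    add_le_add (hta ▸ h1) (hcon.trans h2)
  exact absurd hlen (not_lt.2 h3)

theorem isCompact_closedEBall (m : ℕ) {M : Type*} [EMetricSpace M] [ChartedSpace (Euc m) M]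
    [IsManifold (𝓡 m) ∞ M] [RiemannianBundle (fun p : M => TangentSpace (𝓡 m) p)]
    [IsRiemannianManifold (𝓡 m) M] [CompleteSpace M] (p : M) (r : NNReal) :
    IsCompact (Metric.closedEBall p (r : ENNReal)) := by
  have : LocallyCompactSpace M := Manifold.locallyCompact_of_finiteDimensional (𝓡 m)
  exact isCompact_closedEBall_of_length (exists_edist_le_of_edist_lt m) p r

/-- The distance is at most the length of the curve that is a straight segment in the chart. -/
theorem IsIsometricImmersion.edist_symm_le (hx : IsIsometricImmersion x) {p : M} {y z : Euc m}
    (hs : segment ℝ y z ⊆ (extChartAt (𝓡 m) p).target) {B : ℝ}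
    (hB : ∀ w ∈ segment ℝ y z, ‖fderiv ℝ (x ∘ (extChartAt (𝓡 m) p).symm) w (z - y)‖ ≤ B) :
    edist ((extChartAt (𝓡 m) p).symm y) ((extChartAt (𝓡 m) p).symm z) ≤ ENNReal.ofReal B := by
  set η : ℝ → Euc m := ⇑(AffineMap.lineMap (k := ℝ) y z) with hη
  have hηd : ∀ t, HasDerivAt η (z - y) t := fun t => AffineMap.hasDerivAt_lineMap
  have hηs : ∀ t ∈ Icc (0 : ℝ) 1, η t ∈ segment ℝ y z := by
    intro t ht
    rw [segment_eq_image_lineMap]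
    exact mem_image_of_mem _ ht
  set γ := (extChartAt (𝓡 m) p).symm ∘ η with hγ
  have hηc : ContMDiff 𝓘(ℝ, ℝ) 𝓘(ℝ, Euc m) 1 η := by
    rw [contMDiff_iff_contDiff]
    have : η = fun t => t • (z - y) + y := by
      funext t; simp [hη, AffineMap.lineMap_apply]
    rw [this]
    exact (contDiff_id.smul contDiff_const).add contDiff_const
  have hγc : ContMDiffOn 𝓘(ℝ, ℝ) (𝓡 m) 1 γ (Icc 0 1) :=
    ((contMDiffOn_extChartAt_symm (n := ∞) p).of_le (by simp)).comp hηc.contMDiffOn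
      fun t ht => hs (hηs t ht)
  rw [IsRiemannianManifold.out (I := 𝓡 m)]
  refine (Manifold.riemannianEDist_le_pathELength hγc (by simp [hγ, hη]) (by simp [hγ, hη])
    zero_le_one).trans ?_
  rw [Manifold.pathELength_eq_lintegral_mfderiv_Icc]
  calc _ ≤ ∫⁻ _ in Icc (0 : ℝ) 1, ENNReal.ofReal B := by
        refine setLIntegral_mono' measurableSet_Icc fun t ht => ?_
        have hyt := hs (hηs t ht)
        have h1 : mfderiv 𝓘(ℝ, ℝ) (𝓡 m) γ t (1 : ℝ) =
            mfderiv 𝓘(ℝ, Euc m) (𝓡 m) (extChartAt (𝓡 m) p).symm (η t) (z - y) := by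
          have h2 := (mdifferentiableAt_symm hyt).hasMFDerivAt.comp t
            (hηd t).hasFDerivAt.hasMFDerivAt
          refine (congrArg (fun L => L (1 : ℝ)) h2.mfderiv).trans ?_
          refine congrArg (mfderiv 𝓘(ℝ, Euc m) (𝓡 m) (extChartAt (𝓡 m) p).symm (η t)) ?_
          exact one_smul ℝ (z - y)
        have h3 := hx.norm_mfderiv_symm hyt (z - y)
        refine (congrArg (fun v => ‖v‖ₑ) h1).trans_le ?_
        rw [← ofReal_norm]
        exact ENNReal.ofReal_le_ofReal (h3.trans_le (hB _ (hηs t ht)))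
    _ = ENNReal.ofReal B := by simp

theorem IsIsometricImmersion.edist_le (hx : IsIsometricImmersion x) (p q : M) :
    edist (x p) (x q) ≤ edist p q := by
  rw [IsRiemannianManifold.out (I := 𝓡 m) p q]
  refine le_of_forall_gt fun r hr => ?_
  obtain ⟨γ, hγ0, hγ1, hγ, hlen⟩ := Manifold.exists_lt_of_riemannianEDist_lt hr
  refine lt_of_le_of_lt ?_ hlen
  rw [IsRiemannianManifold.out (I := 𝓘(ℝ, Euc (m + 1))) (x p) (x q)]
  have hxγ : ContMDiffOn 𝓘(ℝ, ℝ) 𝓘(ℝ, Euc (m + 1)) 1 (x ∘ γ) (Icc 0 1) :=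
    (hx.contMDiff.of_le (by simp)).comp_contMDiffOn hγ
  refine (Manifold.riemannianEDist_le_pathELength hxγ (by simp [hγ0]) (by simp [hγ1])
    zero_le_one).trans ?_
  rw [Manifold.pathELength_eq_lintegral_mfderiv_Ioo, Manifold.pathELength_eq_lintegral_mfderiv_Ioo]
  refine setLIntegral_mono' measurableSet_Ioo fun t ht => ?_
  have hγt : MDifferentiableAt 𝓘(ℝ, ℝ) (𝓡 m) γ t :=
    (hγ.contMDiffAt (Icc_mem_nhds ht.1 ht.2)).mdifferentiableAt one_ne_zero
  have h1 := ((hx.mdifferentiableAt (γ t)).hasMFDerivAt.comp t hγt.hasMFDerivAt).mfderiv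
  have h2 : mfderiv 𝓘(ℝ, ℝ) 𝓘(ℝ, Euc (m + 1)) (x ∘ γ) t (1 : ℝ) =
      differentialAt x (γ t) (mfderiv 𝓘(ℝ, ℝ) (𝓡 m) γ t (1 : ℝ)) :=
    congrArg (fun L => L (1 : ℝ)) h1
  rw [enorm_tangentSpace_vectorSpace]
  refine (congrArg (fun v : Euc (m + 1) => ‖v‖ₑ) h2).trans_le ?_
  rw [← ofReal_norm, hx.norm_differentialAt, ofReal_norm]
  exact le_rfl

theorem IsIsometricImmersion.exists_ball_norm_fderiv_le (hx : IsIsometricImmersion x) {p : M}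
    {y : Euc m} (hy : y ∈ (extChartAt (𝓡 m) p).target) {ε : ℝ} (hε : 0 < ε) :
    ∃ r > 0, Metric.ball y r ⊆ (extChartAt (𝓡 m) p).target ∧ ∀ z ∈ Metric.ball y r,
      ‖fderiv ℝ (x ∘ (extChartAt (𝓡 m) p).symm) z - fderiv ℝ (x ∘ (extChartAt (𝓡 m) p).symm) y‖
        ≤ ε := by
  have hc : ContinuousAt (fderiv ℝ (x ∘ (extChartAt (𝓡 m) p).symm)) y :=
    ((contDiffAt_comp_symm hx.contMDiff hy).fderiv_right (m := ∞) le_rfl).continuousAt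
  obtain ⟨r, hr, h⟩ := Metric.mem_nhds_iff.1 (Filter.inter_mem
    ((isOpen_extChartAt_target p).mem_nhds hy) (hc (Metric.closedBall_mem_nhds _ hε)))
  refine ⟨r, hr, fun z hz => (h hz).1, fun z hz => ?_⟩
  have := (h hz).2
  rwa [mem_preimage, mem_closedBall_iff_norm] at this

/-- Near a point the metric is bounded in coordinates, so the chart inverse is Lipschitz there. This
admits functions of the distance as test functions. -/
theorem IsIsometricImmersion.chartLipschitz_of_lipschitzWith (hx : IsIsometricImmersion x)
    {u : M → ℝ} {L : NNReal} (hu : LipschitzWith L u) : ChartLipschitz m u := by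
  intro p y hy
  set X := x ∘ (extChartAt (𝓡 m) p).symm with hX
  obtain ⟨r, hr, hrt, hrn⟩ := hx.exists_ball_norm_fderiv_le hy one_pos
  set C : NNReal := ‖fderiv ℝ X y‖₊ + 1 with hC
  refine ⟨L * C, Metric.ball y r, nhdsWithin_le_nhds (Metric.ball_mem_nhds y hr), ?_⟩
  intro a ha b hb
  have hseg : segment ℝ a b ⊆ Metric.ball y r := (convex_ball y r).segment_subset ha hb
  have h1 : edist ((extChartAt (𝓡 m) p).symm a) ((extChartAt (𝓡 m) p).symm b) ≤
      ENNReal.ofReal (C * ‖b - a‖) := by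
    refine hx.edist_symm_le (hseg.trans hrt) fun w hw => ?_
    refine (ContinuousLinearMap.le_opNorm _ _).trans ?_
    gcongr
    have h2 := hrn w (hseg hw)
    have h3 : ‖fderiv ℝ X w‖ ≤ ‖fderiv ℝ X y‖ + ‖fderiv ℝ X w - fderiv ℝ X y‖ :=
      norm_le_norm_add_norm_sub' _ _
    simp only [hC, NNReal.coe_add, coe_nnnorm, NNReal.coe_one]
    linarith
  refine (hu _ _).trans ?_
  rw [ENNReal.coe_mul, mul_assoc]
  gcongr
  refine h1.trans_eq ?_
  rw [ENNReal.ofReal_mul (NNReal.coe_nonneg C), ENNReal.ofReal_coe_nnreal, edist_comm a b, edist_eq_enorm_sub,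
    ofReal_norm]

/-- Along a short coordinate segment in direction `w` the distance grows at the rate `‖DX w‖` up to
`ε`, because the metric is almost constant there; so `|du(w)| ≤ L‖DX w‖`. Taking for `w` the
coordinates of `v = ∇u` gives `‖v‖² ≤ L‖v‖`. -/
theorem IsIsometricImmersion.norm_riemGradient_symm_le (hx : IsIsometricImmersion x)
    {u : M → ℝ} {L : NNReal} (hu : LipschitzWith L u) {p : M} {y : Euc m}
    (hy : y ∈ (extChartAt (𝓡 m) p).target)
    (hd : MDifferentiableAt (𝓡 m) 𝓘(ℝ, ℝ) u ((extChartAt (𝓡 m) p).symm y)) :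
    ‖riemGradient (m := m) u ((extChartAt (𝓡 m) p).symm y)‖ ≤ L := by
  set X := x ∘ (extChartAt (𝓡 m) p).symm with hX
  have key : ∀ w : Euc m, |fderiv ℝ (u ∘ (extChartAt (𝓡 m) p).symm) y w| ≤ L * ‖fderiv ℝ X y w‖ := by
    intro w
    refine le_of_forall_pos_le_add fun ε hε => ?_
    -- Small enough that the error `L · tolerance · ‖w‖` is at most `ε`; the added ones avoid
    -- division by zero.
    have hε' : 0 < ε / ((L + 1) * (‖w‖ + 1)) := by positivity
    obtain ⟨r, hr, hrt, hrn⟩ := hx.exists_ball_norm_fderiv_le hy hε'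
    have hdu : DifferentiableAt ℝ (u ∘ (extChartAt (𝓡 m) p).symm) y :=
      (hd.comp y (mdifferentiableAt_symm hy)).differentiableAt
    have hline : HasDerivAt (fun t : ℝ => y + t • w) w 0 := by
      simpa using ((hasDerivAt_id (0 : ℝ)).smul_const w).const_add y
    have hder : HasDerivAt (fun t : ℝ => u ((extChartAt (𝓡 m) p).symm (y + t • w)))
        (fderiv ℝ (u ∘ (extChartAt (𝓡 m) p).symm) y w) 0 := by
      have h1 : HasFDerivAt (u ∘ (extChartAt (𝓡 m) p).symm)
        (fderiv ℝ (u ∘ (extChartAt (𝓡 m) p).symm) y) (y + (0 : ℝ) • w) := by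
        simpa using hdu.hasFDerivAt
      exact h1.comp_hasDerivAt 0 hline
    refine hder.le_of_lip' (by positivity) ?_
    have hev : ∀ᶠ t in nhds (0 : ℝ), y + t • w ∈ Metric.ball y r := by
      have : ContinuousAt (fun t : ℝ => y + t • w) 0 := hline.continuousAt
      exact this (by simpa using Metric.ball_mem_nhds y hr)
    filter_upwards [hev] with t ht
    have hseg : segment ℝ y (y + t • w) ⊆ Metric.ball y r :=
      (convex_ball y r).segment_subset (Metric.mem_ball_self hr) ht
    have h1 : edist ((extChartAt (𝓡 m) p).symm y) ((extChartAt (𝓡 m) p).symm (y + t • w)) ≤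
        ENNReal.ofReal ((‖fderiv ℝ X y w‖ + ε / ((L + 1) * (‖w‖ + 1)) * ‖w‖) * |t|) := by
      refine hx.edist_symm_le (hseg.trans hrt) fun z hz => ?_
      rw [add_sub_cancel_left, map_smul, norm_smul, Real.norm_eq_abs, mul_comm]
      gcongr
      calc ‖fderiv ℝ X z w‖ ≤ ‖fderiv ℝ X y w‖ + ‖fderiv ℝ X z w - fderiv ℝ X y w‖ :=
            norm_le_norm_add_norm_sub' _ _
        _ ≤ _ := by
          gcongr
          exact (ContinuousLinearMap.le_opNorm (fderiv ℝ X z - fderiv ℝ X y) w).trans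
            (by gcongr; exact hrn z (hseg hz))
    have h2 : edist (u ((extChartAt (𝓡 m) p).symm y))
        (u ((extChartAt (𝓡 m) p).symm (y + t • w))) ≤ ENNReal.ofReal
        (L * ((‖fderiv ℝ X y w‖ + ε / ((L + 1) * (‖w‖ + 1)) * ‖w‖) * |t|)) := by
      rw [ENNReal.ofReal_mul (NNReal.coe_nonneg L), ENNReal.ofReal_coe_nnreal]
      exact (hu _ _).trans (by gcongr)
    rw [edist_dist, ENNReal.ofReal_le_ofReal_iff (by positivity), dist_comm, Real.dist_eq] at h2
    simp only [zero_smul, add_zero, sub_zero, Real.norm_eq_abs]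
    refine h2.trans ?_
    rw [← mul_assoc]
    gcongr
    rw [mul_add]
    gcongr
    have h3 : (L : ℝ) * ‖w‖ ≤ (L + 1) * (‖w‖ + 1) := by
      have := norm_nonneg w; have := L.2; nlinarith
    calc (L : ℝ) * (ε / ((L + 1) * (‖w‖ + 1)) * ‖w‖) =
          ε * ((L * ‖w‖) / ((L + 1) * (‖w‖ + 1))) := by ring
      _ ≤ ε * 1 := by
        gcongr
        exact div_le_one_of_le₀ h3 (by positivity)
      _ = ε := mul_one ε
  set v := riemGradient (m := m) u ((extChartAt (𝓡 m) p).symm y) with hv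
  obtain ⟨e, he⟩ := isInvertible_mfderiv_symm hy
  have hev : mfderiv 𝓘(ℝ, Euc m) (𝓡 m) (extChartAt (𝓡 m) p).symm y (e.symm v) = v := by
    rw [← he]; exact e.apply_symm_apply v
  have h1 := key (e.symm v)
  have h2 : fderiv ℝ (u ∘ (extChartAt (𝓡 m) p).symm) y (e.symm v) = ‖v‖ * ‖v‖ := by
    refine (fderiv_comp_symm hy hd (e.symm v)).trans ?_
    refine (congrArg (mfderiv (𝓡 m) 𝓘(ℝ, ℝ) u ((extChartAt (𝓡 m) p).symm y)) hev).trans ?_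
    refine (inner_riemGradient u _ v).symm.trans ?_
    rw [← hv, real_inner_self_eq_norm_mul_norm]
  have h3 : ‖fderiv ℝ X y (e.symm v)‖ = ‖v‖ :=
    (hx.norm_mfderiv_symm hy (e.symm v)).symm.trans (congrArg (fun w => ‖w‖) hev)
  erw [h2, h3] at h1
  rw [abs_of_nonneg (by positivity)] at h1
  rcases (norm_nonneg v).eq_or_lt with h0 | h0
  · rw [← h0]; exact L.2
  · exact le_of_mul_le_mul_right h1 h0

theorem IsIsometricImmersion.norm_riemGradient_le (hx : IsIsometricImmersion x)
    {u : M → ℝ} {L : NNReal} (hu : LipschitzWith L u) {q : M}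
    (hd : MDifferentiableAt (𝓡 m) 𝓘(ℝ, ℝ) u q) : ‖riemGradient (m := m) u q‖ ≤ L := by
  have h := hx.norm_riemGradient_symm_le hu (mem_extChartAt_target (I := 𝓡 m) q)
  rw [extChartAt_to_inv] at h
  exact h hd

end Distance

/-! ### A lower bound for the weighted volume of small balls. -/

section Density

/-- An injective linear map into a larger Euclidean space has the same norms as a linear
endomorphism whose determinant is the square root of the Gram determinant. -/
theorem exists_endomorphism_norm_eq {m n : ℕ} {A : Euc m →L[ℝ] Euc n}
    (hA : Function.Injective A) : ∃ S : Euc m →L[ℝ] Euc m, (∀ v, ‖S v‖ = ‖A v‖) ∧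
      S.det ^ 2 = (Matrix.of fun i j => inner ℝ (A (EuclideanSpace.single i 1))
        (A (EuclideanSpace.single j 1)) : Matrix (Fin m) (Fin m) ℝ).det := by
  have hr : Module.finrank ℝ A.range = m := by
    have h := LinearMap.finrank_range_of_inj (f := (A : Euc m →ₗ[ℝ] Euc n)) hA
    rw [finrank_euclideanSpace_fin] at h
    exact h
  let U := ((stdOrthonormalBasis ℝ A.range).reindex (finCongr hr)).repr
  let S : Euc m →L[ℝ] Euc m :=
    (U.toLinearEquiv.toLinearMap ∘ₗ A.toLinearMap.rangeRestrict).toContinuousLinearMap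
  have hS : ∀ v w, inner ℝ (S v) (S w) = inner ℝ (A v) (A w) := fun v w =>
    (U.inner_map_map _ _).trans rfl
  refine ⟨S, fun v => ?_, ?_⟩
  · rw [norm_eq_sqrt_real_inner, hS, ← norm_eq_sqrt_real_inner]
  · have h := det_paramGram_comp (X := (id : Euc m → Euc m)) (Φ := S) (y := 0) differentiableAt_id
      S.differentiableAt
    have h1 : paramGram (id : Euc m → Euc m) (S 0) = 1 := by
      ext i j
      rw [paramGram_apply, partialDeriv, partialDeriv, fderiv_id]
      simp [EuclideanSpace.inner_single_left, Matrix.one_apply]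
    have h2 : paramGram (id ∘ S) 0 = Matrix.of fun i j =>
        inner ℝ (A (EuclideanSpace.single i 1)) (A (EuclideanSpace.single j 1)) := by
      ext i j
      rw [paramGram_apply, Function.id_comp, partialDeriv, partialDeriv, S.fderiv, hS]
      rfl
    rw [h1, h2, S.fderiv, Matrix.det_one, mul_one] at h
    exact h.symm

variable {m : ℕ} {M : Type*} [EMetricSpace M] [SecondCountableTopology M] [MeasurableSpace M]
  [BorelSpace M] [ChartedSpace (Euc m) M] [IsManifold (𝓡 m) ∞ M]
  [RiemannianBundle (fun p : M => TangentSpace (𝓡 m) p)] [IsRiemannianManifold (𝓡 m) M]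
  {x : M → Euc (m + 1)}

variable (m) in
/-- A constant `c` such that small balls of radius `s` have volume at least `c sᵐ`. -/
def densityConst : ℝ := 1 / 4 * (1 / 2) ^ m * (volume (Metric.ball (0 : Euc m) 1)).toReal

theorem densityConst_pos : 0 < densityConst m := by
  have : 0 < (volume (Metric.ball (0 : Euc m) 1)).toReal :=
    ENNReal.toReal_pos (Metric.measure_ball_pos _ _ one_pos).ne' measure_ball_lt_top.ne
  unfold densityConst
  positivity

/-- Freeze the metric at `q` as `‖S v‖`, with `|det S| = √g(q)`. Near `q` the metric norm is at most
`2‖S v‖`, so the ellipsoid `‖S(z - y₀)‖ < s/2` lies in the ball of radius `s`; its Lebesgue measure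
is `(s/2)ᵐ|B₁|/√g(q)`. A further factor `1/2` is lost for the density `√g` and one for the weight,
which explains `densityConst`. -/
theorem IsIsometricImmersion.eventually_le_weightedMeasure_eball (hx : IsIsometricImmersion x)
    (q : M) : ∀ᶠ s in nhdsWithin (0 : ℝ) (Ioi 0),
      ENNReal.ofReal (densityConst m * Real.exp (x q (Fin.last m)) * s ^ m) ≤
        weightedMeasure x (Metric.eball q (ENNReal.ofReal s)) := by
  set y₀ := extChartAt (𝓡 m) q q with hy₀
  have hyt : y₀ ∈ (extChartAt (𝓡 m) q).target := mem_extChartAt_target q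
  have hsymm : (extChartAt (𝓡 m) q).symm y₀ = q := extChartAt_to_inv q
  set X := x ∘ (extChartAt (𝓡 m) q).symm with hX
  have hinj : Function.Injective (fderiv ℝ X y₀) := by
    obtain ⟨e, he⟩ := isInvertible_mfderiv_symm hyt
    refine (injective_iff_map_eq_zero _).2 fun v hv => e.injective ?_
    refine Eq.trans ?_ (map_zero e).symm
    have h := hx.norm_mfderiv_symm hyt v
    rw [← hX, hv, norm_zero] at h
    rw [← norm_eq_zero, ← h]
    exact congrArg (fun L => ‖L v‖) he
  obtain ⟨S, hSn, hSd⟩ := exists_endomorphism_norm_eq hinj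
  have hdet : |S.det| = volumeDensity q y₀ := by
    rw [hx.volumeDensity_eq hyt, ← Real.sqrt_sq_eq_abs, hSd]
    rfl
  have hvd : 0 < volumeDensity q y₀ := volumeDensity_pos hyt
  have hker : (S : Euc m →ₗ[ℝ] Euc m).ker = ⊥ := by
    refine LinearMap.ker_eq_bot'.2 fun v hv => hinj ?_
    rw [map_zero, ← norm_eq_zero, ← hSn]
    exact norm_eq_zero.2 hv
  obtain ⟨κ, hκ, hSκ⟩ := LinearMap.exists_antilipschitzWith (S : Euc m →ₗ[ℝ] Euc m) hker
  have hSκ' : ∀ v, ‖v‖ ≤ κ * ‖S v‖ := fun v => by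
    simpa using hSκ.le_mul_dist v 0
  have hκ' : (0 : ℝ) < κ := hκ
  -- The tolerance `κ⁻¹` makes the change of `DX` along `v` at most `κ⁻¹‖v‖ ≤ ‖S v‖`.
  obtain ⟨r, hr, hrt, hrn⟩ := hx.exists_ball_norm_fderiv_le hyt (inv_pos.2 hκ')
  have hev : ∀ᶠ z in nhds y₀, 1 / 2 * volumeDensity q y₀ < volumeDensity q z ∧
      1 / 2 * Real.exp (x q (Fin.last m)) <
        Real.exp (x ((extChartAt (𝓡 m) q).symm z) (Fin.last m)) := by
    refine ((hx.contDiffAt_volumeDensity hyt).continuousAt.eventually (lt_mem_nhds ?_)).and ?_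
    · linarith
    · have hc : ContinuousAt (fun z => Real.exp (x ((extChartAt (𝓡 m) q).symm z) (Fin.last m)))
          y₀ :=
        (Real.continuous_exp.comp (hx.continuous_coord _)).continuousAt.comp
          (continuousAt_extChartAt_symm'' hyt)
      refine hc.eventually (lt_mem_nhds ?_)
      simp only [hsymm]
      linarith [Real.exp_pos (x q (Fin.last m))]
  obtain ⟨r', hr', hball⟩ := Metric.eventually_nhds_iff_ball.1 hev
  have hs0 : 0 < min r r' / κ := div_pos (lt_min hr hr') hκ'
  filter_upwards [Ioo_mem_nhdsGT hs0] with s hs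
  set D := (S : Euc m → Euc m) ⁻¹' Metric.ball (S y₀) (s / 2) with hD
  have hDn : ∀ z ∈ D, ‖S (z - y₀)‖ < s / 2 := fun z hz => by
    rw [map_sub]; exact mem_ball_iff_norm.1 hz
  have hDr : D ⊆ Metric.ball y₀ (min r r') := fun z hz => by
    rw [mem_ball_iff_norm]
    calc ‖z - y₀‖ ≤ κ * ‖S (z - y₀)‖ := hSκ' _
      _ < κ * (min r r' / κ) := by
        have := hDn z hz
        have := hs.1
        have := hs.2
        gcongr
        linarith
      _ = min r r' := mul_div_cancel₀ _ hκ'.ne'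
  have hDe : ∀ z ∈ D, (extChartAt (𝓡 m) q).symm z ∈ Metric.eball q (ENNReal.ofReal s) := by
    intro z hz
    have hseg : segment ℝ y₀ z ⊆ Metric.ball y₀ r :=
      (convex_ball y₀ r).segment_subset (Metric.mem_ball_self hr)
        (Metric.ball_subset_ball (min_le_left _ _) (hDr hz))
    have h1 := hx.edist_symm_le (B := 2 * ‖S (z - y₀)‖) (hseg.trans hrt) fun w hw => by
      have h2 : ‖fderiv ℝ X w (z - y₀) - fderiv ℝ X y₀ (z - y₀)‖ ≤ ‖S (z - y₀)‖ :=
        calc _ ≤ (κ : ℝ)⁻¹ * ‖z - y₀‖ :=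
              (ContinuousLinearMap.le_opNorm (fderiv ℝ X w - fderiv ℝ X y₀) _).trans
                (by gcongr; exact hrn w (hseg hw))
          _ ≤ (κ : ℝ)⁻¹ * (κ * ‖S (z - y₀)‖) := by gcongr; exact hSκ' _
          _ = _ := inv_mul_cancel_left₀ hκ'.ne' _
      calc _ ≤ ‖fderiv ℝ X y₀ (z - y₀)‖ + ‖fderiv ℝ X w (z - y₀) - fderiv ℝ X y₀ (z - y₀)‖ :=
            norm_le_norm_add_norm_sub' _ _
        _ ≤ _ := by rw [← hSn]; linarith
    rw [hsymm] at h1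
    rw [Metric.mem_eball, edist_comm]
    refine h1.trans_lt ((ENNReal.ofReal_lt_ofReal_iff hs.1).2 ?_)
    linarith [hDn z hz]
  set W := (Metric.eball q (ENNReal.ofReal s) ∩ (extChartAt (𝓡 m) q).source) ∩
    {z | 1 / 2 * Real.exp (x q (Fin.last m)) < Real.exp (x z (Fin.last m))} with hW
  have hcexp : Continuous fun z => Real.exp (x z (Fin.last m)) :=
    Real.continuous_exp.comp (hx.continuous_coord _)
  have hWm : MeasurableSet W := (Metric.isOpen_eball.measurableSet.inter
    (measurableSet_source q)).inter (isOpen_lt continuous_const hcexp).measurableSet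
  have hDW : D ⊆ (extChartAt (𝓡 m) q).target ∩ (extChartAt (𝓡 m) q).symm ⁻¹' W := fun z hz => by
    have hzt := hrt (Metric.ball_subset_ball (min_le_left _ _) (hDr hz))
    exact ⟨hzt, ⟨hDe z hz, (extChartAt (𝓡 m) q).map_target hzt⟩,
      (hball z (Metric.ball_subset_ball (min_le_right _ _) (hDr hz))).2⟩
  have hDm : MeasurableSet D := S.continuous.measurable Metric.isOpen_ball.measurableSet
  have hvolD : volume D = ENNReal.ofReal (volumeDensity q y₀)⁻¹ *
      (ENNReal.ofReal ((s / 2) ^ m) * volume (Metric.ball (0 : Euc m) 1)) := by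
    have hd : (S : Euc m →ₗ[ℝ] Euc m).det ≠ 0 := by
      have h : S.det ≠ 0 := abs_pos.1 (hdet ▸ hvd)
      exact h
    have h1 := Measure.addHaar_preimage_linearMap (volume : Measure (Euc m)) hd
      (Metric.ball (S y₀) (s / 2))
    rw [Measure.addHaar_ball_of_pos _ _ (half_pos hs.1), finrank_euclideanSpace_fin, abs_inv] at h1
    rw [← hdet]
    exact h1
  have hvolW : ENNReal.ofReal (1 / 2 * volumeDensity q y₀) * volume D ≤ riemannianVolume m M W := by
    rw [hx.riemannianVolume_apply hWm (inter_subset_left.trans inter_subset_right),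
      chartVolume_apply q hWm]
    calc _ = ∫⁻ _ in D, ENNReal.ofReal (1 / 2 * volumeDensity q y₀) := by
          rw [setLIntegral_const]
      _ ≤ ∫⁻ y in D, ENNReal.ofReal (volumeDensity q y) :=
          setLIntegral_mono' hDm fun z hz => ENNReal.ofReal_le_ofReal
            (hball z (Metric.ball_subset_ball (min_le_right _ _) (hDr hz))).1.le
      _ ≤ _ := lintegral_mono_set hDW
  have hμW : ENNReal.ofReal (1 / 2 * Real.exp (x q (Fin.last m))) * riemannianVolume m M W ≤
      weightedMeasure x W := by
    rw [weightedMeasure, withDensity_apply _ hWm]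
    calc _ = ∫⁻ _ in W, ENNReal.ofReal (1 / 2 * Real.exp (x q (Fin.last m)))
            ∂riemannianVolume m M := by rw [setLIntegral_const]
      _ ≤ _ := setLIntegral_mono' hWm fun z hz => ENNReal.ofReal_le_ofReal hz.2.le
  refine le_trans ?_ ((mul_le_mul_right hvolW _).trans (hμW.trans
    (measure_mono (inter_subset_left.trans inter_subset_left))))
  rw [hvolD, ← ENNReal.ofReal_toReal (measure_ball_lt_top (μ := (volume : Measure (Euc m)))
    (x := 0) (r := 1)).ne]
  have hs1 := hs.1
  rw [← ENNReal.ofReal_mul (by positivity), ← ENNReal.ofReal_mul (by positivity),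
    ← ENNReal.ofReal_mul (by positivity), ← ENNReal.ofReal_mul (by positivity)]
  refine ENNReal.ofReal_le_ofReal (le_of_eq ?_)
  rw [densityConst, div_pow, div_pow, one_pow]
  field_simp
  ring

end Density

/-! ### Test functions cut off to an open set. -/

section Localization

variable {m : ℕ} {M : Type*} [TopologicalSpace M] [ChartedSpace (Euc m) M] [IsManifold (𝓡 m) ∞ M]
  [MeasurableSpace M] [BorelSpace M] [SecondCountableTopology M]
  [RiemannianBundle (fun p : M => TangentSpace (𝓡 m) p)] {x : M → Euc (m + 1)}

theorem riemGradient_congr {u v : M → ℝ} {q : M} (h : u =ᶠ[nhds q] v) :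
    riemGradient (m := m) u q = riemGradient (m := m) v q := by
  refine ext_inner_right ℝ fun w => ?_
  rw [inner_riemGradient, inner_riemGradient, h.mfderiv_eq]
  rfl

theorem chartLipschitz_of_eventuallyEq {u : M → ℝ}
    (h : ∀ q, ∃ v, ChartLipschitz m v ∧ u =ᶠ[nhds q] v) : ChartLipschitz m u := by
  intro p y hy
  obtain ⟨v, hv, huv⟩ := h ((extChartAt (𝓡 m) p).symm y)
  obtain ⟨C, t, ht, hC⟩ := hv p hy
  have h1 : ∀ᶠ z in nhds y, u ((extChartAt (𝓡 m) p).symm z) = v ((extChartAt (𝓡 m) p).symm z) :=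
    (continuousAt_extChartAt_symm'' hy).eventually huv
  refine ⟨C, t ∩ {z | u ((extChartAt (𝓡 m) p).symm z) = v ((extChartAt (𝓡 m) p).symm z)},
    Filter.inter_mem ht (nhdsWithin_le_nhds h1), fun a ha b hb => ?_⟩
  simp only [Function.comp_apply]
  rw [show u _ = v _ from ha.2, show u _ = v _ from hb.2]
  exact hC ha.1 hb.1

/-- Vanishing near the frontier makes the extension by zero coincide locally with `u` or with `0`,
so that it inherits all local properties of `u`. -/
theorem indicator_eventuallyEq_of_frontier {E : Set M} (hE : IsOpen E) {u : M → ℝ}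
    (h0 : ∀ q ∈ frontier E, u =ᶠ[nhds q] 0) (q : M) :
    (q ∈ E ∧ E.indicator u =ᶠ[nhds q] u) ∨ (q ∉ E ∧ E.indicator u =ᶠ[nhds q] 0) := by
  by_cases hq : q ∈ E
  · refine Or.inl ⟨hq, ?_⟩
    filter_upwards [hE.mem_nhds hq] with z hz using indicator_of_mem hz u
  · refine Or.inr ⟨hq, ?_⟩
    by_cases hqc : q ∈ closure E
    · filter_upwards [h0 q (by rw [hE.frontier_eq]; exact ⟨hqc, hq⟩)] with z hz
      by_cases hzE : z ∈ E
      · rw [indicator_of_mem hzE, hz]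
      · exact indicator_of_notMem hzE u
    · filter_upwards [isClosed_closure.isOpen_compl.mem_nhds hqc] with z hz
      exact indicator_of_notMem (fun h => hz (subset_closure h)) u

/-- The first variation formula for the vector field that is the tangential part of
`(c₁, …, c_{m+1})`. -/
theorem IsTranslator.integral_inner_sum_smul_coordGradient [T2Space M] (hx : IsTranslator x)
    {ψ : M → ℝ} (hψ : ChartLipschitz m ψ) (hc : HasCompactSupport ψ) {c : Fin (m + 1) → M → ℝ}
    (hcd : ∀ k, ContMDiff (𝓡 m) 𝓘(ℝ, ℝ) ∞ (c k)) :
    Integrable (fun q => inner ℝ (riemGradient (m := m) ψ q) (∑ k, c k q • coordGradient x k q) +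
      ψ q * (∑ k, inner ℝ (riemGradient (m := m) (c k) q) (coordGradient x k q) +
        c (Fin.last m) q)) (weightedMeasure x) ∧
    ∫ q, (inner ℝ (riemGradient (m := m) ψ q) (∑ k, c k q • coordGradient x k q) +
      ψ q * (∑ k, inner ℝ (riemGradient (m := m) (c k) q) (coordGradient x k q) +
        c (Fin.last m) q)) ∂weightedMeasure x = 0 := by
  -- The scalar identity for the test functions `ψ cₖ`, to be summed over `k`; only the last
  -- coordinate has a nonzero weighted Laplacian.
  have h := fun k => hx.integral_inner_coordGradient (hψ.mul (hcd k).chartLipschitz) hc.mul_right k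
  have hae : (fun q => ∑ k, (inner ℝ (riemGradient (m := m) (fun z => ψ z * c k z) q)
      (coordGradient x k q) + ψ q * c k q * if k = Fin.last m then 1 else 0))
      =ᵐ[weightedMeasure x] fun q => inner ℝ (riemGradient (m := m) ψ q)
      (∑ k, c k q • coordGradient x k q) +
      ψ q * (∑ k, inner ℝ (riemGradient (m := m) (c k) q) (coordGradient x k q) +
        c (Fin.last m) q) := by
    filter_upwards [hψ.ae_mdifferentiableAt_weighted hx.toIsIsometricImmersion] with q hq
    have h1 : ∀ k, inner ℝ (riemGradient (m := m) (fun z => ψ z * c k z) q) (coordGradient x k q) =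
        ψ q * inner ℝ (riemGradient (m := m) (c k) q) (coordGradient x k q) +
        inner ℝ (riemGradient (m := m) ψ q) (c k q • coordGradient x k q) := fun k => by
      rw [riemGradient_mul hq ((hcd k).contMDiffAt.mdifferentiableAt (by simp)), inner_add_left,
        real_inner_smul_left, real_inner_smul_left, real_inner_smul_right]
    simp only [h1, Finset.sum_add_distrib, ← Finset.mul_sum, inner_sum, mul_ite, mul_one, mul_zero,
      Finset.sum_ite_eq', Finset.mem_univ, if_true]
    ring
  refine ⟨(integrable_finsetSum _ fun k _ => (h k).1).congr hae, ?_⟩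
  rw [← integral_congr_ae hae, integral_finsetSum _ fun k _ => (h k).1]
  exact Finset.sum_eq_zero fun k _ => (h k).2

theorem IsTranslator.setIntegral_inner_sum_smul_coordGradient [T2Space M] (hx : IsTranslator x)
    {E L : Set M} (hE : IsOpen E) (hL : IsCompact L) {u : M → ℝ} (hu : ChartLipschitz m u)
    (h0 : ∀ q ∈ frontier E, u =ᶠ[nhds q] 0) (huL : ∀ q ∈ E, q ∉ L → u q = 0)
    {c : Fin (m + 1) → M → ℝ} (hcd : ∀ k, ContMDiff (𝓡 m) 𝓘(ℝ, ℝ) ∞ (c k)) :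
    IntegrableOn (fun q => inner ℝ (riemGradient (m := m) u q) (∑ k, c k q • coordGradient x k q) +
      u q * (∑ k, inner ℝ (riemGradient (m := m) (c k) q) (coordGradient x k q) +
        c (Fin.last m) q)) E (weightedMeasure x) ∧
    ∫ q in E, (inner ℝ (riemGradient (m := m) u q) (∑ k, c k q • coordGradient x k q) +
      u q * (∑ k, inner ℝ (riemGradient (m := m) (c k) q) (coordGradient x k q) +
        c (Fin.last m) q)) ∂weightedMeasure x = 0 := by
  have hind := indicator_eventuallyEq_of_frontier hE h0
  have hψ : ChartLipschitz m (E.indicator u) := chartLipschitz_of_eventuallyEq fun q => by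
    rcases hind q with h | h
    · exact ⟨u, hu, h.2⟩
    · exact ⟨fun _ => 0, contMDiff_const.chartLipschitz, h.2⟩
  have hc : HasCompactSupport (E.indicator u) := HasCompactSupport.intro hL fun q hq => by
    by_cases hqE : q ∈ E
    · rw [indicator_of_mem hqE, huL q hqE hq]
    · exact indicator_of_notMem hqE u
  have h := hx.integral_inner_sum_smul_coordGradient hψ hc hcd
  have heq : (fun q => inner ℝ (riemGradient (m := m) (E.indicator u) q)
      (∑ k, c k q • coordGradient x k q) + E.indicator u q *
      (∑ k, inner ℝ (riemGradient (m := m) (c k) q) (coordGradient x k q) + c (Fin.last m) q)) =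
      E.indicator fun q => inner ℝ (riemGradient (m := m) u q)
      (∑ k, c k q • coordGradient x k q) + u q *
      (∑ k, inner ℝ (riemGradient (m := m) (c k) q) (coordGradient x k q) +
        c (Fin.last m) q) := by
    funext q
    rcases hind q with ⟨hq, hqe⟩ | ⟨hq, hqe⟩
    · rw [indicator_of_mem hq, indicator_of_mem hq, riemGradient_congr hqe]
    · rw [indicator_of_notMem hq, indicator_of_notMem hq, riemGradient_eq_zero hqe, inner_zero_left,
        zero_mul, add_zero]
  rw [heq, integrable_indicator_iff hE.measurableSet, integral_indicator hE.measurableSet] at h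
  exact h

end Localization

/-! ### The squared positive part. -/

section PositivePart

/-- A Taylor bound with uniform quadratic error: the second derivative of `t₊²` lies in `[0, 2]`.
Uniformity allows differentiation under the integral sign. -/
theorem abs_sq_posPart_sub_le (a b : ℝ) :
    |max 0 b ^ 2 - max 0 a ^ 2 - 2 * max 0 a * (b - a)| ≤ (b - a) ^ 2 := by
  rw [abs_le]
  rcases max_cases 0 a with ⟨h1, h2⟩ | ⟨h1, h2⟩ <;> rcases max_cases 0 b with ⟨h3, h4⟩ | ⟨h3, h4⟩ <;>
    rw [h1, h3] <;> constructor <;> nlinarith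

theorem hasDerivAt_of_abs_sub_le_sq {f : ℝ → ℝ} {f' t C : ℝ}
    (h : ∀ s, |f s - f t - f' * (s - t)| ≤ C * (s - t) ^ 2) : HasDerivAt f f' t := by
  rw [hasDerivAt_iff_isLittleO]
  have h1 : (fun s => f s - f t - (s - t) • f') =O[nhds t] fun s => (s - t) ^ 2 :=
    Asymptotics.IsBigO.of_bound C (Filter.Eventually.of_forall fun s => by
      rw [Real.norm_eq_abs, Real.norm_eq_abs, abs_of_nonneg (sq_nonneg (s - t)), smul_eq_mul,
        mul_comm (s - t)]
      exact h s)
  refine h1.trans_isLittleO ?_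
  have h2 := Asymptotics.isLittleO_pow_sub_sub t one_lt_two
  simpa only [Real.norm_eq_abs, sq_abs] using h2

theorem hasDerivAt_sq_posPart_sub (r t : ℝ) :
    HasDerivAt (fun s => max 0 (r - s) ^ 2) (-2 * max 0 (r - t)) t := by
  refine hasDerivAt_of_abs_sub_le_sq (C := 1) fun s => ?_
  have h := abs_sq_posPart_sub_le (r - t) (r - s)
  rw [one_mul, show (s - t) ^ 2 = (r - s - (r - t)) ^ 2 by ring]
  convert h using 2
  ring

end PositivePart

/-! ### The extended distance as a real-valued function. -/

section DistReal

variable {M : Type*} [EMetricSpace M]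

/-- The distance to `p` as a real-valued function, `0` where it is infinite. -/
def distReal (p q : M) : ℝ := (edist p q).toReal

theorem distReal_nonneg (p q : M) : 0 ≤ distReal p q := ENNReal.toReal_nonneg

/-- Two points at finite distance from each other are at finite distance from `p` both or neither;
in the latter case both values are `0`. -/
theorem lipschitzWith_distReal (p : M) : LipschitzWith 1 (distReal p) := by
  intro a b
  rw [ENNReal.coe_one, one_mul]
  by_cases hab : edist a b = ⊤
  · rw [hab]; exact le_top
  have h1 : edist p b ≤ edist p a + edist a b := edist_triangle _ _ _
  have h2 : edist p a ≤ edist p b + edist a b := by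
    rw [edist_comm a b]; exact edist_triangle _ _ _
  by_cases ha : edist p a = ⊤
  · have hb : edist p b = ⊤ := by
      by_contra hb
      exact absurd (ha ▸ h2) (not_le.2 (ENNReal.add_lt_top.2 ⟨Ne.lt_top hb, Ne.lt_top hab⟩))
    simp [distReal, ha, hb]
  · have hb : edist p b ≠ ⊤ := ne_top_of_le_ne_top (ENNReal.add_ne_top.2 ⟨ha, hab⟩) h1
    rw [edist_dist, Real.dist_eq, ← ENNReal.ofReal_toReal hab]
    refine ENNReal.ofReal_le_ofReal (abs_sub_le_iff.2 ⟨?_, ?_⟩)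
    · have := ENNReal.toReal_mono (ENNReal.add_ne_top.2 ⟨hb, hab⟩) h2
      rw [ENNReal.toReal_add hb hab] at this
      simp only [distReal]
      linarith
    · have := ENNReal.toReal_mono (ENNReal.add_ne_top.2 ⟨ha, hab⟩) h1
      rw [ENNReal.toReal_add ha hab] at this
      simp only [distReal]
      linarith

theorem abs_distReal_sub_le (p : M) {a b : M} (h : edist a b ≠ ⊤) :
    |distReal p a - distReal p b| ≤ distReal a b := by
  have h1 := lipschitzWith_distReal p a b
  rw [ENNReal.coe_one, one_mul, edist_dist, Real.dist_eq] at h1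
  exact (ENNReal.ofReal_le_iff_le_toReal h).1 h1

/-- The points at finite distance from `p` form a clopen set. Hence `distReal` is the true distance
on the closure of a connected set, although `M` may be disconnected. -/
theorem edist_ne_top_of_isPreconnected {E : Set M} (hE : IsPreconnected E) {p q : M}
    (hp : p ∈ E) (hq : q ∈ closure E) : edist p q ≠ ⊤ := by
  have hcl : IsClopen (Metric.eball p ⊤) := ⟨Metric.isClosed_eball_top, Metric.isOpen_eball⟩
  have h1 : E ⊆ Metric.eball p ⊤ :=
    hE.subset_isClopen hcl ⟨p, hp, Metric.mem_eball_self ENNReal.zero_lt_top⟩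
  have h2 := closure_minimal h1 hcl.1 hq
  rw [Metric.mem_eball, edist_comm] at h2
  exact h2.ne

end DistReal

/-! ### The monotonicity formula. -/

section Monotonicity

variable {m : ℕ} {M : Type*} [EMetricSpace M] [SecondCountableTopology M] [MeasurableSpace M]
  [BorelSpace M] [ChartedSpace (Euc m) M] [IsManifold (𝓡 m) ∞ M]
  [RiemannianBundle (fun p : M => TangentSpace (𝓡 m) p)] [IsRiemannianManifold (𝓡 m) M]
  {x : M → Euc (m + 1)}

theorem eventually_eball_subset {U : Set M} (hU : IsOpen U) {q : M} (hq : q ∈ U) :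
    ∀ᶠ s in nhdsWithin (0 : ℝ) (Ioi 0), Metric.eball q (ENNReal.ofReal s) ⊆ U := by
  obtain ⟨ε, hε, hεU⟩ := EMetric.isOpen_iff.1 hU q hq
  have h : Filter.Tendsto ENNReal.ofReal (nhdsWithin 0 (Ioi 0)) (nhds 0) := by
    have := (ENNReal.continuous_ofReal.tendsto 0).mono_left (nhdsWithin_le_nhds (s := Ioi (0 : ℝ)))
    rwa [ENNReal.ofReal_zero] at this
  filter_upwards [h.eventually (gt_mem_nhds hε)] with s hs
  exact (Metric.eball_subset_eball (le_of_lt hs)).trans hεU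

theorem IsIsometricImmersion.norm_sub_le_distReal (hx : IsIsometricImmersion x) {p q : M}
    (h : edist p q ≠ ⊤) : ‖x q - x p‖ ≤ distReal p q := by
  have h1 := hx.edist_le p q
  rw [edist_comm, edist_dist, dist_eq_norm] at h1
  exact (ENNReal.ofReal_le_iff_le_toReal h).1 h1

theorem IsIsometricImmersion.mdifferentiableAt_coord (hx : IsIsometricImmersion x)
    (k : Fin (m + 1)) (q : M) : MDifferentiableAt (𝓡 m) 𝓘(ℝ, ℝ) (fun z => x z k) q :=
  (hx.contMDiff_coord k).contMDiffAt.mdifferentiableAt (by simp)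

theorem integrableOn_of_abs_le {μ : Measure M} {E : Set M} (hE : MeasurableSet E)
    (hμ : μ E ≠ ⊤) {f : M → ℝ} (hf : Continuous f) {C : ℝ} (hC : ∀ q ∈ E, |f q| ≤ C) :
    IntegrableOn f E μ := by
  have : IsFiniteMeasure (μ.restrict E) := ⟨by rwa [Measure.restrict_apply_univ, lt_top_iff_ne_top]⟩
  exact Integrable.of_bound hf.aestronglyMeasurable C
    ((ae_restrict_iff' hE).2 (Filter.Eventually.of_forall hC))

/-- The integral `∫_E (r - ρ)₊² dμ`. -/
def coneIntegral (x : M → Euc (m + 1)) (E : Set M) (q : M) (r : ℝ) : ℝ :=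
  ∫ z in E, max 0 (r - distReal q z) ^ 2 ∂weightedMeasure x

theorem continuous_distReal (q : M) : Continuous (distReal q) := (lipschitzWith_distReal q).continuous

theorem continuous_posPart_sub_distReal (q : M) (r : ℝ) :
    Continuous fun z => max 0 (r - distReal q z) :=
  continuous_const.max (continuous_const.sub (continuous_distReal q))

theorem posPart_sub_distReal_le (q z : M) {r : ℝ} (hr : 0 ≤ r) :
    max 0 (r - distReal q z) ≤ r :=
  max_le hr (sub_le_self _ (distReal_nonneg q z))

theorem integrableOn_posPart {E : Set M} (hE : MeasurableSet E)
    (hμ : weightedMeasure x E ≠ ⊤) (q : M) (r : ℝ) :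
    IntegrableOn (fun z => max 0 (r - distReal q z)) E (weightedMeasure x) :=
  integrableOn_of_abs_le hE hμ (continuous_posPart_sub_distReal q r) (C := |r|) fun z _ => by
    rw [abs_of_nonneg (le_max_left _ _)]
    exact max_le (abs_nonneg r) (by linarith [le_abs_self r, distReal_nonneg q z])

theorem integrableOn_sq_posPart {E : Set M} (hE : MeasurableSet E)
    (hμ : weightedMeasure x E ≠ ⊤) (q : M) (r : ℝ) :
    IntegrableOn (fun z => max 0 (r - distReal q z) ^ 2) E (weightedMeasure x) :=
  integrableOn_of_abs_le hE hμ ((continuous_posPart_sub_distReal q r).pow 2) (C := |r| ^ 2)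
    fun z _ => by
      rw [abs_of_nonneg (sq_nonneg _)]
      exact pow_le_pow_left₀ (le_max_left _ _)
        (max_le (abs_nonneg r) (by linarith [le_abs_self r, distReal_nonneg q z])) 2

/-- The quadratic bound of `abs_sq_posPart_sub_le`, integrated over a set of finite measure. -/
theorem hasDerivAt_coneIntegral {E : Set M} (hE : MeasurableSet E)
    (hμ : weightedMeasure x E ≠ ⊤) (q : M) (r : ℝ) :
    HasDerivAt (coneIntegral x E q)
      (2 * ∫ z in E, max 0 (r - distReal q z) ∂weightedMeasure x) r := by
  refine hasDerivAt_of_abs_sub_le_sq (C := (weightedMeasure x).real E) fun s => ?_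
  have h1 := integrableOn_sq_posPart hE hμ q r
  have h2 := integrableOn_sq_posPart hE hμ q s
  have h3 := integrableOn_posPart hE hμ q r
  have h21 : IntegrableOn (fun z => max 0 (s - distReal q z) ^ 2 - max 0 (r - distReal q z) ^ 2) E
      (weightedMeasure x) := h2.sub h1
  have heq : coneIntegral x E q s - coneIntegral x E q r -
      2 * (∫ z in E, max 0 (r - distReal q z) ∂weightedMeasure x) * (s - r) =
      ∫ z in E, (max 0 (s - distReal q z) ^ 2 - max 0 (r - distReal q z) ^ 2 -
        2 * (s - r) * max 0 (r - distReal q z)) ∂weightedMeasure x := by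
    rw [integral_sub h21 (h3.const_mul _), integral_sub h2 h1, integral_const_mul,
      coneIntegral, coneIntegral]
    ring
  rw [heq, mul_comm _ ((s - r) ^ 2), ← Real.norm_eq_abs]
  refine norm_setIntegral_le_of_norm_le_const hμ.lt_top fun z _ => ?_
  have h := abs_sq_posPart_sub_le (r - distReal q z) (s - distReal q z)
  rw [sub_sub_sub_cancel_right] at h
  rw [Real.norm_eq_abs, mul_right_comm]
  exact h

theorem riemGradient_sub_const {u : M → ℝ} {q : M} (a : ℝ)
    (hu : MDifferentiableAt (𝓡 m) 𝓘(ℝ, ℝ) u q) :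
    riemGradient (m := m) (fun z => u z - a) q = riemGradient (m := m) u q := by
  have h := riemGradient_comp (g := fun t => t - a) ((hasDerivAt_id (u q)).sub_const a) hu
  rwa [one_smul] at h

variable [CompleteSpace M]

/-- Test the tangential part `V` of `x - x(q)` with `(r - ρ)₊²`. Its weighted divergence is `m +
x_{m+1} - x_{m+1}(q) ≥ m - ρ`, and `|⟨∇ρ, V⟩| ≤ ρ`, since intrinsic distance dominates extrinsic
distance. -/
theorem IsTranslator.coneIntegral_le (hx : IsTranslator x) {E : Set M} (hE : IsOpen E)
    (hμ : weightedMeasure x E ≠ ⊤) {q : M} (hq : ∀ z ∈ closure E, edist q z ≠ ⊤)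
    (hfr : ∀ z ∈ frontier E, 1 < distReal q z) {r : ℝ} (hr1 : r ≤ 1) :
    (m + 2 - r) * coneIntegral x E q r ≤
      r * (2 * ∫ z in E, max 0 (r - distReal q z) ∂weightedMeasure x) := by
  have hx' := hx.toIsIsometricImmersion
  have hρL := lipschitzWith_distReal q
  have hρC : ChartLipschitz m (distReal q) := hx'.chartLipschitz_of_lipschitzWith hρL
  have hgC : ChartLipschitz m fun z => max 0 (r - distReal q z) := by
    refine hx'.chartLipschitz_of_lipschitzWith (L := 1) (LipschitzWith.const_max ?_ 0)
    have h1 : LipschitzWith 1 fun t : ℝ => r - t := LipschitzWith.of_dist_le_mul fun a b => by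
      rw [Real.dist_eq, sub_sub_sub_cancel_left, NNReal.coe_one, one_mul, dist_comm, Real.dist_eq]
    have h2 := h1.comp hρL
    rwa [one_mul] at h2
  have huC : ChartLipschitz m fun z => max 0 (r - distReal q z) ^ 2 := by
    simpa only [sq] using hgC.mul hgC
  obtain ⟨hint, hint0⟩ := hx.setIntegral_inner_sum_smul_coordGradient hE
    (isCompact_closedEBall m q 1) huC (fun z hz => by
      filter_upwards [(continuous_distReal q).continuousAt.eventually (lt_mem_nhds (hfr z hz))]
        with y hy
      simp only [Pi.zero_apply]
      rw [max_eq_left (by linarith), zero_pow two_ne_zero])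
    (fun z hz hzL => by
      rw [Metric.mem_closedEBall, not_le, edist_comm] at hzL
      have h1 : 1 < distReal q z := by
        have := (ENNReal.toReal_lt_toReal ENNReal.coe_ne_top (hq z (subset_closure hz))).2 hzL
        rwa [ENNReal.coe_one, ENNReal.toReal_one] at this
      rw [max_eq_left (by linarith), zero_pow two_ne_zero])
    (c := fun k z => x z k - x q k) (fun k => (hx'.contMDiff_coord k).sub contMDiff_const)
  have h1 := integrableOn_posPart hE.measurableSet hμ q r
  have h2 := integrableOn_sq_posPart hE.measurableSet hμ q r
  have hle : ∀ᵐ z ∂weightedMeasure x, z ∈ E →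
      (m + 2 - r) * max 0 (r - distReal q z) ^ 2 - r * 2 * max 0 (r - distReal q z) ≤
      inner ℝ (riemGradient (m := m) (fun z => max 0 (r - distReal q z) ^ 2) z)
        (∑ k, (x z k - x q k) • coordGradient x k z) + max 0 (r - distReal q z) ^ 2 *
        (∑ k, inner ℝ (riemGradient (m := m) (fun z => x z k - x q k) z) (coordGradient x k z) +
        (x z (Fin.last m) - x q (Fin.last m))) := by
    filter_upwards [hρC.ae_mdifferentiableAt_weighted hx'] with z hz hzE
    have hd := hx'.norm_sub_le_distReal (hq z (subset_closure hzE))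
    have hV : ‖∑ k, (x z k - x q k) • coordGradient x k z‖ ≤ distReal q z :=
      (hx'.norm_sum_smul_coordGradient_le z (x z - x q)).trans hd
    have hh : -distReal q z ≤ x z (Fin.last m) - x q (Fin.last m) :=
      (abs_le.1 ((PiLp.norm_apply_le (x z - x q) (Fin.last m)).trans hd)).1
    have hsum : ∑ k, inner ℝ (riemGradient (m := m) (fun z => x z k - x q k) z)
        (coordGradient x k z) = m := by
      rw [← hx'.sum_norm_sq_coordGradient z]
      refine Finset.sum_congr rfl fun k _ => ?_
      rw [riemGradient_sub_const _ (hx'.mdifferentiableAt_coord k z)]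
      exact real_inner_self_eq_norm_sq _
    have hgrad := riemGradient_comp (hasDerivAt_sq_posPart_sub r (distReal q z)) hz
    have hin : -distReal q z ≤ -inner ℝ (riemGradient (m := m) (distReal q) z)
        (∑ k, (x z k - x q k) • coordGradient x k z) := by
      have h3 := (real_inner_le_norm (riemGradient (m := m) (distReal q) z)
        (∑ k, (x z k - x q k) • coordGradient x k z)).trans
        (mul_le_mul (hx'.norm_riemGradient_le hρL hz) hV (norm_nonneg _) NNReal.zero_le_coe)
      rw [NNReal.coe_one, one_mul] at h3
      linarith
    rw [hgrad, hsum, real_inner_smul_left]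
    rcases max_cases 0 (r - distReal q z) with ⟨ha, -⟩ | ⟨ha, ha'⟩
    · rw [ha]; simp
    · rw [ha]
      have := distReal_nonneg q z
      -- With `a = r - ρ > 0` the integrand is at least `-2aρ + a²(m - ρ) ≥ (m + 2 - r)a² - 2ra`,
      -- because `-2aρ = 2a² - 2ra` and `ρ ≤ r`.
      have h3 := mul_le_mul_of_nonneg_left hin (mul_nonneg two_pos.le ha'.le)
      have h4 := mul_le_mul_of_nonneg_left hh (sq_nonneg (r - distReal q z))
      nlinarith [mul_nonneg (sq_nonneg (r - distReal q z)) ha'.le]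
  have h21 : IntegrableOn (fun z => (m + 2 - r) * max 0 (r - distReal q z) ^ 2 -
    r * 2 * max 0 (r - distReal q z)) E (weightedMeasure x) :=
    (h2.const_mul (m + 2 - r)).sub (h1.const_mul (r * 2))
  have h3 := setIntegral_mono_on_ae h21 hint hE.measurableSet hle
  rw [hint0, integral_sub (h2.const_mul _) (h1.const_mul _), integral_const_mul,
    integral_const_mul] at h3
  rw [coneIntegral]
  linarith

/-- The derivative has the sign of `r I' - (m + 2 - r) I`, where `I` is the cone integral; the
factor `eʳ` absorbs the `-r`. -/
theorem IsTranslator.monotoneOn_coneIntegral (hx : IsTranslator x) {E : Set M} (hE : IsOpen E)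
    (hμ : weightedMeasure x E ≠ ⊤) {q : M} (hq : ∀ z ∈ closure E, edist q z ≠ ⊤)
    (hfr : ∀ z ∈ frontier E, 1 < distReal q z) :
    MonotoneOn (fun r => coneIntegral x E q r * Real.exp r / r ^ (m + 2)) (Ioc 0 1) := by
  have hder : ∀ r ∈ Ioc (0 : ℝ) 1, HasDerivAt
      (fun r => coneIntegral x E q r * Real.exp r / r ^ (m + 2)) _ r := fun r hr =>
    ((hasDerivAt_coneIntegral hE.measurableSet hμ q r).mul (Real.hasDerivAt_exp r)).div
      (hasDerivAt_pow (m + 2) r) (pow_pos hr.1 _).ne'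
  refine monotoneOn_of_deriv_nonneg (convex_Ioc 0 1)
    (fun r hr => (hder r hr).continuousAt.continuousWithinAt)
    (fun r hr => (hder r (interior_subset hr)).differentiableAt.differentiableWithinAt)
    fun r hr => ?_
  have hr' := interior_subset hr
  rw [(hder r hr').deriv]
  refine div_nonneg ?_ (sq_nonneg _)
  have h := hx.coneIntegral_le hE hμ hq hfr hr'.2
  have hp : 0 ≤ Real.exp r * r ^ (m + 1) := mul_nonneg (Real.exp_pos r).le (pow_pos hr'.1 _).le
  have h2 := mul_nonneg hp (sub_nonneg.2 h)
  rw [show m + 2 - 1 = m + 1 by omega, pow_succ r (m + 1)]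
  simp only [Pi.mul_apply]
  push_cast
  refine h2.trans_eq ?_
  ring

/-- Unit balls inside a set of finite weighted volume have weighted volume bounded below. -/
theorem IsTranslator.densityConst_mul_exp_le (hx : IsTranslator x) {E : Set M} (hE : IsOpen E)
    (hμ : weightedMeasure x E ≠ ⊤) {q : M} (hqE : q ∈ E) (hq : ∀ z ∈ closure E, edist q z ≠ ⊤)
    (hfr : ∀ z ∈ frontier E, 1 < distReal q z) :
    densityConst m * Real.exp (x q (Fin.last m)) / 2 ^ (m + 2) ≤
      (weightedMeasure x).real (E ∩ {z | distReal q z ≤ 1}) * Real.exp 1 := by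
  have hx' := hx.toIsIsometricImmersion
  obtain ⟨s, ⟨hs0, hs1⟩, hBE, hsμ⟩ := (Filter.Eventually.and
    (Ioo_mem_nhdsGT (show (0 : ℝ) < 1 / 2 by norm_num)) ((eventually_eball_subset hE hqE).and
      (hx'.eventually_le_weightedMeasure_eball q))).exists
  set B := Metric.eball q (ENNReal.ofReal s) with hB
  have hBm : MeasurableSet B := Metric.isOpen_eball.measurableSet
  have hBμ : weightedMeasure x B ≠ ⊤ := ne_top_of_le_ne_top hμ (measure_mono hBE)
  have hlow : densityConst m * Real.exp (x q (Fin.last m)) * s ^ m ≤ (weightedMeasure x).real B :=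
    (ENNReal.ofReal_le_iff_le_toReal hBμ).1 hsμ
  -- On the ball of radius `s` one has `2s - ρ ≥ s`. Using the radius `2s` costs the factor
  -- `2^(m+2)` of the conclusion.
  have h1 : (weightedMeasure x).real B * s ^ 2 ≤ coneIntegral x E q (2 * s) := by
    have h2 := integrableOn_sq_posPart hE.measurableSet hμ q (2 * s)
    refine le_trans ?_ (setIntegral_mono_set h2 (Filter.Eventually.of_forall fun z => sq_nonneg _)
      hBE.eventuallyLE)
    refine setIntegral_ge_of_const_le hBm hBμ (fun z hz => ?_) (h2.mono_set hBE)
    rw [hB, Metric.mem_eball, edist_comm] at hz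
    have h3 : distReal q z < s := (ENNReal.lt_ofReal_iff_toReal_lt hz.ne_top).1 hz
    exact pow_le_pow_left₀ hs0.le (le_max_of_le_right (by linarith)) 2
  have h2 : coneIntegral x E q 1 ≤ (weightedMeasure x).real (E ∩ {z | distReal q z ≤ 1}) := by
    have hm : MeasurableSet {z | distReal q z ≤ 1} :=
      (isClosed_le (continuous_distReal q) continuous_const).measurableSet
    rw [coneIntegral, ← setIntegral_one_eq_measureReal, ← setIntegral_indicator hm]
    refine setIntegral_mono_on (integrableOn_sq_posPart hE.measurableSet hμ q 1) ?_
      hE.measurableSet fun z _ => ?_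
    · refine Integrable.indicator ?_ hm
      exact integrableOn_const hμ
    · by_cases hz : distReal q z ≤ 1
      · rw [indicator_of_mem (show z ∈ {z | distReal q z ≤ 1} from hz)]
        exact pow_le_one₀ (le_max_left _ _) (posPart_sub_distReal_le q z zero_le_one)
      · rw [indicator_of_notMem (show z ∉ {z | distReal q z ≤ 1} from hz),
          max_eq_left (by linarith), zero_pow two_ne_zero]
  have h3 := hx.monotoneOn_coneIntegral hE hμ hq hfr (a := 2 * s) (b := 1)
    ⟨by linarith, by linarith⟩ ⟨one_pos, le_rfl⟩ (by linarith)
  simp only [one_pow, div_one] at h3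
  have hc := densityConst_pos (m := m)
  refine le_trans ?_ (h3.trans (mul_le_mul_of_nonneg_right h2 (Real.exp_pos 1).le))
  rw [div_le_div_iff₀ (by positivity) (by positivity)]
  have h4 : 1 ≤ Real.exp (2 * s) := Real.one_le_exp (by linarith)
  have h5 : densityConst m * Real.exp (x q (Fin.last m)) * s ^ m * s ^ 2 ≤
      coneIntegral x E q (2 * s) * Real.exp (2 * s) := by
    have h6 := (mul_le_mul_of_nonneg_right hlow (sq_nonneg s)).trans h1
    have h7 : 0 ≤ coneIntegral x E q (2 * s) := by refine le_trans ?_ h6; positivity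
    exact h6.trans (le_mul_of_one_le_right h7 h4)
  calc _ = densityConst m * Real.exp (x q (Fin.last m)) * s ^ m * s ^ 2 * 2 ^ (m + 2) := by ring
    _ ≤ _ := mul_le_mul_of_nonneg_right h5 (by positivity)

end Monotonicity

/-! ### The barrier function. -/

section Barrier

variable {m : ℕ} {M : Type*} [TopologicalSpace M] [ChartedSpace (Euc m) M] [IsManifold (𝓡 m) ∞ M]
  [RiemannianBundle (fun p : M => TangentSpace (𝓡 m) p)] {x : M → Euc (m + 1)}

theorem riemGradient_const (a : ℝ) (q : M) : riemGradient (m := m) (fun _ => a) q = 0 := by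
  refine ext_inner_right ℝ fun w => ?_
  rw [inner_zero_left, inner_riemGradient, mfderiv_const]
  rfl

theorem riemGradient_sum {ι : Type*} (s : Finset ι) {u : ι → M → ℝ}
    (hu : ∀ k, ContMDiff (𝓡 m) 𝓘(ℝ, ℝ) ∞ (u k)) (q : M) :
    riemGradient (m := m) (fun z => ∑ k ∈ s, u k z) q = ∑ k ∈ s, riemGradient (m := m) (u k) q := by
  classical
  induction s using Finset.induction_on with
  | empty => simpa using riemGradient_const (m := m) 0 q
  | insert a s ha ih =>
    simp only [Finset.sum_insert ha]
    rw [riemGradient_add ((hu a).contMDiffAt.mdifferentiableAt (by simp))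
      ((contMDiff_finsetSum fun k _ => hu k).contMDiffAt.mdifferentiableAt (by simp)), ih]

/-- The functions `xₖ²`, `k ≤ m`, and `-x_{m+1}`, whose sum is the barrier. -/
def barrierTerm (x : M → Euc (m + 1)) (k : Fin (m + 1)) (q : M) : ℝ :=
  if k = Fin.last m then -x q k else x q k ^ 2

/-- The coefficients of the gradient of the barrier. -/
def barrierCoeff (x : M → Euc (m + 1)) (k : Fin (m + 1)) (q : M) : ℝ :=
  if k = Fin.last m then -1 else 2 * x q k

/-- The barrier `x₁² + ⋯ + x_m² - x_{m+1}`. -/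
def barrier (x : M → Euc (m + 1)) (q : M) : ℝ := ∑ k, barrierTerm x k q

theorem IsIsometricImmersion.contMDiff_barrierTerm (hx : IsIsometricImmersion x)
    (k : Fin (m + 1)) : ContMDiff (𝓡 m) 𝓘(ℝ, ℝ) ∞ (barrierTerm x k) := by
  unfold barrierTerm
  split_ifs
  · exact (hx.contMDiff_coord k).neg
  · exact (hx.contMDiff_coord k).pow 2

theorem IsIsometricImmersion.contMDiff_barrierCoeff (hx : IsIsometricImmersion x)
    (k : Fin (m + 1)) : ContMDiff (𝓡 m) 𝓘(ℝ, ℝ) ∞ (barrierCoeff x k) := by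
  unfold barrierCoeff
  split_ifs
  · exact contMDiff_const
  · exact contMDiff_const.mul (hx.contMDiff_coord k)

theorem IsIsometricImmersion.contMDiff_barrier (hx : IsIsometricImmersion x) :
    ContMDiff (𝓡 m) 𝓘(ℝ, ℝ) ∞ (barrier x) :=
  contMDiff_finsetSum fun k _ => hx.contMDiff_barrierTerm k

theorem IsIsometricImmersion.riemGradient_barrier (hx : IsIsometricImmersion x) (q : M) :
    riemGradient (m := m) (barrier x) q = ∑ k, barrierCoeff x k q • coordGradient x k q := by
  refine (riemGradient_sum Finset.univ hx.contMDiff_barrierTerm q).trans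
    (Finset.sum_congr rfl fun k _ => ?_)
  have hd := (hx.contMDiff_coord k).contMDiffAt.mdifferentiableAt (x := q) (by simp)
  unfold barrierTerm barrierCoeff
  split_ifs
  · exact riemGradient_comp (hasDerivAt_neg (x q k)) hd
  · have h := riemGradient_comp (u := fun z => x z k) (g := fun t => t ^ 2) (hasDerivAt_pow 2 (x q k)) hd
    simpa [coordGradient] using h

/-- The gradient of the barrier is the tangential part of `2x - (1 + 2x_{m+1})e_{m+1}`. Linear
growth is what cutoffs of slope `1/R` can compensate. -/
theorem IsIsometricImmersion.norm_sum_barrierCoeff_le (hx : IsIsometricImmersion x) (q : M) :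
    ‖∑ k, barrierCoeff x k q • coordGradient x k q‖ ≤ 4 * ‖x q‖ + 1 := by
  have hc : (WithLp.toLp 2 fun k => barrierCoeff x k q : Euc (m + 1)) =
      (2 : ℝ) • x q + EuclideanSpace.single (Fin.last m) (-1 - 2 * x q (Fin.last m)) := by
    ext k
    by_cases hk : k = Fin.last m
    · subst hk; simp [barrierCoeff]
    · simp [barrierCoeff, hk]
  refine (hx.norm_sum_smul_coordGradient_le q (WithLp.toLp 2 fun k => barrierCoeff x k q)).trans ?_
  rw [hc]
  refine (norm_add_le _ _).trans ?_
  rw [norm_smul, PiLp.norm_single, Real.norm_eq_abs, Real.norm_eq_abs, abs_two]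
  have h1 := abs_sub (-1 : ℝ) (2 * x q (Fin.last m))
  rw [abs_neg, abs_one, abs_mul, abs_two] at h1
  have h2 := PiLp.norm_apply_le (x q) (Fin.last m)
  rw [Real.norm_eq_abs] at h2
  linarith

/-- On a translator the right-hand side is the weighted Laplacian of the barrier. It equals `2(m -
|∇x_{m+1}|²) - 1 ≥ 2m - 3`, since `|∇x_{m+1}| ≤ 1`. This is where `m ≥ 2` enters. -/
theorem IsIsometricImmersion.one_le_sum_inner_barrierCoeff (hx : IsIsometricImmersion x)
    (hm : 2 ≤ m) (q : M) :
    1 ≤ ∑ k, inner ℝ (riemGradient (m := m) (barrierCoeff x k) q) (coordGradient x k q) +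
      barrierCoeff x (Fin.last m) q := by
  have h1 : ∀ k, inner ℝ (riemGradient (m := m) (barrierCoeff x k) q) (coordGradient x k q) =
      2 * ‖coordGradient x k q‖ ^ 2 -
        if k = Fin.last m then 2 * ‖coordGradient x k q‖ ^ 2 else 0 := by
    intro k
    unfold barrierCoeff
    split_ifs
    · rw [riemGradient_const, inner_zero_left, sub_self]
    · have hd := (hx.contMDiff_coord k).contMDiffAt.mdifferentiableAt (x := q) (by simp)
      have h := riemGradient_comp (u := fun z => x z k) (g := fun t => 2 * t)
        ((hasDerivAt_id (x q k)).const_mul 2) hd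
      rw [mul_one] at h
      rw [h, real_inner_smul_left, sub_zero]
      exact congrArg _ (real_inner_self_eq_norm_sq _)
  have h2 := hx.norm_sq_normalProj_single (Fin.last m) q
  have h3 := sq_nonneg ‖normalProj x q (EuclideanSpace.single (Fin.last m) (1 : ℝ))‖
  have h4 : (2 : ℝ) ≤ m := by exact_mod_cast hm
  simp only [h1, Finset.sum_sub_distrib, ← Finset.mul_sum, hx.sum_norm_sq_coordGradient,
    Finset.sum_ite_eq', Finset.mem_univ, if_true, barrierCoeff]
  linarith

/-- Turns an upper bound for the barrier into a lower bound for the height, hence for the weight. -/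
theorem neg_coord_le_barrier (x : M → Euc (m + 1)) (q : M) : -x q (Fin.last m) ≤ barrier x q := by
  rw [barrier, ← Finset.add_sum_erase _ _ (Finset.mem_univ (Fin.last m)), barrierTerm, if_pos rfl]
  refine le_add_of_nonneg_right (Finset.sum_nonneg fun k hk => ?_)
  rw [barrierTerm, if_neg (Finset.ne_of_mem_erase hk)]
  exact sq_nonneg _

end Barrier

/-! ### Cutoff functions of the distance. -/

section Cutoff

/-- The piecewise linear cutoff that is `1` on `(-∞, R]` and `0` on `[2R, ∞)`. -/
def cutoff (R : NNReal) (t : ℝ) : ℝ := max 0 (min 1 (2 - t / R))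

theorem lipschitzWith_cutoff (R : NNReal) : LipschitzWith R⁻¹ (cutoff R) := by
  refine LipschitzWith.const_max (LipschitzWith.const_min ?_ 1) 0
  refine LipschitzWith.of_dist_le_mul fun a b => ?_
  rw [dist_comm, Real.dist_eq, Real.dist_eq, sub_sub_sub_cancel_left, ← sub_div, abs_div,
    NNReal.abs_eq, NNReal.coe_inv, div_eq_inv_mul]

theorem cutoff_nonneg (R : NNReal) (t : ℝ) : 0 ≤ cutoff R t := le_max_left _ _

theorem cutoff_le_one (R : NNReal) (t : ℝ) : cutoff R t ≤ 1 := max_le zero_le_one (min_le_left _ _)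

theorem cutoff_eq_one {R : NNReal} {t : ℝ} (ht : t ≤ R) : cutoff R t = 1 := by
  have h : t / R ≤ 1 := div_le_one_of_le₀ ht R.2
  rw [cutoff, min_eq_left (by linarith), max_eq_right zero_le_one]

theorem cutoff_eq_zero {R : NNReal} (hR : 0 < R) {t : ℝ} (ht : 2 * R ≤ t) : cutoff R t = 0 := by
  have h : 2 ≤ t / R := (le_div_iff₀ (by exact_mod_cast hR)).2 ht
  exact max_eq_left ((min_le_right _ _).trans (by linarith))

end Cutoff

/-! ### Tails of a set of finite measure. -/

section Tail

variable {M : Type*} [EMetricSpace M] [MeasurableSpace M] [BorelSpace M]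

theorem tendsto_measureReal_tail {μ : Measure M} {E : Set M} (hE : MeasurableSet E)
    (hμ : μ E ≠ ⊤) (p : M) :
    Filter.Tendsto (fun n : ℕ => μ.real (E ∩ {z | (n : ℝ) ≤ distReal p z})) Filter.atTop
      (nhds 0) := by
  have hm : ∀ n : ℕ, MeasurableSet (E ∩ {z | (n : ℝ) ≤ distReal p z}) := fun n =>
    hE.inter (isClosed_le continuous_const (lipschitzWith_distReal p).continuous).measurableSet
  have h := tendsto_measure_iInter_atTop (μ := μ) (fun n => (hm n).nullMeasurableSet)
    (fun a b hab z hz => ⟨hz.1, (show (a : ℝ) ≤ b from Nat.cast_le.2 hab).trans hz.2⟩)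
    ⟨0, ne_top_of_le_ne_top hμ (measure_mono inter_subset_left)⟩
  have h0 : ⋂ n : ℕ, E ∩ {z | (n : ℝ) ≤ distReal p z} = ∅ := by
    refine eq_empty_of_forall_notMem fun z hz => ?_
    obtain ⟨n, hn⟩ := exists_nat_gt (distReal p z)
    exact absurd (mem_iInter.1 hz n).2 (not_le.2 hn)
  rw [h0, measure_empty] at h
  exact (ENNReal.tendsto_toReal ENNReal.zero_ne_top).comp h

end Tail

/-! ### The maximum principle on an end and the infinite volume of ends. -/

section Ends

variable {m : ℕ} {M : Type*} [EMetricSpace M] [SecondCountableTopology M] [MeasurableSpace M]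
  [BorelSpace M] [ChartedSpace (Euc m) M] [IsManifold (𝓡 m) ∞ M]
  [RiemannianBundle (fun p : M => TangentSpace (𝓡 m) p)] [IsRiemannianManifold (𝓡 m) M]
  {x : M → Euc (m + 1)}

theorem IsIsometricImmersion.weightedMeasure_pos_of_isOpen (hx : IsIsometricImmersion x)
    {U : Set M} (hU : IsOpen U) (hne : U.Nonempty) : 0 < weightedMeasure x U := by
  obtain ⟨q, hq⟩ := hne
  obtain ⟨s, hs0, hsU, hsμ⟩ := ((eventually_mem_nhdsWithin (a := (0 : ℝ)) (s := Ioi 0)).and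
    ((eventually_eball_subset hU hq).and (hx.eventually_le_weightedMeasure_eball q))).exists
  have hs0' : 0 < s := hs0
  have hc := densityConst_pos (m := m)
  refine lt_of_lt_of_le (ENNReal.ofReal_pos.2 ?_) (hsμ.trans
    (measure_mono hsU))
  positivity

variable [CompleteSpace M]

/-- With `w` the barrier, `η` the cutoff and `S` the smooth step, test `∇w` with `u = η S(w - c)`.
As `Δ_f w ≥ 1`, this gives `∫u ≤ -∫η S'|∇w|² - ∫S⟨∇η, ∇w⟩`. The first term is not positive; the
second lives on `R ≤ ρ ≤ 2R`, where `|∇η||∇w| ≤ R⁻¹(4(‖x p‖ + 2R) + 1) ≤ 4‖x p‖ + 9`. -/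
theorem IsTranslator.setIntegral_cutoff_le (hx : IsTranslator x) (hm : 2 ≤ m) {E : Set M}
    (hE : IsOpen E) (hμ : weightedMeasure x E ≠ ⊤) {p : M}
    (hp : ∀ z ∈ closure E, edist p z ≠ ⊤) {c : ℝ} (hc : ∀ z ∈ frontier E, barrier x z < c)
    {R : NNReal} (hR : 1 ≤ R) :
    ∫ z in E, cutoff R (distReal p z) * Real.smoothTransition (barrier x z - c)
      ∂weightedMeasure x ≤
      (4 * ‖x p‖ + 9) * (weightedMeasure x).real (E ∩ {z | (R : ℝ) ≤ distReal p z}) := by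
  have hx' := hx.toIsIsometricImmersion
  have hR0 : 0 < R := one_pos.trans_le hR
  have hR0' : (0 : ℝ) < R := hR0
  have hR1' : (1 : ℝ) ≤ R := hR
  have hρc := (lipschitzWith_distReal p).continuous
  have hηL : LipschitzWith R⁻¹ fun z => cutoff R (distReal p z) := by
    have h := (lipschitzWith_cutoff R).comp (lipschitzWith_distReal p)
    rwa [mul_one] at h
  have hηC : ChartLipschitz m fun z => cutoff R (distReal p z) :=
    hx'.chartLipschitz_of_lipschitzWith hηL
  have hχd : ContMDiff (𝓡 m) 𝓘(ℝ, ℝ) ∞ fun z => Real.smoothTransition (barrier x z - c) :=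
    (Real.smoothTransition.contDiff (n := ⊤)).contMDiff.comp
      (hx'.contMDiff_barrier.sub contMDiff_const)
  have huC := hηC.mul hχd.chartLipschitz
  obtain ⟨hint, hint0⟩ := hx.setIntegral_inner_sum_smul_coordGradient hE
    (isCompact_closedEBall m p (2 * R)) huC (fun z hz => by
      filter_upwards [hx'.contMDiff_barrier.continuous.continuousAt.eventually
        (gt_mem_nhds (hc z hz))] with y hy
      rw [Real.smoothTransition.zero_of_nonpos (by linarith), mul_zero, Pi.zero_apply])
    (fun z hz hzL => by
      rw [Metric.mem_closedEBall, not_le, edist_comm] at hzL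
      have h1 : _ < distReal p z := (ENNReal.toReal_lt_toReal ENNReal.coe_ne_top (hp z (subset_closure hz))).2 hzL
      rw [ENNReal.coe_toReal, NNReal.coe_mul, NNReal.coe_ofNat] at h1
      rw [cutoff_eq_zero hR0 h1.le, zero_mul])
    (c := barrierCoeff x) hx'.contMDiff_barrierCoeff
  set u : M → ℝ := fun z => cutoff R (distReal p z) * Real.smoothTransition (barrier x z - c)
    with hu
  have hu0 : ∀ z, 0 ≤ u z := fun z =>
    mul_nonneg (cutoff_nonneg _ _) (Real.smoothTransition.nonneg _)
  have hu1 : ∀ z, u z ≤ 1 := fun z =>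
    mul_le_one₀ (cutoff_le_one _ _) (Real.smoothTransition.nonneg _) (Real.smoothTransition.le_one _)
  set T : Set M := {z | (R : ℝ) ≤ distReal p z} with hT
  have hTm : MeasurableSet T := (isClosed_le continuous_const hρc).measurableSet
  have hui : IntegrableOn u E (weightedMeasure x) :=
    integrableOn_of_abs_le hE.measurableSet hμ huC.continuous (C := 1) fun z _ => by
      rw [abs_of_nonneg (hu0 z)]; exact hu1 z
  have hTi : IntegrableOn (T.indicator fun _ => 4 * ‖x p‖ + 9) E (weightedMeasure x) :=
    Integrable.indicator (integrableOn_const hμ) hTm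
  have hle : ∀ᵐ z ∂weightedMeasure x, z ∈ E → u z - T.indicator (fun _ => 4 * ‖x p‖ + 9) z ≤
      inner ℝ (riemGradient (m := m) u z) (∑ k, barrierCoeff x k z • coordGradient x k z) +
      u z * (∑ k, inner ℝ (riemGradient (m := m) (barrierCoeff x k) z) (coordGradient x k z) +
        barrierCoeff x (Fin.last m) z) := by
    filter_upwards [hηC.ae_mdifferentiableAt_weighted hx'] with z hz hzE
    set V := ∑ k, barrierCoeff x k z • coordGradient x k z with hV
    have h1 : u z ≤ u z * (∑ k, inner ℝ (riemGradient (m := m) (barrierCoeff x k) z)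
        (coordGradient x k z) + barrierCoeff x (Fin.last m) z) :=
      le_mul_of_one_le_right (hu0 z) (hx'.one_le_sum_inner_barrierCoeff hm z)
    have hwd : MDifferentiableAt (𝓡 m) 𝓘(ℝ, ℝ) (barrier x) z :=
      hx'.contMDiff_barrier.contMDiffAt.mdifferentiableAt (by simp)
    have hS : HasDerivAt (fun t => Real.smoothTransition (t - c))
        (deriv Real.smoothTransition (barrier x z - c)) (barrier x z) := by
      have h := (Real.smoothTransition.contDiffAt (x := barrier x z - c) (n := 1)).differentiableAt
        (by simp)
      exact h.hasDerivAt.comp_sub_const _ _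
    have hgχ := riemGradient_comp hS hwd
    rw [hx'.riemGradient_barrier, ← hV] at hgχ
    have hgu := riemGradient_mul hz (hχd.contMDiffAt.mdifferentiableAt (x := z) (by simp))
    rw [hgχ] at hgu
    have hS0 : 0 ≤ deriv Real.smoothTransition (barrier x z - c) :=
      Real.smoothTransition.monotone.deriv_nonneg
    -- The discarded term `η S'|∇w|²` is nonnegative because the step is monotone.
    have h2 : Real.smoothTransition (barrier x z - c) *
        inner ℝ (riemGradient (m := m) (fun z => cutoff R (distReal p z)) z) V ≤
        inner ℝ (riemGradient (m := m) u z) V := by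
      rw [hgu, inner_add_left, real_inner_smul_left, real_inner_smul_left, real_inner_smul_left]
      have := mul_nonneg (cutoff_nonneg R (distReal p z)) (mul_nonneg hS0
        (real_inner_self_nonneg (x := V)))
      linarith
    have h3 : -T.indicator (fun _ => 4 * ‖x p‖ + 9) z ≤ Real.smoothTransition (barrier x z - c) *
        inner ℝ (riemGradient (m := m) (fun z => cutoff R (distReal p z)) z) V := by
      rcases lt_or_ge (distReal p z) R with hlt | hge
      · have h4 : (fun z => cutoff R (distReal p z)) =ᶠ[nhds z] fun _ => 1 := by
          filter_upwards [hρc.continuousAt.eventually (gt_mem_nhds hlt)] with y hy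
          exact cutoff_eq_one hy.le
        rw [riemGradient_congr h4, riemGradient_const, inner_zero_left, mul_zero,
          indicator_of_notMem (show z ∉ T from not_le.2 hlt), neg_zero]
      · rw [indicator_of_mem (show z ∈ T from hge)]
        rcases lt_or_ge (2 * (R : ℝ)) (distReal p z) with hlt | hle
        · have h4 : (fun z => cutoff R (distReal p z)) =ᶠ[nhds z] fun _ => 0 := by
            filter_upwards [hρc.continuousAt.eventually (lt_mem_nhds hlt)] with y hy
            exact cutoff_eq_zero hR0 hy.le
          rw [riemGradient_congr h4, riemGradient_const, inner_zero_left, mul_zero]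
          have := norm_nonneg (x p)
          linarith
        · have h4 := hx'.norm_sub_le_distReal (hp z (subset_closure hzE))
          have h5 : ‖V‖ ≤ 4 * ‖x p‖ + 1 + 8 * R := by
            have h6 := hx'.norm_sum_barrierCoeff_le z
            have h7 := norm_le_norm_add_norm_sub' (x z) (x p)
            linarith
          have h6 : |inner ℝ (riemGradient (m := m) (fun z => cutoff R (distReal p z)) z) V| ≤
              4 * ‖x p‖ + 9 :=
            calc _ ≤ _ := abs_real_inner_le_norm _ _
              _ ≤ (R : ℝ)⁻¹ * (4 * ‖x p‖ + 1 + 8 * R) :=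
                mul_le_mul (hx'.norm_riemGradient_le hηL hz) h5 (norm_nonneg _)
                  (inv_nonneg.2 hR0'.le)
              _ ≤ _ := by
                rw [inv_mul_le_iff₀ hR0']
                have := norm_nonneg (x p)
                nlinarith
          have h7 : |Real.smoothTransition (barrier x z - c) *
              inner ℝ (riemGradient (m := m) (fun z => cutoff R (distReal p z)) z) V| ≤
              4 * ‖x p‖ + 9 := by
            rw [abs_mul, abs_of_nonneg (Real.smoothTransition.nonneg _)]
            exact (mul_le_of_le_one_left (abs_nonneg _) (Real.smoothTransition.le_one _)).trans h6
          exact (abs_le.1 h7).1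
    linarith
  have hsub : IntegrableOn (fun z => u z - T.indicator (fun _ => 4 * ‖x p‖ + 9) z) E
      (weightedMeasure x) := hui.sub hTi
  have h := setIntegral_mono_on_ae hsub hint hE.measurableSet hle
  rw [hint0, integral_sub hui hTi, setIntegral_indicator hTm, setIntegral_const, smul_eq_mul] at h
  linarith

/-- If the barrier exceeded `c` at `q`, the integrals of `setIntegral_cutoff_le` would stay above a
positive constant as the cutoff radius grows, while their bounds by the tails of `E` tend to `0`. -/
theorem IsTranslator.barrier_le (hx : IsTranslator x) (hm : 2 ≤ m) {E : Set M}
    (hE : IsOpen E) (hμ : weightedMeasure x E ≠ ⊤) {p : M}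
    (hp : ∀ z ∈ closure E, edist p z ≠ ⊤) {c : ℝ} (hc : ∀ z ∈ frontier E, barrier x z < c)
    {q : M} (hq : q ∈ E) : barrier x q ≤ c := by
  have hx' := hx.toIsIsometricImmersion
  by_contra! hcon
  have hρc := (lipschitzWith_distReal p).continuous
  have hwc := hx'.contMDiff_barrier.continuous
  set σ := Real.smoothTransition ((barrier x q - c) / 2) with hσ
  have hσ0 : 0 < σ := Real.smoothTransition.pos_of_pos (by linarith)
  -- A neighbourhood of `q` in `E` on which the smooth step is at least `σ` and every large cutoff
  -- equals `1`.
  set N := E ∩ ({z | distReal p z < distReal p q + 1} ∩ {z | (barrier x q + c) / 2 < barrier x z})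
    with hN
  have hNo : IsOpen N := hE.inter ((isOpen_lt hρc continuous_const).inter
    (isOpen_lt continuous_const hwc))
  have hNμ : weightedMeasure x N ≠ ⊤ := ne_top_of_le_ne_top hμ (measure_mono inter_subset_left)
  have hNpos : 0 < (weightedMeasure x).real N :=
    ENNReal.toReal_pos (hx'.weightedMeasure_pos_of_isOpen hNo
      ⟨q, hq, by simp, by simp only [mem_ofPred_eq]; linarith⟩).ne' hNμ
  have hlow : ∀ n : ℕ, distReal p q + 1 ≤ n → 1 ≤ n → (weightedMeasure x).real N * σ ≤
      (4 * ‖x p‖ + 9) * (weightedMeasure x).real (E ∩ {z | (n : ℝ) ≤ distReal p z}) := by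
    intro n hn hn1
    have hn1' : (1 : NNReal) ≤ n := by exact_mod_cast hn1
    have hcut := hx.setIntegral_cutoff_le hm hE hμ hp hc hn1'
    rw [NNReal.coe_natCast] at hcut
    refine le_trans ?_ hcut
    have hcont : Continuous fun z => cutoff (n : NNReal) (distReal p z) *
        Real.smoothTransition (barrier x z - c) :=
      ((lipschitzWith_cutoff _).continuous.comp hρc).mul
        (Real.smoothTransition.continuous.comp (hwc.sub continuous_const))
    have h0 : ∀ z, 0 ≤ cutoff (n : NNReal) (distReal p z) *
        Real.smoothTransition (barrier x z - c) := fun z =>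
      mul_nonneg (cutoff_nonneg _ _) (Real.smoothTransition.nonneg _)
    have hi := integrableOn_of_abs_le hE.measurableSet hμ hcont (C := 1) fun z _ => by
      rw [abs_of_nonneg (h0 z)]
      exact mul_le_one₀ (cutoff_le_one _ _) (Real.smoothTransition.nonneg _)
        (Real.smoothTransition.le_one _)
    refine le_trans ?_ (setIntegral_mono_set hi (Filter.Eventually.of_forall h0)
      (show N ⊆ E from inter_subset_left).eventuallyLE)
    refine setIntegral_ge_of_const_le hNo.measurableSet hNμ (fun z hz => ?_)
      (hi.mono_set inter_subset_left)
    have hz1 : distReal p z < distReal p q + 1 := hz.2.1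
    have hz2 : (barrier x q + c) / 2 < barrier x z := hz.2.2
    rw [cutoff_eq_one (by rw [NNReal.coe_natCast]; linarith), one_mul]
    exact Real.smoothTransition.monotone (by linarith)
  have hlim := (tendsto_measureReal_tail hE.measurableSet hμ p).const_mul (4 * ‖x p‖ + 9)
  rw [mul_zero] at hlim
  obtain ⟨n₀, hn₀⟩ := exists_nat_ge (distReal p q + 1)
  have hle := ge_of_tendsto hlim (Filter.eventually_atTop.2 ⟨max n₀ 1, fun n hn => hlow n
    (hn₀.trans (by exact_mod_cast (le_max_left n₀ 1).trans hn)) ((le_max_right n₀ 1).trans hn)⟩)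
  exact absurd hle (not_le.2 (mul_pos hNpos hσ0))

/-- An unbounded connected open set with compact frontier has infinite weighted volume. -/
theorem IsTranslator.weightedMeasure_eq_top (hx : IsTranslator x) (hm : 2 ≤ m) {E K : Set M}
    (hE : IsOpen E) (hEc : IsPreconnected E) (hK : IsCompact K) (hEK : frontier E ⊆ K)
    (hnc : ¬ IsCompact (closure E)) : weightedMeasure x E = ⊤ := by
  have hx' := hx.toIsIsometricImmersion
  by_contra hμ
  obtain ⟨p, hpE⟩ : E.Nonempty := by
    by_contra h
    rw [not_nonempty_iff_eq_empty] at h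
    exact hnc (by rw [h, closure_empty]; exact isCompact_empty)
  have hfin : ∀ q ∈ E, ∀ z ∈ closure E, edist q z ≠ ⊤ := fun q hq z hz =>
    edist_ne_top_of_isPreconnected hEc hq hz
  obtain ⟨B, hB⟩ := hK.exists_bound_of_continuousOn hx'.contMDiff_barrier.continuous.continuousOn
  obtain ⟨D, hD⟩ := hK.exists_bound_of_continuousOn (continuous_distReal p).continuousOn
  have hw : ∀ q ∈ E, -(B + 1) ≤ x q (Fin.last m) := fun q hq => by
    have h := hx.barrier_le hm hE hμ (hfin p hpE) (c := B + 1)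
      (fun z hz => lt_of_le_of_lt (le_trans (le_abs_self _) (hB z (hEK hz))) (lt_add_one B)) hq
    linarith [neg_coord_le_barrier x q]
  -- Otherwise the closure of `E` would be a closed subset of a ball that is compact by Hopf–Rinow.
  have hunb : ∀ n : ℕ, ∃ q ∈ E, (n : ℝ) < distReal p q := by
    intro n
    by_contra! h
    refine hnc ((isCompact_closedEBall m p n).of_isClosed_subset isClosed_closure
      (closure_minimal (fun q hq => ?_) Metric.isClosed_closedEBall))
    rw [Metric.mem_closedEBall, edist_comm, ← ENNReal.toReal_le_toReal
      (hfin p hpE q (subset_closure hq)) ENNReal.coe_ne_top]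
    exact (h q hq).trans_eq (by simp)
  set c₀ := densityConst m * Real.exp (-(B + 1)) / 2 ^ (m + 2) with hc₀
  have hc₀0 : 0 < c₀ := by have := densityConst_pos (m := m); positivity
  have hlow : ∀ n : ℕ, D < n →
      c₀ ≤ (weightedMeasure x).real (E ∩ {z | (n : ℝ) ≤ distReal p z}) * Real.exp 1 := by
    intro n hn
    -- The extra `1` keeps the unit ball around `q` in the tail `ρ ≥ n`. The frontier is within `D <
    -- n` of `p`, hence farther than `1` from `q`.
    obtain ⟨q, hq, hqn⟩ := hunb (n + 1)
    push_cast at hqn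
    have h1 := hx.densityConst_mul_exp_le hE hμ hq (hfin q hq) fun z hz => by
      have hzc := frontier_subset_closure hz
      have h2 := (abs_le.1 (abs_distReal_sub_le p (hfin q hq z hzc))).2
      have h3 := (le_abs_self _).trans (hD z (hEK hz))
      linarith
    refine le_trans ?_ (h1.trans ?_)
    · rw [hc₀]
      have := (densityConst_pos (m := m)).le
      gcongr
      exact hw q hq
    · refine mul_le_mul_of_nonneg_right (measureReal_mono (fun z hz => ⟨hz.1, ?_⟩)
        (ne_top_of_le_ne_top hμ (measure_mono inter_subset_left))) (Real.exp_pos 1).le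
      have h2 := (abs_le.1 (abs_distReal_sub_le p (hfin q hq z (subset_closure hz.1)))).2
      have h3 : distReal q z ≤ 1 := hz.2
      simp only [mem_ofPred_eq]
      linarith
  have hlim := (tendsto_measureReal_tail hE.measurableSet hμ p).mul_const (Real.exp 1)
  rw [zero_mul] at hlim
  obtain ⟨n₀, hn₀⟩ := exists_nat_gt D
  have hle := ge_of_tendsto hlim (Filter.eventually_atTop.2 ⟨n₀, fun n hn => hlow n
    (hn₀.trans_le (by exact_mod_cast hn))⟩)
  exact absurd hle (not_le.2 hc₀0)

theorem IsTranslator.weightedMeasure_end (hx : IsTranslator x) (hm : 2 ≤ m) {E : Set M}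
    (hE : IsEnd E) : MeasurableSet E ∧ weightedMeasure x E = ⊤ := by
  obtain ⟨K, hK, ⟨p, hp, rfl⟩, hnc⟩ := hE
  have : LocallyConnectedSpace M := ChartedSpace.locallyConnectedSpace (Euc m) M
  have hEo : IsOpen (connectedComponentIn Kᶜ p) := hK.isClosed.isOpen_compl.connectedComponentIn
  refine ⟨hEo.measurableSet, hx.weightedMeasure_eq_top hm hEo isPreconnected_connectedComponentIn
    hK (fun z hz => ?_) hnc⟩
  -- The frontier of a component lies in `K`: a frontier point outside `K` has an open component of
  -- its own, which meets the given one and therefore equals it.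
  by_contra hzK
  rw [hEo.frontier_eq] at hz
  have hzo : IsOpen (connectedComponentIn Kᶜ z) := hK.isClosed.isOpen_compl.connectedComponentIn
  obtain ⟨y, hyz, hyp⟩ := mem_closure_iff.1 hz.1 _ hzo (mem_connectedComponentIn hzK)
  refine hz.2 ?_
  rw [connectedComponentIn_eq hyp, ← connectedComponentIn_eq hyz]
  exact mem_connectedComponentIn hzK

end Ends

end Hypersurface

end

theorem theorem1p2 {m : ℕ} (hm : 2 ≤ m)
    {M : Type*} [EMetricSpace M] [SecondCountableTopology M] [MeasurableSpace M] [BorelSpace M]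
    [ChartedSpace (Euc m) M] [IsManifold (𝓡 m) ∞ M]
    [RiemannianBundle (fun p : M => TangentSpace (𝓡 m) p)]
    [IsContMDiffRiemannianBundle (𝓡 m) ∞ (Euc m) (fun p : M => TangentSpace (𝓡 m) p)]
    [IsRiemannianManifold (𝓡 m) M] [CompleteSpace M]
    (x : M → Euc (m + 1)) (hx : IsTranslator x)
    (f : M → ℝ) (hf : ∀ p, f p = -x p (Fin.last m)) :
    (∀ φ : M → ℝ, ContMDiff (𝓡 m) 𝓘(ℝ, ℝ) ∞ φ → HasCompactSupport φ →
      Integrable (fun p => φ p ^ 2 * Real.exp (-f p)) (riemannianVolume m M) ∧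
      Integrable (fun p => (1 + ‖meanCurvatureVector x p‖ ^ 2) * φ p ^ 2 * Real.exp (-f p))
        (riemannianVolume m M) ∧
      Integrable (fun p => ‖riemGradient (m := m) φ p‖ ^ 2 * Real.exp (-f p))
        (riemannianVolume m M) ∧
      1 / 4 * ∫ p, φ p ^ 2 * Real.exp (-f p) ∂riemannianVolume m M ≤
        1 / 4 * ∫ p, (1 + ‖meanCurvatureVector x p‖ ^ 2) * φ p ^ 2 * Real.exp (-f p)
          ∂riemannianVolume m M ∧
      1 / 4 * ∫ p, (1 + ‖meanCurvatureVector x p‖ ^ 2) * φ p ^ 2 * Real.exp (-f p)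
          ∂riemannianVolume m M ≤
        ∫ p, ‖riemGradient (m := m) φ p‖ ^ 2 * Real.exp (-f p) ∂riemannianVolume m M) ∧
    (∀ E : Set M, IsEnd E → weightedVolume m f E = ⊤) := by
  have hx' := hx.toIsIsometricImmersion
  refine ⟨fun φ hφ hc => ?_, fun E hE => ?_⟩
  · have h := hx.weighted_poincare hφ hc
    simpa only [hx'.integrable_weightedMeasure, hx'.integral_weightedMeasure, hf, neg_neg] using h
  · obtain ⟨hEm, hE⟩ := hx.weightedMeasure_end hm hE
    rw [weightedVolume_eq hf hEm, hE]
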